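/- Let $n\ge 0$, let $(M,\omega)$ be a smooth symplectic manifold (Hausdorff, second countable, without boundary) of dimension $2n+2$, and let $\mathbf D$ be a smooth vector field on $M$ with $L_{\mathbf D}\omega=\omega$. Suppose that $\mathbf D$ is complete, i.e. generates a smooth global flow $\varphi:\mathbb R\times M\to M$, and that this $\mathbb R$-action is free and proper (the map $(t,x)\mapsto(\varphi_t(x),x)$ is proper). Let $C:=M/\mathbf D$ be the space of orbits with the quotient topology, $\pi:M\to C$ the projection, and $\lambda:=i_{\mathbf D}\omega$. Then $C$ is Hausdorff and second countable and has a structure of smooth manifold of dimension $2n+1$ for which $\pi$ is a smooth submersion; and for every such smooth structure the following hold. (i) There is a distribution $\mathscr D$ on $C$ with $\mathscr D_{\pi(m)}=\pi_*(\ker\lambda_m)$ for every $m\in M$, and $\mathscr D$ is a contact distribution: near every point of $C$ there is a smooth $1$-form $\eta$ with $\mathscr D=\ker\eta$ and $\eta\wedge(d\eta)^n$ nowhere zero (such an $\eta$ is called a local contact form). (ii) $\mathscr D$ carries a conformal symplectic structure, i.e. in each fibre $\mathscr D_c$ a class $[\sigma_c]=\{a\,\sigma_c: a\in\mathbb R,\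 a\neq0\}$ of nondegenerate alternating bilinear forms, where locally $\sigma$ can be chosen as the restriction to $\mathscr D$ of a smooth $2$-form. It is represented by $d\eta|_{\mathscr D}$ for every local contact form $\eta$ on an open subset of $C$, and, for every $m\in M$, on $\mathscr D_{\pi(m)}$ by $(u_1,u_2)\mapsto\omega_m(\tilde u_1,\tilde u_2)$, where $\tilde u_j\in\ker\lambda_m$ is any vector with $\pi_*\tilde u_j=u_j$. (iii) The symplectification $\tilde C:=\{\beta\in T_x^*C:\ x\in C,\ \ker\beta=\mathscr D_x\}\subset T^*C$ is a smoothly embedded submanifold of dimension $2n+2$. Let $\tilde\alpha_\beta(\xi):=\beta((\pi_C)_*\xi)$ be its canonical $1$-form, where $\pi_C:\tilde C\to C$ is the projection. Then $\tilde\alpha$ is smooth and $d\tilde\alpha$ is symplectic. There is a map $F:M\to\tilde C$ such that $F(m)\in T^*_{\pi(m)}C$ and $F(m)(\pi_*v)=\lambda_m(v)$ for all $m\in M$ and $v\in T_mM$; it is a smooth local diffeomorphism with $F^*\tilde\alpha=\lambda$ and $F^*d\tilde\alpha=d\lambda$, i.e. a local exact symplectomorphism from $(M,d\lambda)$ to $(\tilde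 C,d\tilde\alpha)$. -/

import Mathlib

open scoped Manifold ContDiff Topology

noncomputable section

section DifferentialForms

variable {E : Type*} [NormedAddCommGroup E] [NormedSpace ℝ E]
  {E' : Type*} [NormedAddCommGroup E'] [NormedSpace ℝ E']
  {M : Type*} [TopologicalSpace M] [ChartedSpace E M]
  {N : Type*} [TopologicalSpace N] [ChartedSpace E' N] {k : ℕ}

/-- A (not necessarily smooth) differential `k`-form on a manifold `M` without boundary,
modelled on the normed space `E`. -/
abbrev DiffForm (E : Type*) [NormedAddCommGroup E] [NormedSpace ℝ E]
    (M : Type*) [TopologicalSpace M] [ChartedSpace E M] (k : ℕ) : Type _ :=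
  (x : M) → TangentSpace 𝓘(ℝ, E) x [⋀^Fin k]→L[ℝ] ℝ

/-- The pullback `f^* α` of a form under a differentiable map. -/
def DiffForm.pullback (f : M → N) (α : DiffForm E' N k) : DiffForm E M k :=
  fun x => (α (f x)).compContinuousLinearMap (mfderiv 𝓘(ℝ, E) 𝓘(ℝ, E') f x)

/-- The coordinate expression of a form in the preferred chart at `x₀`, that is, its pullback
under the inverse of the chart. It is meaningful on the target of the chart. -/
def DiffForm.inChart (α : DiffForm E M k) (x₀ : M) : E → E [⋀^Fin k]→L[ℝ] ℝ :=
  fun y => (α ((extChartAt 𝓘(ℝ, E) x₀).symm y)).compContinuousLinearMap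
    (mfderiv 𝓘(ℝ, E) 𝓘(ℝ, E) (extChartAt 𝓘(ℝ, E) x₀).symm y)

/-- The form is smooth on the open set `U`: all its coordinate expressions are. -/
def DiffForm.SmoothOn (α : DiffForm E M k) (U : Set M) : Prop :=
  ∀ x₀ : M, ContDiffOn ℝ ∞ (α.inChart x₀)
    ((extChartAt 𝓘(ℝ, E) x₀).target ∩ (extChartAt 𝓘(ℝ, E) x₀).symm ⁻¹' U)

/-- The exterior derivative, computed at `x` in the preferred chart at `x`. -/
def DiffForm.d (α : DiffForm E M k) : DiffForm E M (k + 1) :=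
  fun x => (extDeriv (α.inChart x) (extChartAt 𝓘(ℝ, E) x x)).compContinuousLinearMap
    (mfderiv 𝓘(ℝ, E) 𝓘(ℝ, E) (extChartAt 𝓘(ℝ, E) x) x)

/-- The interior product `i_X α`, `(i_X α)(v₁, …, v_k) = α(X, v₁, …, v_k)`. -/
def DiffForm.interior (X : (x : M) → TangentSpace 𝓘(ℝ, E) x) (α : DiffForm E M (k + 1)) :
    DiffForm E M k :=
  fun x => ContinuousAlternatingMap.curryLeft (E := E) (α x) (X x)

/-- A symplectic form: a smooth closed nondegenerate `2`-form. -/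
structure DiffForm.IsSymplectic (Ω : DiffForm E M 2) : Prop where
  smooth : Ω.SmoothOn Set.univ
  closed : ∀ x, Ω.d x = 0
  nondegenerate : ∀ (x : M) (v : TangentSpace 𝓘(ℝ, E) x),
    (∀ w : TangentSpace 𝓘(ℝ, E) x, Ω x ![v, w] = 0) → v = 0

end DifferentialForms

section LinearAlgebra

variable {V : Type*} [AddCommGroup V] [Module ℝ V]

/-- The wedge product of two alternating forms. -/
def wedge {p q : ℕ} (a : V [⋀^Fin p]→ₗ[ℝ] ℝ) (b : V [⋀^Fin q]→ₗ[ℝ] ℝ) :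
    V [⋀^Fin (p + q)]→ₗ[ℝ] ℝ :=
  ((LinearMap.mul' ℝ ℝ).compAlternatingMap (a.domCoprod b)).domDomCongr finSumFinEquiv

/-- The `n`-fold wedge power `Ω ∧ ⋯ ∧ Ω` of a `2`-form. -/
def wedgePow (Ω : V [⋀^Fin 2]→ₗ[ℝ] ℝ) : (n : ℕ) → V [⋀^Fin (2 * n)]→ₗ[ℝ] ℝ
  | 0 => AlternatingMap.constOfIsEmpty ℝ V (Fin 0) (1 : ℝ)
  | n + 1 => wedge (wedgePow Ω n) Ω

variable [TopologicalSpace V]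

/-- The kernel of a `1`-form. -/
def formKer (a : V [⋀^Fin 1]→L[ℝ] ℝ) : Submodule ℝ V :=
  LinearMap.ker (((ContinuousAlternatingMap.ofSubsingleton ℝ V ℝ (0 : Fin 1)).symm a :
    V →L[ℝ] ℝ) : V →ₗ[ℝ] ℝ)

/-- The bilinear form on a subspace `W` obtained by restricting a `2`-form. -/
def formRestrict (Ω : V [⋀^Fin 2]→L[ℝ] ℝ) (W : Submodule ℝ V) : LinearMap.BilinForm ℝ W :=
  LinearMap.mk₂ ℝ (fun u v : W => Ω ![(u : V), (v : V)])
    (fun u u' v => by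
      have := Ω.toAlternatingMap.map_vecCons_add ![(v : V)] (u : V) (u' : V)
      simpa using this)
    (fun c u v => by
      have := Ω.toAlternatingMap.map_vecCons_smul ![(v : V)] c (u : V)
      simpa using this)
    (fun u v v' => by
      have e : ∀ x : V, Function.update ![(u : V), 0] 1 x = ![(u : V), x] := by
        intro x; ext i; fin_cases i <;> simp
      have := Ω.toAlternatingMap.map_update_add ![(u : V), 0] 1 (v : V) (v' : V)
      rw [e, e, e] at this
      exact this)
    (fun c u v => by
      have e : ∀ x : V, Function.update ![(u : V), 0] 1 x = ![(u : V), x] := by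
        intro x; ext i; fin_cases i <;> simp
      have := Ω.toAlternatingMap.map_update_smul ![(u : V), 0] 1 c (v : V)
      rw [e, e] at this
      exact this)

end LinearAlgebra

section Flows

variable {E : Type*} [NormedAddCommGroup E] [NormedSpace ℝ E]
  {M : Type*} [TopologicalSpace M] [ChartedSpace E M] {k : ℕ}

/-- `φ` is the (smooth, global) flow of the vector field `X`; a complete vector field is one that
has such a flow. The laws `φ 0 = id` and `φ (s + t) = φ s ∘ φ t` are part of `Flow`. -/
structure IsGlobalFlow (X : (x : M) → TangentSpace 𝓘(ℝ, E) x) (φ : Flow ℝ M) : Prop where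
  smooth : ContMDiff (𝓘(ℝ, ℝ).prod 𝓘(ℝ, E)) 𝓘(ℝ, E) ∞ (fun p : ℝ × M => φ p.1 p.2)
  generator : ∀ x, IsMIntegralCurve (I := 𝓘(ℝ, E)) (fun t => φ t x) X

/-- `β` is the Lie derivative of `α` along the vector field with flow `φ`: the derivative at
`t = 0` of the pullbacks `(φ t)^* α`. -/
def IsLieDerivative (φ : Flow ℝ M) (α β : DiffForm E M k) : Prop :=
  ∀ (x : M) (v : Fin k → TangentSpace 𝓘(ℝ, E) x),
    HasDerivAt (fun t : ℝ => DiffForm.pullback (φ t) α x v) (β x v) 0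

/-- The quotient of `M` by the flow: the space of orbits, with the quotient topology. -/
abbrev OrbitSpace {M : Type*} [TopologicalSpace M] (φ : Flow ℝ M) : Type _ :=
  Quotient (@AddAction.orbitRel ℝ M _ φ.toAddAction)

/-- The projection of `M` to the quotient by the flow. -/
def OrbitSpace.proj {M : Type*} [TopologicalSpace M] (φ : Flow ℝ M) (m : M) : OrbitSpace φ :=
  Quotient.mk _ m

end Flows

section Contact

variable {E : Type*} [NormedAddCommGroup E] [NormedSpace ℝ E]
  {C : Type*} [TopologicalSpace C] [ChartedSpace E C]

/-- `η` is a contact `1`-form for `𝒟` on the open set `U`: it is smooth there, `𝒟 = ker η` and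
`η ∧ (dη)^n` vanishes nowhere on `U`. -/
structure IsContactFormOn (n : ℕ) (𝒟 : (c : C) → Submodule ℝ (TangentSpace 𝓘(ℝ, E) c))
    (U : Set C) (η : DiffForm E C 1) : Prop where
  smooth : η.SmoothOn U
  ker_eq : ∀ c ∈ U, formKer (η c) = 𝒟 c
  nonintegrable : ∀ c ∈ U,
    wedge (η c).toAlternatingMap (wedgePow (η.d c).toAlternatingMap n) ≠ 0

/-- `𝒟` is a contact distribution on the `(2n+1)`-dimensional manifold `C`: it is locally the
kernel of a contact `1`-form. -/
def IsContactDistribution (n : ℕ) (𝒟 : (c : C) → Submodule ℝ (TangentSpace 𝓘(ℝ, E) c)) : Prop :=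
  ∀ c : C, ∃ (U : Set C) (η : DiffForm E C 1), IsOpen U ∧ c ∈ U ∧ IsContactFormOn n 𝒟 U η

/-- A conformal symplectic structure on the distribution `𝒟`: in every fibre a class `𝒞 c` of
nondegenerate alternating forms, consisting of all nonzero multiples of one of them, which can be
chosen locally to be the restriction to `𝒟` of a smooth `2`-form. -/
def IsConformalSymplectic (𝒟 : (c : C) → Submodule ℝ (TangentSpace 𝓘(ℝ, E) c))
    (𝒞 : (c : C) → Set (LinearMap.BilinForm ℝ (𝒟 c))) : Prop :=
  ∀ c : C, ∃ (U : Set C) (Ω : DiffForm E C 2), IsOpen U ∧ c ∈ U ∧ Ω.SmoothOn U ∧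
    ∀ y ∈ U, (formRestrict (Ω y) (𝒟 y)).Nondegenerate ∧
      𝒞 y = {B | ∃ a : ℝ, a ≠ 0 ∧ B = a • formRestrict (Ω y) (𝒟 y)}

/-- The cotangent bundle. -/
abbrev CotangentBundle (E : Type*) [NormedAddCommGroup E] [NormedSpace ℝ E]
    (C : Type*) [TopologicalSpace C] [ChartedSpace E C] : Type _ :=
  Bundle.TotalSpace (E →L[ℝ] ℝ) (fun c : C => TangentSpace 𝓘(ℝ, E) c →L[ℝ] ℝ)

/-- The symplectification of `(C, 𝒟)`: all covectors with kernel `𝒟`. -/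
abbrev Symplectification (𝒟 : (c : C) → Submodule ℝ (TangentSpace 𝓘(ℝ, E) c)) : Type _ :=
  {β : CotangentBundle E C // LinearMap.ker (β.2 : TangentSpace 𝓘(ℝ, E) β.1 →ₗ[ℝ] ℝ) = 𝒟 β.1}

/-- The projection of the symplectification to `C`. -/
def Symplectification.proj (𝒟 : (c : C) → Submodule ℝ (TangentSpace 𝓘(ℝ, E) c))
    (β : Symplectification 𝒟) : C := β.1.1

/-- The restriction to the symplectification of the canonical `1`-form of the cotangent bundle:
`ξ ↦ β (proj_* ξ)` at the point `β`. -/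
def canonicalForm [IsManifold 𝓘(ℝ, E) 1 C]
    (E' : Type*) [NormedAddCommGroup E'] [NormedSpace ℝ E']
    (𝒟 : (c : C) → Submodule ℝ (TangentSpace 𝓘(ℝ, E) c))
    [ChartedSpace E' (Symplectification 𝒟)] : DiffForm E' (Symplectification 𝒟) 1 :=
  fun β => ContinuousAlternatingMap.ofSubsingleton ℝ (TangentSpace 𝓘(ℝ, E') β) ℝ (0 : Fin 1)
    ((β.1.2).comp (mfderiv 𝓘(ℝ, E') 𝓘(ℝ, E) (Symplectification.proj 𝒟) β))

end Contact

end

/-! Near each orbit the flow is a translation. The inverse function theorem gives a box of the form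
transversal times interval, and freeness with properness shrinks it until every orbit meets it in at
most one segment (`IsGlobalFlow.exists_isFlowBox`). The transversals serve as charts of the orbit
space; their transition maps are smooth because the flow carries one transversal into the box of
another.

Two identities govern the forms. The equation `L_D ω = ω` integrates to `φ_t^* ω = e^t ω`
(`IsLieDerivative.pullback_eq_exp_smul`), and together with closedness it gives `dλ = ω` by Cartan's
formula (`DiffForm.d_interior_eq`). Since `λ(D) = 0` and the kernel of `π_*` is spanned by `D`, the
covector `λ_m` is the pullback of a unique covector `β_m` at `π m` (`reducedCovector`). It is
nonzero, because `ω` is nondegenerate and `D` vanishes nowhere. Moreover `β` at `φ_t m` is `e^t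
β_m`, so the kernel of `β_m` depends only on the orbit: this is the distribution.

A local section `σ` of `π` produces the form `η = σ^* λ`, with kernel the distribution and `dη = σ^*
ω`. On the kernel, `dη` is the linear reduction of `ω` by `D`, hence nondegenerate
(`eq_zero_of_pair_eq_zero`), and `η ∧ (dη)^n ≠ 0` follows by linear algebra
(`wedge_wedgePow_ne_zero`). Any other contact form has, on the distribution, a proportional exterior
derivative (`DiffForm.d_eq_of_ker_le`); moving along an orbit only multiplies `ω` by `e^t`. So the
conformal class is well defined.

In cotangent charts the symplectification is a family of punctured lines spanned by `η`, and a shear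
makes this family constant, which exhibits slices. The map `F(m) = β_m` sends `φ_t (σ c)` to `e^t
η_c`; the time is recovered by a logarithm, which gives smooth local inverses. That `F` pulls the
canonical form back to `λ` expresses that `F` covers `π`. Over each point `F` reaches only one of
the two half-lines, so the multiples `ε β_m` with `ε ≠ 0` are used as well: together they cover
everything, and they pull the canonical form back to `ε λ` and its derivative to `ε ω`. Smoothness
and nondegeneracy are then transferred along local diffeomorphisms. -/

noncomputable section

set_option linter.unusedSectionVars false

/-! ### Smooth families of alternating forms on a finite-dimensional space. -/

section AlternatingSmooth

variable {E : Type*} [NormedAddCommGroup E] [NormedSpace ℝ E] [FiniteDimensional ℝ E]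
  {E' : Type*} [NormedAddCommGroup E'] [NormedSpace ℝ E'] [FiniteDimensional ℝ E']
  {X : Type*} [NormedAddCommGroup X] [NormedSpace ℝ X] {k : ℕ} {n : WithTop ℕ∞}

/-- A function with values in alternating forms on a finite-dimensional space is smooth if its
values on all tuples of vectors are. -/
theorem ContDiffAt.of_alternating_apply {f : X → E [⋀^Fin k]→L[ℝ] ℝ} {x : X}
    (h : ∀ v : Fin k → E, ContDiffAt ℝ n (fun y => f y v) x) : ContDiffAt ℝ n f x := by
  let b := Module.finBasis ℝ E
  let ev : (E [⋀^Fin k]→L[ℝ] ℝ) →ₗ[ℝ] ((Fin k → Fin (Module.finrank ℝ E)) → ℝ) :=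
    { toFun := fun A r => A (fun i => b (r i))
      map_add' := fun _ _ => rfl
      map_smul' := fun _ _ => rfl }
  have hinj : Function.Injective ev := by
    intro A B hAB
    apply ContinuousAlternatingMap.toAlternatingMap_injective
    apply AlternatingMap.coe_multilinearMap_injective
    exact Module.Basis.ext_multilinear (fun _ => b) (fun r => congrFun hAB r)
  have : FiniteDimensional ℝ (E [⋀^Fin k]→L[ℝ] ℝ) := FiniteDimensional.of_injective ev hinj
  -- A linear left inverse of `ev` recovers `f` linearly from finitely many of its values on basis
  -- tuples.
  obtain ⟨g, hg⟩ := LinearMap.exists_leftInverse_of_injective ev (LinearMap.ker_eq_bot.2 hinj)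
  have hfg : f = (LinearMap.toContinuousLinearMap g) ∘ (fun y => ev (f y)) := by
    funext y
    exact (LinearMap.congr_fun hg (f y)).symm
  rw [hfg]
  refine (ContinuousLinearMap.contDiff _).contDiffAt.comp x ?_
  exact contDiffAt_pi.2 (fun r => h _)

/-- Expanding the vectors in a basis turns the value into a finite sum of products of coordinates
with values on constant basis tuples. -/
theorem ContDiffAt.alternating_apply {f : X → E [⋀^Fin k]→L[ℝ] ℝ} {w : X → Fin k → E} {x : X}
    (hf : ContDiffAt ℝ n f x) (hw : ∀ i, ContDiffAt ℝ n (fun y => w y i) x) :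
    ContDiffAt ℝ n (fun y => f y (w y)) x := by
  let b := Module.finBasis ℝ E
  have key : ∀ y, f y (w y) = ∑ r : Fin k → Fin (Module.finrank ℝ E),
      (∏ i, b.coord (r i) (w y i)) * f y (fun i => b (r i)) := by
    intro y
    have h1 : w y = fun i => ∑ j, b.coord j (w y i) • b j := by
      funext i; exact (b.sum_repr (w y i)).symm
    conv_lhs => rw [h1]
    have := (f y).toMultilinearMap.map_sum (fun i j => b.coord j (w y i) • b j)
    refine this.trans (Finset.sum_congr rfl fun r _ => ?_)
    have := (f y).toMultilinearMap.map_smul_univ (fun i => b.coord (r i) (w y i))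
      (fun i => b (r i))
    exact this
  simp_rw [key]
  refine ContDiffAt.sum fun r _ => ContDiffAt.mul ?_ ?_
  · refine contDiffAt_prod fun i _ => ?_
    exact (LinearMap.toContinuousLinearMap (b.coord (r i))).contDiff.contDiffAt.comp x (hw i)
  · let ev : (E [⋀^Fin k]→L[ℝ] ℝ) →L[ℝ] ℝ :=
      ContinuousAlternatingMap.apply ℝ E ℝ (fun i => b (r i))
    exact ev.contDiff.contDiffAt.comp x hf

theorem ContDiffAt.alternating_comp {f : X → E' [⋀^Fin k]→L[ℝ] ℝ} {B : X → E →L[ℝ] E'} {x : X}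
    (hf : ContDiffAt ℝ n f x) (hB : ContDiffAt ℝ n B x) :
    ContDiffAt ℝ n (fun y => (f y).compContinuousLinearMap (B y)) x :=
  ContDiffAt.of_alternating_apply fun v =>
    hf.alternating_apply (w := fun y i => B y (v i)) fun _ => hB.clm_apply contDiffAt_const

end AlternatingSmooth

/-! ### Pullback, smoothness and exterior derivative in charts. -/

section FormCalculus

variable {E : Type*} [NormedAddCommGroup E] [NormedSpace ℝ E]
  {E' : Type*} [NormedAddCommGroup E'] [NormedSpace ℝ E']
  {E'' : Type*} [NormedAddCommGroup E''] [NormedSpace ℝ E'']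
  {M : Type*} [TopologicalSpace M] [ChartedSpace E M]
  {N : Type*} [TopologicalSpace N] [ChartedSpace E' N]
  {P : Type*} [TopologicalSpace P] [ChartedSpace E'' P] {k : ℕ}

/-- The form is smooth at `x`: its expression in the preferred chart at `x` is. -/
def DiffForm.SmoothAt (α : DiffForm E M k) (x : M) : Prop :=
  ContDiffAt ℝ ∞ (α.inChart x) (extChartAt 𝓘(ℝ, E) x x)

/-- Tangent spaces at equal points share the model space `E` but depend on the point, so base points
are exchanged through `subst` on forms of `E` and not by rewriting. -/
theorem DiffForm.apply_congr (α : DiffForm E M k) {p q : M} (h : p = q) {v w : Fin k → E}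
    (hvw : v = w) :
    (show E [⋀^Fin k]→L[ℝ] ℝ from α p) v = (show E [⋀^Fin k]→L[ℝ] ℝ from α q) w := by
  subst h hvw; rfl

theorem DiffForm.pullback_apply (f : M → N) (α : DiffForm E' N k) (x : M)
    (v : Fin k → TangentSpace 𝓘(ℝ, E) x) :
    DiffForm.pullback f α x v = α (f x) (fun i => mfderiv 𝓘(ℝ, E) 𝓘(ℝ, E') f x (v i)) := rfl

theorem DiffForm.pullback_congr {f g : M → N} (α : DiffForm E' N k) {x : M} (h : f =ᶠ[𝓝 x] g) :
    DiffForm.pullback (E := E) (E' := E') f α x =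
      DiffForm.pullback (E := E) (E' := E') g α x := by
  ext v
  exact α.apply_congr h.self_of_nhds
    (by rw [show (mfderiv 𝓘(ℝ, E) 𝓘(ℝ, E') f x : E →L[ℝ] E') = mfderiv 𝓘(ℝ, E) 𝓘(ℝ, E') g x from
      h.mfderiv_eq]; rfl)

theorem DiffForm.pullback_pullback {f : M → N} {g : N → P} (α : DiffForm E'' P k) {x : M}
    (hg : MDifferentiableAt 𝓘(ℝ, E') 𝓘(ℝ, E'') g (f x))
    (hf : MDifferentiableAt 𝓘(ℝ, E) 𝓘(ℝ, E') f x) :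
    DiffForm.pullback (E := E) f (DiffForm.pullback (E := E') g α) x =
      DiffForm.pullback (E := E) (g ∘ f) α x := by
  ext v
  refine α.apply_congr rfl ?_
  funext i
  exact (mfderiv_comp_apply x hg hf (v i)).symm

theorem DiffForm.pullback_id (α : DiffForm E M k) : DiffForm.pullback id α = α := by
  funext x
  ext v
  rw [DiffForm.pullback_apply]
  simp only [mfderiv_id]
  rfl

theorem DiffForm.inChart_congr {α β : DiffForm E M k} {x₀ : M} {z : E}
    (h : α ((extChartAt 𝓘(ℝ, E) x₀).symm z) = β ((extChartAt 𝓘(ℝ, E) x₀).symm z)) :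
    α.inChart x₀ z = β.inChart x₀ z := by
  simp only [DiffForm.inChart, h]

theorem DiffForm.inChart_eventuallyEq {α β : DiffForm E M k} {x₀ x : M}
    (hx : x ∈ (extChartAt 𝓘(ℝ, E) x₀).source) (h : ∀ᶠ y in 𝓝 x, α y = β y) :
    α.inChart x₀ =ᶠ[𝓝 (extChartAt 𝓘(ℝ, E) x₀ x)] β.inChart x₀ := by
  have hc := continuousAt_extChartAt_symm' (I := 𝓘(ℝ, E)) hx
  rw [ContinuousAt, (extChartAt 𝓘(ℝ, E) x₀).left_inv hx] at hc
  filter_upwards [hc.eventually h] with z hz using DiffForm.inChart_congr hz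

theorem DiffForm.SmoothAt.congr {α β : DiffForm E M k} {x : M} (hα : α.SmoothAt x)
    (h : ∀ᶠ y in 𝓝 x, β y = α y) : β.SmoothAt x :=
  ContDiffAt.congr_of_eventuallyEq hα
    (DiffForm.inChart_eventuallyEq (mem_extChartAt_source x) h)

theorem DiffForm.d_congr {α β : DiffForm E M k} {x : M} (h : ∀ᶠ y in 𝓝 x, α y = β y) :
    α.d x = β.d x := by
  simp only [DiffForm.d]
  rw [(DiffForm.inChart_eventuallyEq (mem_extChartAt_source x) h).extDeriv_eq]

variable [IsManifold 𝓘(ℝ, E) ∞ M] [IsManifold 𝓘(ℝ, E') ∞ N]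

theorem mdifferentiableAt_extChartAt_symm {x : M} {z : E}
    (hz : z ∈ (extChartAt 𝓘(ℝ, E) x).target) :
    MDifferentiableAt 𝓘(ℝ, E) 𝓘(ℝ, E) (extChartAt 𝓘(ℝ, E) x).symm z :=
  ((contMDiffOn_extChartAt_symm (n := ∞) x).contMDiffAt
    ((isOpen_extChartAt_target x).mem_nhds hz)).mdifferentiableAt (by simp)

/-- By the chain rule the coordinate expression of a pullback is a pullback between normed spaces;
this reduces naturality of `d` and smoothness of pullbacks to the flat case. -/
theorem DiffForm.inChart_pullback {f : M → N} (α : DiffForm E' N k) {x₀ : M} {y₀ : N} {z : E}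
    (hz : z ∈ (extChartAt 𝓘(ℝ, E) x₀).target)
    (hfz : f ((extChartAt 𝓘(ℝ, E) x₀).symm z) ∈ (extChartAt 𝓘(ℝ, E') y₀).source)
    (hf : MDifferentiableAt 𝓘(ℝ, E) 𝓘(ℝ, E') f ((extChartAt 𝓘(ℝ, E) x₀).symm z)) :
    (DiffForm.pullback f α).inChart x₀ z =
      (α.inChart y₀ ((extChartAt 𝓘(ℝ, E') y₀ ∘ f ∘ (extChartAt 𝓘(ℝ, E) x₀).symm) z)
        ).compContinuousLinearMap
        (fderiv ℝ (extChartAt 𝓘(ℝ, E') y₀ ∘ f ∘ (extChartAt 𝓘(ℝ, E) x₀).symm) z) := by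
  set s := (extChartAt 𝓘(ℝ, E) x₀).symm with hs
  set e := extChartAt 𝓘(ℝ, E') y₀ with he
  have hsd : MDifferentiableAt 𝓘(ℝ, E) 𝓘(ℝ, E) s z := mdifferentiableAt_extChartAt_symm hz
  have hfs : MDifferentiableAt 𝓘(ℝ, E) 𝓘(ℝ, E') (f ∘ s) z := hf.comp z hsd
  have hed : MDifferentiableAt 𝓘(ℝ, E') 𝓘(ℝ, E') e (f (s z)) :=
    mdifferentiableAt_extChartAt (by simpa [e] using hfz)
  have hg : MDifferentiableAt 𝓘(ℝ, E) 𝓘(ℝ, E') (e ∘ f ∘ s) z := hed.comp z hfs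
  have hes : MDifferentiableAt 𝓘(ℝ, E') 𝓘(ℝ, E') e.symm ((e ∘ f ∘ s) z) :=
    mdifferentiableAt_extChartAt_symm (e.map_source hfz)
  have hev : e.symm ∘ (e ∘ f ∘ s) =ᶠ[𝓝 z] f ∘ s := by
    have : ∀ᶠ y in 𝓝 z, (f ∘ s) y ∈ e.source :=
      hfs.continuousAt.eventually ((isOpen_extChartAt_source y₀).mem_nhds hfz)
    filter_upwards [this] with y hy using e.left_inv hy
  ext v
  refine (α.apply_congr hev.self_of_nhds ?_).symm
  funext i
  have h1 := mfderiv_comp_apply z hes hg (v i)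
  have h2 := mfderiv_comp_apply z hf hsd (v i)
  have h3 := DFunLike.congr_fun (show (mfderiv 𝓘(ℝ, E) 𝓘(ℝ, E') (e.symm ∘ (e ∘ f ∘ s)) z :
    E →L[ℝ] E') = mfderiv 𝓘(ℝ, E) 𝓘(ℝ, E') (f ∘ s) z from hev.mfderiv_eq) (v i)
  rw [mfderiv_eq_fderiv] at h1
  exact h1.symm.trans (h3.trans h2)

/-- The coordinate expression of `f` at a point where it is smooth. -/
theorem ContMDiffAt.contDiffAt_inCharts {f : M → N} {x₀ x : M} {y₀ : N}
    (hx : x ∈ (extChartAt 𝓘(ℝ, E) x₀).source) (hfx : f x ∈ (extChartAt 𝓘(ℝ, E') y₀).source)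
    (hf : ContMDiffAt 𝓘(ℝ, E) 𝓘(ℝ, E') ∞ f x) :
    ContDiffAt ℝ ∞ (extChartAt 𝓘(ℝ, E') y₀ ∘ f ∘ (extChartAt 𝓘(ℝ, E) x₀).symm)
      (extChartAt 𝓘(ℝ, E) x₀ x) := by
  rw [← contMDiffAt_iff_contDiffAt]
  have hinv := (extChartAt 𝓘(ℝ, E) x₀).left_inv hx
  refine ContMDiffAt.comp (I' := 𝓘(ℝ, E')) _ ?_ (ContMDiffAt.comp (I' := 𝓘(ℝ, E)) _ ?_ ?_)
  · refine contMDiffAt_extChartAt' ?_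
    rw [Function.comp_apply, hinv]
    simpa using hfx
  · rwa [hinv]
  · exact (contMDiffOn_extChartAt_symm x₀).contMDiffAt
      ((isOpen_extChartAt_target x₀).mem_nhds ((extChartAt 𝓘(ℝ, E) x₀).map_source hx))

theorem DiffForm.inChart_pullback_eventuallyEq {f : M → N} (α : DiffForm E' N k) {x₀ x : M}
    {y₀ : N} (hx : x ∈ (extChartAt 𝓘(ℝ, E) x₀).source)
    (hfx : f x ∈ (extChartAt 𝓘(ℝ, E') y₀).source)
    (hf : ContMDiffAt 𝓘(ℝ, E) 𝓘(ℝ, E') ∞ f x) :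
    (DiffForm.pullback f α).inChart x₀ =ᶠ[𝓝 (extChartAt 𝓘(ℝ, E) x₀ x)] fun z =>
      (α.inChart y₀ ((extChartAt 𝓘(ℝ, E') y₀ ∘ f ∘ (extChartAt 𝓘(ℝ, E) x₀).symm) z)
        ).compContinuousLinearMap
        (fderiv ℝ (extChartAt 𝓘(ℝ, E') y₀ ∘ f ∘ (extChartAt 𝓘(ℝ, E) x₀).symm) z) := by
  have hc := continuousAt_extChartAt_symm' (I := 𝓘(ℝ, E)) hx
  rw [ContinuousAt, (extChartAt 𝓘(ℝ, E) x₀).left_inv hx] at hc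
  have h1 : ∀ᶠ p in 𝓝 x, f p ∈ (extChartAt 𝓘(ℝ, E') y₀).source :=
    hf.continuousAt.eventually ((isOpen_extChartAt_source y₀).mem_nhds hfx)
  have h2 : ∀ᶠ p in 𝓝 x, MDifferentiableAt 𝓘(ℝ, E) 𝓘(ℝ, E') f p := by
    filter_upwards [(contMDiffAt_iff_contMDiffAt_nhds (n := 1) (by simp)).1
      (hf.of_le (by simp))] with p hp using hp.mdifferentiableAt (by simp)
  filter_upwards [hc.eventually h1, hc.eventually h2,
    (isOpen_extChartAt_target x₀).mem_nhds ((extChartAt 𝓘(ℝ, E) x₀).map_source hx)]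
    with z hz1 hz2 hz using DiffForm.inChart_pullback α hz hz1 hz2

/-- The exterior derivative commutes with pullbacks. -/
theorem DiffForm.d_pullback {f : M → N} {α : DiffForm E' N k} {x : M}
    (hα : α.SmoothAt (f x)) (hf : ContMDiffAt 𝓘(ℝ, E) 𝓘(ℝ, E') ∞ f x) :
    (DiffForm.pullback (E := E) f α).d x = DiffForm.pullback f α.d x := by
  have hg := hf.contDiffAt_inCharts (mem_extChartAt_source x) (mem_extChartAt_source (f x))
  have hz : (extChartAt 𝓘(ℝ, E') (f x) ∘ f ∘ (extChartAt 𝓘(ℝ, E) x).symm)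
      (extChartAt 𝓘(ℝ, E) x x) = extChartAt 𝓘(ℝ, E') (f x) (f x) := by
    simp
  have hα' : DifferentiableAt ℝ (α.inChart (f x))
      ((extChartAt 𝓘(ℝ, E') (f x) ∘ f ∘ (extChartAt 𝓘(ℝ, E) x).symm)
        (extChartAt 𝓘(ℝ, E) x x)) := by
    rw [hz]; exact ContDiffAt.differentiableAt hα (by simp)
  have key := (DiffForm.inChart_pullback_eventuallyEq α (mem_extChartAt_source x)
    (mem_extChartAt_source (f x)) hf).extDeriv_eq.trans
      (extDeriv_pullback hα' hg (by simpa using (WithTop.coe_le_coe.2 le_top : ((2 : ℕ∞) : WithTop ℕ∞) ≤ ∞)))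
  have hed : MDifferentiableAt 𝓘(ℝ, E) 𝓘(ℝ, E) (extChartAt 𝓘(ℝ, E) x) x :=
    mdifferentiableAt_extChartAt (by simp)
  have hed' : MDifferentiableAt 𝓘(ℝ, E') 𝓘(ℝ, E') (extChartAt 𝓘(ℝ, E') (f x)) (f x) :=
    mdifferentiableAt_extChartAt (by simp)
  have hev : (extChartAt 𝓘(ℝ, E') (f x) ∘ f ∘ (extChartAt 𝓘(ℝ, E) x).symm) ∘
      extChartAt 𝓘(ℝ, E) x =ᶠ[𝓝 x] extChartAt 𝓘(ℝ, E') (f x) ∘ f := by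
    filter_upwards [(isOpen_extChartAt_source (I := 𝓘(ℝ, E)) x).mem_nhds
      (mem_extChartAt_source x)] with y hy
    simp only [Function.comp_apply, (extChartAt 𝓘(ℝ, E) x).left_inv hy]
  ext v
  simp only [DiffForm.d, DiffForm.pullback]
  rw [key, hz]
  refine congrArg (extDeriv (α.inChart (f x)) (extChartAt 𝓘(ℝ, E') (f x) (f x))) ?_
  funext i
  have h1 := mfderiv_comp_apply (I' := 𝓘(ℝ, E)) x
    (g := extChartAt 𝓘(ℝ, E') (f x) ∘ f ∘ (extChartAt 𝓘(ℝ, E) x).symm)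
    (hg.differentiableAt (by simp)).mdifferentiableAt hed (v i)
  have h2 := mfderiv_comp_apply x hed' (hf.mdifferentiableAt (by simp)) (v i)
  have h3 := DFunLike.congr_fun (show (mfderiv 𝓘(ℝ, E) 𝓘(ℝ, E')
      ((extChartAt 𝓘(ℝ, E') (f x) ∘ f ∘ (extChartAt 𝓘(ℝ, E) x).symm) ∘
      extChartAt 𝓘(ℝ, E) x) x : E →L[ℝ] E') =
      mfderiv 𝓘(ℝ, E) 𝓘(ℝ, E') (extChartAt 𝓘(ℝ, E') (f x) ∘ f) x from hev.mfderiv_eq) (v i)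
  rw [mfderiv_eq_fderiv] at h1
  exact h1.symm.trans (h3.trans h2)

variable [FiniteDimensional ℝ E] [FiniteDimensional ℝ E']

theorem DiffForm.contDiffAt_inChart_pullback {f : M → N} (α : DiffForm E' N k) {x₀ x : M}
    {y₀ : N} (hx : x ∈ (extChartAt 𝓘(ℝ, E) x₀).source)
    (hfx : f x ∈ (extChartAt 𝓘(ℝ, E') y₀).source)
    (hf : ContMDiffAt 𝓘(ℝ, E) 𝓘(ℝ, E') ∞ f x)
    (hα : ContDiffAt ℝ ∞ (α.inChart y₀) (extChartAt 𝓘(ℝ, E') y₀ (f x))) :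
    ContDiffAt ℝ ∞ ((DiffForm.pullback f α).inChart x₀) (extChartAt 𝓘(ℝ, E) x₀ x) := by
  refine ContDiffAt.congr_of_eventuallyEq ?_ (DiffForm.inChart_pullback_eventuallyEq α hx hfx hf)
  have hg := hf.contDiffAt_inCharts hx hfx
  have hα' : ContDiffAt ℝ ∞ (α.inChart y₀)
      ((extChartAt 𝓘(ℝ, E') y₀ ∘ f ∘ (extChartAt 𝓘(ℝ, E) x₀).symm)
        (extChartAt 𝓘(ℝ, E) x₀ x)) := by
    rw [Function.comp_apply, Function.comp_apply, (extChartAt 𝓘(ℝ, E) x₀).left_inv hx]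
    exact hα
  exact ContDiffAt.alternating_comp (hα'.comp _ hg) (hg.fderiv_right (by simp))

/-- A change of chart is the pullback under the identity map, read in two different charts. -/
theorem DiffForm.SmoothAt.contDiffAt_inChart {α : DiffForm E M k} {x₀ x : M}
    (hα : α.SmoothAt x) (hx : x ∈ (extChartAt 𝓘(ℝ, E) x₀).source) :
    ContDiffAt ℝ ∞ (α.inChart x₀) (extChartAt 𝓘(ℝ, E) x₀ x) := by
  have := DiffForm.contDiffAt_inChart_pullback (f := id) α hx (mem_extChartAt_source x)
    contMDiffAt_id hα
  rwa [DiffForm.pullback_id] at this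

theorem DiffForm.smoothOn_iff {α : DiffForm E M k} {U : Set M} (hU : IsOpen U) :
    α.SmoothOn U ↔ ∀ x ∈ U, α.SmoothAt x := by
  constructor
  · intro h x hx
    refine (h x).contDiffAt (Filter.inter_mem
      ((isOpen_extChartAt_target x).mem_nhds (mem_extChartAt_target x)) ?_)
    have hc := continuousAt_extChartAt_symm (I := 𝓘(ℝ, E)) x
    refine hc (hU.mem_nhds ?_)
    rwa [extChartAt_to_inv x]
  · rintro h x₀ z ⟨hz, hzU⟩
    have := (h _ hzU).contDiffAt_inChart ((extChartAt 𝓘(ℝ, E) x₀).map_target hz)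
    rw [(extChartAt 𝓘(ℝ, E) x₀).right_inv hz] at this
    exact this.contDiffWithinAt

theorem DiffForm.SmoothAt.pullback {f : M → N} {α : DiffForm E' N k} {x : M}
    (hα : α.SmoothAt (f x)) (hf : ContMDiffAt 𝓘(ℝ, E) 𝓘(ℝ, E') ∞ f x) :
    (DiffForm.pullback (E := E) f α).SmoothAt x :=
  DiffForm.contDiffAt_inChart_pullback α (mem_extChartAt_source x) (mem_extChartAt_source _) hf hα

end FormCalculus

/-! ### Wedge powers and Darboux bases. -/

section Wedge

variable {V : Type*} [AddCommGroup V] [Module ℝ V]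

/-- The wedge is a sum over shuffles, and alternatizing the factors supplies the remaining
permutations. Neither operation is normalised, so no factorials appear. -/
theorem wedge_alternatization {p q : ℕ} (S : MultilinearMap ℝ (fun _ : Fin p => V) ℝ)
    (T : MultilinearMap ℝ (fun _ : Fin q => V) ℝ) :
    wedge (MultilinearMap.alternatization S) (MultilinearMap.alternatization T) =
      MultilinearMap.alternatization
        (((LinearMap.mul' ℝ ℝ).compMultilinearMap (S.domCoprod T)).domDomCongr
          finSumFinEquiv) := by
  rw [wedge, ← MultilinearMap.domCoprod_alternization,
    ← LinearMap.compMultilinearMap_alternatization]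
  ext v
  simp only [AlternatingMap.domDomCongr_apply, MultilinearMap.alternatization_apply,
    MultilinearMap.domDomCongr_apply]
  refine Fintype.sum_equiv (Equiv.permCongr finSumFinEquiv) _ _ fun σ => ?_
  rw [Equiv.Perm.sign_permCongr]
  simp [Equiv.permCongr_apply]

/-- Induction on `n` through `wedge_alternatization`. The explicit tensor, with slots `2k` and `2k +
1` paired, is what makes the wedge power computable on a given tuple. -/
theorem wedgePow_eq_alternatization {Ω : V [⋀^Fin 2]→ₗ[ℝ] ℝ}
    (b : MultilinearMap ℝ (fun _ : Fin 2 => V) ℝ) (hb : MultilinearMap.alternatization b = Ω)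
    (n : ℕ) : ∃ T : MultilinearMap ℝ (fun _ : Fin (2 * n) => V) ℝ,
      (∀ v, T v = ∏ k : Fin n, b ![v ⟨2 * k, by omega⟩, v ⟨2 * k + 1, by omega⟩]) ∧
      wedgePow Ω n = MultilinearMap.alternatization T := by
  induction n with
  | zero =>
    have : IsEmpty (Fin (2 * 0)) := by simp only [Nat.mul_zero]; infer_instance
    refine ⟨MultilinearMap.constOfIsEmpty ℝ (fun _ => V) 1, fun v => by simp, ?_⟩
    ext v
    rw [MultilinearMap.alternatization_apply, Fintype.sum_subsingleton _ 1]
    simp [wedgePow]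
  | succ n ih =>
    obtain ⟨T, hT, hw⟩ := ih
    refine ⟨((LinearMap.mul' ℝ ℝ).compMultilinearMap (T.domCoprod b)).domDomCongr
          finSumFinEquiv, fun v => ?_, ?_⟩
    · rw [Fin.prod_univ_castSucc]
      simp only [MultilinearMap.domDomCongr_apply, LinearMap.compMultilinearMap_apply,
        MultilinearMap.domCoprod_apply, LinearMap.mul'_apply, hT]
      congr 1
      congr 1
      ext i; fin_cases i <;> simp <;> rfl
    · rw [wedgePow, hw, ← hb, wedge_alternatization]

/-- An alternating bilinear form is a sum of products of pairs of linear forms which are dual to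
a family of vectors. -/
theorem LinearMap.IsAlt.exists_darboux [FiniteDimensional ℝ V] {B : V →ₗ[ℝ] V →ₗ[ℝ] ℝ}
    (hB : B.IsAlt) : ∃ (ι : Type) (_ : Fintype ι) (_ : DecidableEq ι) (e f : ι → V),
      (∀ i j, B (e i) (f j) = if i = j then 1 else 0) ∧ (∀ i j, B (e i) (e j) = 0) ∧
      (∀ i j, B (f i) (f j) = 0) ∧
      ∀ u v, B u v = ∑ i, (B u (f i) * B (e i) v - B (e i) u * B v (f i)) := by
  induction hr : Module.finrank ℝ (LinearMap.range B) using Nat.strong_induction_on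
    generalizing B with
  | _ r ih =>
  by_cases h0 : B = 0
  · exact ⟨Empty, inferInstance, inferInstance, Empty.elim, Empty.elim, by simp, by simp, by simp,
      by simp [h0]⟩
  obtain ⟨e, f, hef⟩ : ∃ e f, B e f = 1 := by
    obtain ⟨e, he⟩ : ∃ e, B e ≠ 0 := by
      by_contra! h
      exact h0 (LinearMap.ext h)
    obtain ⟨f, hf⟩ : ∃ f, B e f ≠ 0 := by
      by_contra! h
      exact he (LinearMap.ext h)
    exact ⟨e, (B e f)⁻¹ • f, by simp [hf]⟩
  have hself : ∀ x, B x x = 0 := hB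
  have hneg : ∀ x y, B x y = - B y x := fun x y => by
    have := hB.neg y x; linarith
  have hfe : B f e = -1 := by rw [hneg, hef]
  -- Symplectic Gram–Schmidt: `P` projects onto the `B`-orthogonal complement of the plane spanned
  -- by `e` and `f`, and the induction continues with `B` on that complement.
  let P : V →ₗ[ℝ] V := LinearMap.id - (B.flip f).smulRight e - (B e).smulRight f
  have hP : ∀ u, P u = u - B u f • e - B e u • f := fun u => rfl
  have hPf : ∀ u, B (P u) f = 0 := fun u => by simp [hP, hef, hself]
  have heP : ∀ u, B e (P u) = 0 := fun u => by simp [hP, hef, hself]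
  have hPe : ∀ u, B (P u) e = 0 := fun u => by rw [hneg, heP, neg_zero]
  have hfP : ∀ u, B f (P u) = 0 := fun u => by rw [hneg, hPf, neg_zero]
  have hPP : ∀ u v, B (P u) (P v) = B (P u) v := fun u v => by
    conv_lhs => rw [hP v]
    simp [hPf, hPe]
  have hPP' : ∀ u v, B (P u) (P v) = B u (P v) := fun u v => by
    conv_lhs => rw [hP u]
    simp [hfP, heP]
  have hB' : (B.comp P).IsAlt := fun u => by
    change B (P u) u = 0
    rw [← hPP, hself]
  have hlt : Module.finrank ℝ (LinearMap.range (B.comp P)) < r := by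
    rw [← hr]
    refine Submodule.finrank_lt_finrank_of_lt (lt_of_le_of_ne (LinearMap.range_comp_le_range _ _) ?_)
    intro heq
    -- The rank drops because all functionals `B (P u)` vanish at `f`, whereas `B e f = 1`.
    have hmem : B e ∈ LinearMap.range (B.comp P) := heq ▸ LinearMap.mem_range_self B e
    obtain ⟨u, hu⟩ := hmem
    have := hPf u
    rw [show B (P u) = B e from hu, hef] at this
    exact one_ne_zero this
  obtain ⟨ι, _, _, e', f', h1, h2, h3, h4⟩ := ih _ hlt hB' rfl
  have hc : ∀ x y, B.comp P x y = B (P x) (P y) := fun x y => (hPP x y).symm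
  simp only [hc] at h1 h2 h3 h4
  refine ⟨Option ι, inferInstance, inferInstance, fun o => o.elim e (fun i => P (e' i)),
    fun o => o.elim f (fun i => P (f' i)), ?_, ?_, ?_, ?_⟩
  · rintro (_ | i) (_ | j) <;> simp [hef, heP, hPf, h1]
  · rintro (_ | i) (_ | j) <;> simp [heP, hPe, h2, hself]
  · rintro (_ | i) (_ | j) <;> simp [hfP, hPf, h3, hself]
  · intro u v
    have h5 : B (P u) (P v) = B u v - (B u f * B e v - B e u * B v f) := by
      rw [hPP, hP u]
      simp [hneg v f]
      ring
    have h6 := h4 u v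
    rw [h5, sub_eq_iff_eq_add'] at h6
    rw [h6, Fintype.sum_option]
    simp only [Option.elim_none, Option.elim_some]
    congr 1
    refine Finset.sum_congr rfl fun i _ => ?_
    rw [hPP', hPP, hPP, hPP']

/-- The function `η ∧ Ω ^ n` does not vanish if `Ω` is nondegenerate on the kernel of `η`. -/
theorem wedge_wedgePow_ne_zero [FiniteDimensional ℝ V] (n : ℕ)
    (hV : Module.finrank ℝ V = 2 * n + 1) (η : V [⋀^Fin 1]→ₗ[ℝ] ℝ) (Ω : V [⋀^Fin 2]→ₗ[ℝ] ℝ)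
    (hnd : ∀ u, η ![u] = 0 → (∀ w, η ![w] = 0 → Ω ![u, w] = 0) → u = 0) :
    wedge η (wedgePow Ω n) ≠ 0 := by
  let B : V →ₗ[ℝ] V →ₗ[ℝ] ℝ := LinearMap.mk₂ ℝ (fun u v => Ω ![u, v])
    (fun u u' v => by simpa using Ω.map_vecCons_add ![v] u u')
    (fun c u v => by simpa using Ω.map_vecCons_smul ![v] c u)
    (fun u v v' => by
      have e : ∀ x : V, Function.update ![u, 0] 1 x = ![u, x] := by
        intro x; ext i; fin_cases i <;> simp
      have := Ω.map_update_add ![u, 0] 1 v v'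
      rwa [e, e, e] at this)
    (fun c u v => by
      have e : ∀ x : V, Function.update ![u, 0] 1 x = ![u, x] := by
        intro x; ext i; fin_cases i <;> simp
      have := Ω.map_update_smul ![u, 0] 1 c v
      rwa [e, e] at this)
  have hBΩ : ∀ u v, B u v = Ω ![u, v] := fun _ _ => rfl
  have hBalt : B.IsAlt := fun u => Ω.map_eq_zero_of_eq ![u, u] (i := 0) (j := 1) rfl (by decide)
  let h : V →ₗ[ℝ] ℝ :=
    { toFun := fun u => η ![u]
      map_add' := fun u v => by simpa using η.map_vecCons_add ![] u v
      map_smul' := fun c u => by simpa using η.map_vecCons_smul ![] c u }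
  have hη : ∀ u, h u = η ![u] := fun _ => rfl
  obtain ⟨ι, _, _, e, f, hef, hee, hff, hsum⟩ := hBalt.exists_darboux
  -- In these terms `Ω` is the sum of the `p i ∧ q i`. The rest shows that `h`, `p`, `q` form a
  -- basis of the dual and evaluates on the dual basis.
  let p : ι → V →ₗ[ℝ] ℝ := fun i => B.flip (f i)
  let q : ι → V →ₗ[ℝ] ℝ := fun i => B (e i)
  have hneg : ∀ x y, B x y = - B y x := fun x y => by
    have := hBalt.neg y x; linarith
  let Ψ : V →ₗ[ℝ] (ι → ℝ) × (ι → ℝ) := (LinearMap.pi p).prod (LinearMap.pi q)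
  let Φ : V →ₗ[ℝ] ℝ × ((ι → ℝ) × (ι → ℝ)) := h.prod Ψ
  have hΦ : Function.Injective Φ := by
    rw [injective_iff_map_eq_zero]
    intro u hu
    have hu1 : h u = 0 := congrArg Prod.fst hu
    have hu2 : ∀ i, B u (f i) = 0 := fun i => congrFun (congrArg (fun x => x.2.1) hu) i
    have hu3 : ∀ i, B (e i) u = 0 := fun i => congrFun (congrArg (fun x => x.2.2) hu) i
    refine hnd u hu1 fun w _ => ?_
    rw [← hBΩ, hsum]
    simp [hu2, hu3]
  have hΨ : Function.Surjective Ψ := by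
    rintro ⟨a, b⟩
    refine ⟨∑ i, a i • e i + ∑ i, b i • f i, Prod.ext (funext fun j => ?_) (funext fun j => ?_)⟩
    · change B (∑ i, a i • e i + ∑ i, b i • f i) (f j) = a j
      simp [hef, hff]
    · change B (e j) (∑ i, a i • e i + ∑ i, b i • f i) = b j
      simp [hef, hee]
  -- Injectivity of `Φ` gives `2n + 1 ≤ 1 + 2|ι|` and surjectivity of `Ψ` gives `2|ι| ≤ 2n + 1`.
  have hcard : Fintype.card ι = n := by
    have h1 := LinearMap.finrank_le_finrank_of_injective hΦ
    have h2 := LinearMap.finrank_le_finrank_of_surjective hΨ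
    simp at h1 h2
    omega
  have hΦb : Function.Bijective Φ := by
    refine ⟨hΦ, (LinearMap.injective_iff_surjective_of_finrank_eq_finrank ?_).1 hΦ⟩
    simp [hcard, hV]; omega
  let κ : ι ≃ Fin n := Fintype.equivFinOfCardEq hcard
  let b : MultilinearMap ℝ (fun _ : Fin 2 => V) ℝ :=
    ∑ i, (MultilinearMap.mkPiAlgebra ℝ (Fin 2) ℝ).compLinearMap ![p i, q i]
  have hb : ∀ v, b v = ∑ i, p i (v 0) * q i (v 1) := fun v => by
    simp [b, Fin.prod_univ_two]
  have hbΩ : MultilinearMap.alternatization b = Ω := by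
    ext v
    have hv : v = ![v 0, v 1] := by ext i; fin_cases i <;> rfl
    rw [hv, ← hBΩ, hsum, MultilinearMap.alternatization_apply]
    have hu : (Finset.univ : Finset (Equiv.Perm (Fin 2))) = {1, Equiv.swap 0 1} := by decide
    rw [hu, Finset.sum_pair (by decide), Finset.sum_sub_distrib]
    simp only [MultilinearMap.domDomCongr_apply, hb, Equiv.Perm.sign_one, one_smul,
      Equiv.Perm.sign_swap (show (0 : Fin 2) ≠ 1 by decide), Units.neg_smul, ← sub_eq_add_neg]
    congr 1
    exact Finset.sum_congr rfl fun i _ => mul_comm _ _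
  let S : MultilinearMap ℝ (fun _ : Fin 1 => V) ℝ :=
    (MultilinearMap.mkPiAlgebra ℝ (Fin 1) ℝ).compLinearMap (fun _ => h)
  have hS : MultilinearMap.alternatization S = η := by
    ext v
    have hv : v = ![v 0] := by ext i; fin_cases i; rfl
    rw [hv, ← hη, MultilinearMap.alternatization_apply, Fintype.sum_subsingleton _ 1]
    simp [S]
  obtain ⟨T, hT, hw⟩ := wedgePow_eq_alternatization b hbΩ n
  have hpos : ∀ k : Fin n, 1 + (2 * (k : ℕ) + 1) < 1 + 2 * n := fun k => by omega
  -- Slot `0` belongs to `η`; the pair with index `κ i = k` occupies the slots `1 + 2k` and `2 +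
  -- 2k`, as in the tensor `T`.
  let pos : Unit ⊕ (ι ⊕ ι) → Fin (1 + 2 * n) := Sum.elim (fun _ => ⟨0, by omega⟩)
    (Sum.elim (fun i => ⟨1 + 2 * (κ i : ℕ), by have := hpos (κ i); omega⟩)
      (fun i => ⟨1 + (2 * (κ i : ℕ) + 1), hpos (κ i)⟩))
  have hposb : Function.Bijective pos := by
    rw [Fintype.bijective_iff_injective_and_card]
    refine ⟨?_, by simp [hcard]; omega⟩
    have hκ : ∀ i j, (κ i : ℕ) = κ j → i = j := fun i j hij => κ.injective (Fin.ext hij)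
    rintro (_ | i | i) (_ | j | j) hij <;> simp [pos] at hij ⊢
    · exact hκ i j hij
    · omega
    · omega
    · exact hκ i j hij
  let ε : Unit ⊕ (ι ⊕ ι) ≃ Fin (1 + 2 * n) := Equiv.ofBijective pos hposb
  let std : Unit ⊕ (ι ⊕ ι) → ℝ × ((ι → ℝ) × (ι → ℝ)) := Sum.elim (fun _ => (1, 0, 0))
    (Sum.elim (fun i => (0, Pi.single i 1, 0)) (fun i => (0, 0, Pi.single i 1)))
  -- `w` lists the basis dual to `h`, `p`, `q` in the order of the slots.
  choose g hg using hΦb.2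
  let w : Fin (1 + 2 * n) → V := fun j => g (std (ε.symm j))
  have hwh : ∀ j, h (w j) = if j = ε (Sum.inl ()) then 1 else 0 := fun j => by
    obtain ⟨s, rfl⟩ := ε.surjective j
    have : h (w (ε s)) = (std s).1 := by
      have := congrArg Prod.fst (hg (std s))
      simp only [w, Equiv.symm_apply_apply]
      exact this
    rw [this]
    rcases s with _ | i | i <;> simp [std]
  have hwp : ∀ i j, p i (w j) = if j = ε (Sum.inr (Sum.inl i)) then 1 else 0 := fun i j => by
    obtain ⟨s, rfl⟩ := ε.surjective j
    have : p i (w (ε s)) = (std s).2.1 i := by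
      have := congrFun (congrArg (fun x => x.2.1) (hg (std s))) i
      simp only [w, Equiv.symm_apply_apply]
      exact this
    rw [this]
    rcases s with _ | i | i <;> simp [std, Pi.single_apply, eq_comm]
  have hwq : ∀ i j, q i (w j) = if j = ε (Sum.inr (Sum.inr i)) then 1 else 0 := fun i j => by
    obtain ⟨s, rfl⟩ := ε.surjective j
    have : q i (w (ε s)) = (std s).2.2 i := by
      have := congrFun (congrArg (fun x => x.2.2) (hg (std s))) i
      simp only [w, Equiv.symm_apply_apply]
      exact this
    rw [this]
    rcases s with _ | i | i <;> simp [std, Pi.single_apply, eq_comm]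
  have hval : wedge η (wedgePow Ω n) w = ∑ σ : Equiv.Perm (Fin (1 + 2 * n)),
      Equiv.Perm.sign σ • (h (w (σ (ε (Sum.inl ())))) * ∏ k, ∑ i,
        p i (w (σ (ε (Sum.inr (Sum.inl k))))) * q i (w (σ (ε (Sum.inr (Sum.inr k)))))) := by
    rw [hw, ← hS, wedge_alternatization, MultilinearMap.alternatization_apply]
    refine Finset.sum_congr rfl fun σ _ => ?_
    simp only [MultilinearMap.domDomCongr_apply, LinearMap.compMultilinearMap_apply,
      MultilinearMap.domCoprod_apply, LinearMap.mul'_apply, hT, hb]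
    congr 2
    · simp [S]; rfl
    · exact (Fintype.prod_equiv κ _ _ fun k => rfl).symm
  have hnn : ∀ σ : Equiv.Perm (Fin (1 + 2 * n)),
      0 ≤ h (w (σ (ε (Sum.inl ())))) * ∏ k, ∑ i,
        p i (w (σ (ε (Sum.inr (Sum.inl k))))) * q i (w (σ (ε (Sum.inr (Sum.inr k))))) := by
    intro σ
    simp only [hwh, hwp, hwq]
    refine mul_nonneg (by split_ifs <;> simp) (Finset.prod_nonneg fun k _ =>
      Finset.sum_nonneg fun i _ => mul_nonneg ?_ ?_) <;> split_ifs <;> simp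
  intro hzero
  rw [hzero] at hval
  refine absurd hval (ne_of_lt ?_)
  -- Every nonzero term comes from a permutation that fixes slot `0` and permutes the pairs as
  -- blocks. Such a permutation is even, so no term is negative, and the identity contributes a
  -- positive one.
  refine Finset.sum_pos' (fun σ _ => ?_) ⟨1, Finset.mem_univ _, ?_⟩
  · by_cases hz : h (w (σ (ε (Sum.inl ())))) * ∏ k, ∑ i,
        p i (w (σ (ε (Sum.inr (Sum.inl k))))) * q i (w (σ (ε (Sum.inr (Sum.inr k))))) = 0
    · rw [hz, smul_zero]
    rw [mul_eq_zero, not_or, Finset.prod_eq_zero_iff] at hz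
    have h0 : σ (ε (Sum.inl ())) = ε (Sum.inl ()) := by
      by_contra h0
      exact hz.1 (by rw [hwh, if_neg h0])
    have hk : ∀ k, ∃ i, σ (ε (Sum.inr (Sum.inl k))) = ε (Sum.inr (Sum.inl i)) ∧
        σ (ε (Sum.inr (Sum.inr k))) = ε (Sum.inr (Sum.inr i)) := by
      intro k
      by_contra! hk
      refine hz.2 ⟨k, Finset.mem_univ _, Finset.sum_eq_zero fun i _ => ?_⟩
      rw [hwp, hwq]
      by_cases h1 : σ (ε (Sum.inr (Sum.inl k))) = ε (Sum.inr (Sum.inl i))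
      · rw [if_neg (hk i h1), mul_zero]
      · rw [if_neg h1, zero_mul]
    choose τ hτ1 hτ2 using hk
    have hτ : Function.Injective τ := fun i j hij => by
      have := (hτ1 i).trans ((congrArg (fun x => ε (Sum.inr (Sum.inl x))) hij).trans (hτ1 j).symm)
      simpa using this
    let τ' : Equiv.Perm ι := Equiv.ofBijective τ (Finite.injective_iff_bijective.1 hτ)
    have hσ : σ = ε.permCongr (Equiv.sumCongr (Equiv.refl Unit) (Equiv.sumCongr τ' τ')) := by
      ext1 j
      obtain ⟨s, rfl⟩ := ε.surjective j
      rcases s with _ | i | i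
      · simpa [Equiv.permCongr_apply] using h0
      · simpa [Equiv.permCongr_apply, τ'] using hτ1 i
      · simpa [Equiv.permCongr_apply, τ'] using hτ2 i
    -- The same permutation `τ'` acts on first and on second members of the pairs, so its sign
    -- occurs squared.
    have hsign : Equiv.Perm.sign σ = 1 := by
      rw [hσ, Equiv.Perm.sign_permCongr]
      erw [Equiv.Perm.sign_sumCongr, Equiv.Perm.sign_sumCongr]
      simp
    rw [hsign, one_smul]
    exact hnn σ
  · simp [hwh, hwp, hwq]

end Wedge

/-! ### Cartan's formula for closed two-forms on a vector space. -/

section CartanVectorSpace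

variable {E : Type*} [NormedAddCommGroup E] [NormedSpace ℝ E]

theorem ContinuousAlternatingMap.apply_pair_swap {V : Type*} [AddCommGroup V] [Module ℝ V]
    [TopologicalSpace V] (A : V [⋀^Fin 2]→L[ℝ] ℝ) (u v : V) : A ![u, v] = - A ![v, u] := by
  have h := A.toAlternatingMap.map_swap ![v, u] (show (0 : Fin 2) ≠ 1 by decide)
  have e : ![v, u] ∘ Equiv.swap (0 : Fin 2) 1 = ![u, v] := by
    ext i; fin_cases i <;> simp
  rw [e] at h
  exact h

/-- Interchange of the derivative in time with the derivative in space, for a family of maps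
`f t` whose velocity at time `0` is `D`. -/
theorem hasDerivAt_fderiv_slice {f : ℝ × E → E} {D : E → E} {y₀ : E}
    (hf : ContDiffAt ℝ ∞ f (0, y₀))
    (hD : ∀ᶠ y in 𝓝 y₀, HasDerivAt (fun t => f (t, y)) (D y) 0) (w : E) :
    HasDerivAt (fun t : ℝ => fderiv ℝ (fun z => f (t, z)) y₀ w) (fderiv ℝ D y₀ w) 0 := by
  have hev : ∀ᶠ p in 𝓝 ((0 : ℝ), y₀), DifferentiableAt ℝ f p := by
    filter_upwards [(hf.of_le (m := 1) (by simp)).eventually (by simp)] with p hp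
      using hp.differentiableAt (by simp)
  have hf2 : DifferentiableAt ℝ (fderiv ℝ f) (0, y₀) :=
    (hf.fderiv_right (m := ∞) (by simp)).differentiableAt (by simp)
  -- The interchange of the two derivatives is the symmetry of the second derivative of `f` on the
  -- product.
  have hsymm := (hf.isSymmSndFDerivAt (by
    simpa using (WithTop.coe_le_coe.2 le_top : ((2 : ℕ∞) : WithTop ℕ∞) ≤ ∞)))
  have heval : ∀ x, HasFDerivAt (fun p => fderiv ℝ f p x)
      ((fderiv ℝ (fderiv ℝ f) (0, y₀)).flip x) (0, y₀) := fun x =>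
    (ContinuousLinearMap.apply ℝ E x).hasFDerivAt.comp _ hf2.hasFDerivAt
  have hline : ∀ (t : ℝ) (y : E), HasDerivAt (fun s : ℝ => (s, y)) ((1 : ℝ), (0 : E)) t :=
    fun t y => (hasDerivAt_id t).prodMk (hasDerivAt_const t y)
  have hinr : ∀ (t : ℝ) (y : E),
      HasFDerivAt (fun z : E => (t, z)) (ContinuousLinearMap.inr ℝ ℝ E) y := fun t y =>
    (hasFDerivAt_const t y).prodMk (hasFDerivAt_id y)
  have hpart : ∀ (t : ℝ) (y : E), DifferentiableAt ℝ f (t, y) →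
      fderiv ℝ (fun z => f (t, z)) y w = fderiv ℝ f (t, y) (0, w) := fun t y h => by
    have h2 := (h.hasFDerivAt.comp y (hinr t y)).fderiv
    rw [show (fun z => f (t, z)) = f ∘ fun z => (t, z) from rfl, h2]
    simp
  have hDeq : D =ᶠ[𝓝 y₀] fun y => fderiv ℝ f (0, y) (1, 0) := by
    have hc : Filter.Tendsto (fun y : E => ((0 : ℝ), y)) (𝓝 y₀) (𝓝 (0, y₀)) :=
      (continuous_const.prodMk continuous_id).continuousAt
    filter_upwards [hD, hc.eventually hev] with y hy1 hy2
    exact hy1.unique (hy2.hasFDerivAt.comp_hasDerivAt 0 (hline 0 y))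
  have hDder : fderiv ℝ D y₀ w = fderiv ℝ (fderiv ℝ f) (0, y₀) (0, w) (1, 0) := by
    have h2 : HasFDerivAt (fun y => fderiv ℝ f (0, y) ((1 : ℝ), (0 : E)))
        (((fderiv ℝ (fderiv ℝ f) (0, y₀)).flip (1, 0)).comp (ContinuousLinearMap.inr ℝ ℝ E)) y₀ :=
      (heval (1, 0)).comp y₀ (hinr 0 y₀)
    rw [hDeq.fderiv_eq, h2.fderiv]
    simp
  have h1 : HasDerivAt (fun t : ℝ => fderiv ℝ f (t, y₀) (0, w))
      ((fderiv ℝ (fderiv ℝ f) (0, y₀)).flip (0, w) (1, 0)) 0 :=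
    HasFDerivAt.comp_hasDerivAt (f := fun s : ℝ => (s, y₀)) (l := fun p => fderiv ℝ f p (0, w))
      (0 : ℝ) (heval (0, w)) (hline 0 y₀)
  have hc : Filter.Tendsto (fun t : ℝ => (t, y₀)) (𝓝 0) (𝓝 (0, y₀)) :=
    (continuous_id.prodMk continuous_const).continuousAt
  refine (h1.congr_deriv ?_).congr_of_eventuallyEq ?_
  · rw [hDder, hsymm.eq]
    simp
  · filter_upwards [hc.eventually hev] with t ht using hpart t y₀ ht

variable [FiniteDimensional ℝ E]

theorem ContDiffAt.alternating_curryLeft {X : Type*} [NormedAddCommGroup X] [NormedSpace ℝ X]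
    {k : ℕ} {n : WithTop ℕ∞} {Ω : X → E [⋀^Fin (k + 1)]→L[ℝ] ℝ} {D : X → E} {x : X}
    (hΩ : ContDiffAt ℝ n Ω x) (hD : ContDiffAt ℝ n D x) :
    ContDiffAt ℝ n (fun y => ContinuousAlternatingMap.curryLeft (Ω y) (D y)) x :=
  ContDiffAt.of_alternating_apply fun v =>
    hΩ.alternating_apply (w := fun y => Matrix.vecCons (D y) v)
      (Fin.cases hD fun _ => contDiffAt_const)

/-- Cartan's formula for a closed `2`-form on a vector space. The family `f t` stands for the flow
of the vector field `D`, and `c` for the value of the Lie derivative. -/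
theorem extDeriv_curryLeft_of_closed {Ω : E → E [⋀^Fin 2]→L[ℝ] ℝ} {f : ℝ × E → E} {D : E → E}
    {y₀ : E} (hΩ : ContDiffAt ℝ ∞ Ω y₀) (hclosed : extDeriv Ω y₀ = 0)
    (hf : ContDiffAt ℝ ∞ f (0, y₀)) (hf0 : f (0, y₀) = y₀)
    (hf1 : ∀ᶠ y in 𝓝 y₀, fderiv ℝ (fun z => f (0, z)) y = ContinuousLinearMap.id ℝ E)
    (hD : ∀ᶠ y in 𝓝 y₀, HasDerivAt (fun t => f (t, y)) (D y) 0)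
    (hDc : ContDiffAt ℝ ∞ D y₀) {v : Fin 2 → E} {c : ℝ}
    (hL : HasDerivAt (fun t => Ω (f (t, y₀)) (fun i => fderiv ℝ (fun z => f (t, z)) y₀ (v i))) c 0)
    : extDeriv (fun y => ContinuousAlternatingMap.curryLeft (Ω y) (D y)) y₀ v = c := by
  have htop : (∞ : WithTop ℕ∞) ≠ 0 := by simp
  have hDs : DifferentiableAt ℝ D y₀ := hDc.differentiableAt htop
  have hΩd : DifferentiableAt ℝ Ω y₀ := hΩ.differentiableAt htop
  have hwder := hasDerivAt_fderiv_slice hf hD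
  have hDy := hD.self_of_nhds
  have hΩf : HasDerivAt (fun t => Ω (f (t, y₀))) (fderiv ℝ Ω y₀ (D y₀)) 0 := by
    have : DifferentiableAt ℝ Ω (f (0, y₀)) := by rwa [hf0]
    have h := this.hasFDerivAt.comp_hasDerivAt (0 : ℝ) hDy
    rwa [hf0] at h
  have hid : ∀ w, fderiv ℝ (fun z => f (0, z)) y₀ w = w := fun w => by
    rw [hf1.self_of_nhds]; rfl
  -- Product rule at time `0`: one term moves the base point, the other two move the vectors with
  -- velocity `fderiv ℝ D y₀`.
  have hc : c = fderiv ℝ Ω y₀ (D y₀) v + (Ω y₀ ![fderiv ℝ D y₀ (v 0), v 1]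
      + Ω y₀ ![v 0, fderiv ℝ D y₀ (v 1)]) := by
    have h1 := hL.hasFDerivAt.fderiv
    have h2 := fderiv_continuousAlternatingMap_apply_apply (g := fun i t =>
      fderiv ℝ (fun z => f (t, z)) y₀ (v i)) hΩf.differentiableAt
      (fun i => (hwder (v i)).differentiableAt) (1 : ℝ)
    rw [h1] at h2
    simp only [hΩf.hasFDerivAt.fderiv, (hwder _).hasFDerivAt.fderiv, hf0, hid,
      ContinuousLinearMap.toSpanSingleton_apply, one_smul, Fin.sum_univ_two] at h2
    rw [h2]
    have hv : v = ![v 0, v 1] := by ext i; fin_cases i <;> rfl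
    congr 3
    · ext i; fin_cases i <;> simp
    · ext i; fin_cases i <;> simp
  -- Closedness on this triple trades the derivative of `Ω` along `D` for derivatives along `v 0`
  -- and `v 1`, which are those in `d (i_D Ω)`.
  have h3 : extDeriv Ω y₀ ![D y₀, v 0, v 1] = 0 := by rw [hclosed]; rfl
  have hconst : ∀ (w : Fin 2 → E) (x : E),
      fderiv ℝ (fun y => Ω y w) y₀ x = fderiv ℝ Ω y₀ x w := fun w x => by
    have := fderiv_continuousAlternatingMap_apply_apply (g := fun i (_ : E) => w i) hΩd
      (fun i => differentiableAt_const _) x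
    rw [this]
    simp
  rw [extDeriv_apply hΩd] at h3
  replace h3 := (Fin.sum_univ_three _).symm.trans h3
  simp only [hconst] at h3
  have r0 : (0 : Fin 3).removeNth ![D y₀, v 0, v 1] = ![v 0, v 1] := by
    ext i; fin_cases i <;> rfl
  have r1 : (1 : Fin 3).removeNth ![D y₀, v 0, v 1] = ![D y₀, v 1] := by
    ext i; fin_cases i <;> rfl
  have r2 : (2 : Fin 3).removeNth ![D y₀, v 0, v 1] = ![D y₀, v 0] := by
    ext i; fin_cases i <;> rfl
  have hv : ![v 0, v 1] = v := by ext i; fin_cases i <;> rfl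
  rw [r0, r1, r2, hv] at h3
  have hdiff : ∀ w : E, DifferentiableAt ℝ (fun y => Ω y ![D y, w]) y₀ ∧
      ∀ x, fderiv ℝ (fun y => Ω y ![D y, w]) y₀ x =
        fderiv ℝ Ω y₀ x ![D y₀, w] + Ω y₀ ![fderiv ℝ D y₀ x, w] := fun w => by
    have hg : ∀ i : Fin 2, DifferentiableAt ℝ (fun y => ![D y, w] i) y₀ := by
      intro i; fin_cases i
      · exact hDs
      · exact differentiableAt_const _
    have e : ∀ y, (fun i => ![D y, w] i) = ![D y, w] := fun y => rfl
    refine ⟨hΩd.continuousAlternatingMap_apply hg, fun x => ?_⟩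
    have := fderiv_continuousAlternatingMap_apply_apply (g := fun i y => ![D y, w] i) hΩd hg x
    refine this.trans ?_
    congr 1
    rw [Fin.sum_univ_two]
    have e1 : Function.update (fun i => ![D y₀, w] i) 1
        (fderiv ℝ (fun y => ![D y, w] 1) y₀ x) = ![D y₀, 0] := by
      ext i; fin_cases i <;> simp
    have e0 : Function.update (fun i => ![D y₀, w] i) 0
        (fderiv ℝ (fun y => ![D y, w] 0) y₀ x) = ![fderiv ℝ D y₀ x, w] := by
      ext i; fin_cases i <;> simp
    rw [e0, e1]
    have : Ω y₀ ![D y₀, 0] = 0 := (Ω y₀).toAlternatingMap.map_coord_zero 1 rfl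
    rw [this, add_zero]
  have hld : DifferentiableAt ℝ (fun y => ContinuousAlternatingMap.curryLeft (Ω y) (D y)) y₀ :=
    (hΩ.alternating_curryLeft hDc).differentiableAt htop
  rw [extDeriv_apply hld, Fin.sum_univ_two]
  have s0 : ∀ y, ContinuousAlternatingMap.curryLeft (Ω y) (D y) ((0 : Fin 2).removeNth v) =
      Ω y ![D y, v 1] := fun y => by
    rw [ContinuousAlternatingMap.curryLeft_apply_apply]
    congr 1
    ext i; fin_cases i <;> rfl
  have s1 : ∀ y, ContinuousAlternatingMap.curryLeft (Ω y) (D y) ((1 : Fin 2).removeNth v) =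
      Ω y ![D y, v 0] := fun y => by
    rw [ContinuousAlternatingMap.curryLeft_apply_apply]
    congr 1
    ext i; fin_cases i <;> rfl
  simp only [s0, s1, (hdiff _).2]
  rw [hc, (Ω y₀).apply_pair_swap (v 0) (fderiv ℝ D y₀ (v 1))]
  simp at h3 ⊢
  linarith

end CartanVectorSpace

/-! ### Integrating the scaling equation along the flow. -/

section FlowCalculus

variable {E : Type*} [NormedAddCommGroup E] [NormedSpace ℝ E]
  {M : Type*} [TopologicalSpace M] [ChartedSpace E M] {k : ℕ}
  {D : (x : M) → TangentSpace 𝓘(ℝ, E) x} {φ : Flow ℝ M}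

theorem IsGlobalFlow.contMDiff_map (hφ : IsGlobalFlow D φ) (t : ℝ) :
    ContMDiff 𝓘(ℝ, E) 𝓘(ℝ, E) ∞ (φ t) :=
  hφ.smooth.comp (contMDiff_const.prodMk contMDiff_id)

theorem IsGlobalFlow.mdifferentiableAt_map (hφ : IsGlobalFlow D φ) (t : ℝ) (x : M) :
    MDifferentiableAt 𝓘(ℝ, E) 𝓘(ℝ, E) (φ t) x :=
  (hφ.contMDiff_map t x).mdifferentiableAt (by simp)

/-- A form which is its own Lie derivative is scaled exponentially by the flow. -/
theorem IsLieDerivative.pullback_eq_exp_smul (hφ : IsGlobalFlow D φ) {Ω : DiffForm E M k}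
    (h : IsLieDerivative φ Ω Ω) (t : ℝ) (x : M) (v : Fin k → TangentSpace 𝓘(ℝ, E) x) :
    DiffForm.pullback (φ t) Ω x v = Real.exp t * Ω x v := by
  set g : ℝ → ℝ := fun t => DiffForm.pullback (φ t) Ω x v with hg
  -- The group law carries the derivative at time `0`, taken at the point `φ t x`, to time `t`;
  -- hence `g' = g` everywhere.
  have hadd : ∀ t s, g (t + s) = DiffForm.pullback (φ s) Ω (φ t x)
      (fun i => mfderiv 𝓘(ℝ, E) 𝓘(ℝ, E) (φ t) x (v i)) := fun t s => by
    have h1 : φ.toFun (t + s) = φ.toFun s ∘ φ.toFun t := by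
      funext y
      rw [add_comm]
      exact φ.map_add s t y
    have h2 := DiffForm.pullback_pullback (E := E) Ω (hφ.mdifferentiableAt_map s (φ t x))
      (hφ.mdifferentiableAt_map t x)
    have h3 : DiffForm.pullback (E := E) (φ (t + s)) Ω x =
      DiffForm.pullback (E := E) (φ s ∘ φ t) Ω x := by
        refine DiffForm.pullback_congr Ω ?_
        rw [h1]
    rw [hg]
    dsimp only
    exact (DFunLike.congr_fun h3 v).trans (DFunLike.congr_fun h2 v).symm
  have hderiv : ∀ t, HasDerivAt g (g t) t := fun t => by
    have h1 := h (φ t x) (fun i => mfderiv 𝓘(ℝ, E) 𝓘(ℝ, E) (φ t) x (v i))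
    have h2 : HasDerivAt (fun s => g (t + s)) (g t) 0 := by
      simp_rw [hadd t]
      exact h1
    have h3 : HasDerivAt (fun s => g (t + (s - t))) (g t) t :=
      HasDerivAt.comp_sub_const (f := fun s => g (t + s)) t t (by simpa using h2)
    simpa using h3
  -- Uniqueness for `g' = g`: the function `e^{-s} g(s)` is constant.
  have hconst : ∀ t, HasDerivAt (fun s => Real.exp (-s) * g s) 0 t := fun t => by
    have h1 := ((hasDerivAt_neg t).exp).mul (hderiv t)
    refine h1.congr_deriv ?_
    ring
  have h0 := is_const_of_deriv_eq_zero (fun t => (hconst t).differentiableAt)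
    (fun t => (hconst t).deriv) t 0
  have hg0 : g 0 = Ω x v := by
    have h1 : φ.toFun (0 : ℝ) = id := by
      funext y; exact φ.map_zero_apply y
    have h3 : DiffForm.pullback (E := E) (φ (0 : ℝ)) Ω x =
      DiffForm.pullback (E := E) id Ω x := by
        refine DiffForm.pullback_congr Ω ?_
        rw [h1]
    rw [DiffForm.pullback_id] at h3
    exact DFunLike.congr_fun h3 v
  simp only [neg_zero, Real.exp_zero, one_mul, hg0] at h0
  rw [← h0, ← mul_assoc, ← Real.exp_add]
  simp [hg]

/-- The flow preserves its generator. -/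
theorem IsGlobalFlow.mfderiv_map_generator (hφ : IsGlobalFlow D φ) (t : ℝ) (x : M) :
    mfderiv 𝓘(ℝ, E) 𝓘(ℝ, E) (φ t) x (D x) = D (φ t x) := by
  have h1 := hφ.generator x 0
  have h0 : φ 0 x = x := φ.map_zero_apply x
  have h2 : HasMFDerivAt 𝓘(ℝ, E) 𝓘(ℝ, E) (φ t) (φ 0 x)
      (mfderiv 𝓘(ℝ, E) 𝓘(ℝ, E) (φ t) (φ 0 x)) :=
    (hφ.mdifferentiableAt_map t _).hasMFDerivAt
  -- The curve `s ↦ φ t (φ s x) = φ s (φ t x)` is differentiated at `s = 0` in both of its forms.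
  have h3 := HasMFDerivAt.comp (0 : ℝ) h2 h1
  have h4 := hφ.generator (φ t x) 0
  have h5 : (φ t ∘ fun s => φ s x) = fun s => φ s (φ t x) := by
    funext s
    simp only [Function.comp_apply]
    rw [← φ.map_add, ← φ.map_add, add_comm]
  rw [h5] at h3
  have h6 := DFunLike.congr_fun (hasMFDerivAt_unique h3 h4) (1 : ℝ)
  have h7 : mfderiv 𝓘(ℝ, E) 𝓘(ℝ, E) (φ t) (φ 0 x) (D (φ 0 x)) = D (φ 0 (φ t x)) := by
    have a1 : ∀ w : E, ((1 : ℝ →L[ℝ] ℝ).smulRight w) (1 : ℝ) = w := fun w => by simp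
    have a2 := a1 (D (φ 0 (φ t x)))
    have a3 := a1 (D (φ 0 x))
    refine Eq.trans ?_ (h6.trans a2)
    exact congrArg (mfderiv 𝓘(ℝ, E) 𝓘(ℝ, E) (φ t) (φ 0 x)) a3.symm
  have e : ∀ y z : M, y = z → (D y : E) = D z := fun y z h => by subst h; rfl
  have e' : ∀ y z : M, y = z → (mfderiv 𝓘(ℝ, E) 𝓘(ℝ, E) (φ t) y (D y) : E) =
      mfderiv 𝓘(ℝ, E) 𝓘(ℝ, E) (φ t) z (D z) := fun y z h => by subst h; rfl
  exact (e' _ _ h0).symm.trans (h7.trans (e _ _ (φ.map_zero_apply _)))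

/-- The generator of a free flow vanishes nowhere. -/
theorem IsGlobalFlow.generator_ne_zero [T2Space M] [CompleteSpace E] [IsManifold 𝓘(ℝ, E) ∞ M]
    (hD : ContMDiff 𝓘(ℝ, E) 𝓘(ℝ, E).tangent ∞ (fun x => (⟨x, D x⟩ : TangentBundle 𝓘(ℝ, E) M)))
    (hφ : IsGlobalFlow D φ) (hfree : ∀ (t : ℝ) (x : M), φ t x = x → t = 0) (x : M) : D x ≠ 0 := by
  intro hx
  -- At a zero of `D` the constant curve is also integral, so by uniqueness the point is fixed at
  -- time `1`, against freeness.
  have h2 := isMIntegralCurve_Ioo_eq_of_contMDiff_boundaryless (t₀ := 0)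
    (hD.of_le (by simp)) (hφ.generator x) (isMIntegralCurve_const hx) (φ.map_zero_apply x)
  exact one_ne_zero (hfree 1 x (congrFun h2 1))

end FlowCalculus

/-! ### Cartan's formula on the manifold. -/

section CartanManifold

variable {E : Type*} [NormedAddCommGroup E] [NormedSpace ℝ E]
  {M : Type*} [TopologicalSpace M] [ChartedSpace E M] [IsManifold 𝓘(ℝ, E) ∞ M] {k : ℕ}
  {D : (x : M) → TangentSpace 𝓘(ℝ, E) x} {φ : Flow ℝ M}

/-- The coordinate expression of a vector field in the preferred chart at `x`. -/
def vectorFieldInChart (D : (x : M) → TangentSpace 𝓘(ℝ, E) x) (x : M) (y : E) : E :=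
  mfderiv 𝓘(ℝ, E) 𝓘(ℝ, E) (extChartAt 𝓘(ℝ, E) x) ((extChartAt 𝓘(ℝ, E) x).symm y)
    (D ((extChartAt 𝓘(ℝ, E) x).symm y))

theorem contDiffAt_vectorFieldInChart
    (hD : ContMDiff 𝓘(ℝ, E) 𝓘(ℝ, E).tangent ∞ (fun x => (⟨x, D x⟩ : TangentBundle 𝓘(ℝ, E) M)))
    (x : M) : ContDiffAt ℝ ∞ (vectorFieldInChart D x) (extChartAt 𝓘(ℝ, E) x x) := by
  have h1 := (Bundle.contMDiffAt_section x).1 (hD x)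
  have h2 : ContMDiffAt 𝓘(ℝ, E) 𝓘(ℝ, E) ∞ (fun p => (mfderiv 𝓘(ℝ, E) 𝓘(ℝ, E)
      (extChartAt 𝓘(ℝ, E) x) p (D p) : E)) x := by
    refine h1.congr_of_eventuallyEq ?_
    filter_upwards [(chartAt E x).open_source.mem_nhds (mem_chart_source E x)] with p hp
    rw [← TangentBundle.continuousLinearMapAt_trivializationAt hp]
    exact ((trivializationAt E (TangentSpace 𝓘(ℝ, E)) x).continuousLinearMapAt_apply_of_mem ℝ
      (by simpa using hp) (D p))
  rw [← contMDiffAt_iff_contDiffAt]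
  refine ContMDiffAt.comp (I' := 𝓘(ℝ, E)) _ (g := fun p => (mfderiv 𝓘(ℝ, E) 𝓘(ℝ, E)
      (extChartAt 𝓘(ℝ, E) x) p (D p) : E)) ?_ ?_
  · rwa [extChartAt_to_inv]
  · exact (contMDiffOn_extChartAt_symm x).contMDiffAt
      ((isOpen_extChartAt_target x).mem_nhds (mem_extChartAt_target x))

theorem mfderiv_extChartAt_symm_vectorFieldInChart {x : M} {y : E}
    (hy : y ∈ (extChartAt 𝓘(ℝ, E) x).target) :
    (mfderiv 𝓘(ℝ, E) 𝓘(ℝ, E) (extChartAt 𝓘(ℝ, E) x).symm y (vectorFieldInChart (E := E) D x y) : E) =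
      D ((extChartAt 𝓘(ℝ, E) x).symm y) := by
  set e := extChartAt 𝓘(ℝ, E) x
  have hsrc := e.map_target hy
  have h1 : MDifferentiableAt 𝓘(ℝ, E) 𝓘(ℝ, E) e (e.symm y) :=
    mdifferentiableAt_extChartAt (by simpa [e] using hsrc)
  have h2 : MDifferentiableAt 𝓘(ℝ, E) 𝓘(ℝ, E) e.symm (e (e.symm y)) := by
    rw [e.right_inv hy]; exact mdifferentiableAt_extChartAt_symm hy
  have h3 := mfderiv_comp_apply (e.symm y) h2 h1 (D (e.symm y))
  have hev : e.symm ∘ e =ᶠ[𝓝 (e.symm y)] id := by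
    filter_upwards [(isOpen_extChartAt_source (I := 𝓘(ℝ, E)) x).mem_nhds hsrc] with p hp
      using e.left_inv hp
  have h4 : (mfderiv 𝓘(ℝ, E) 𝓘(ℝ, E) (e.symm ∘ e) (e.symm y) : E →L[ℝ] E) =
    mfderiv 𝓘(ℝ, E) 𝓘(ℝ, E) id (e.symm y) := hev.mfderiv_eq
  have h5 := DFunLike.congr_fun h4 (D (e.symm y))
  rw [mfderiv_id] at h5
  have e' : ∀ a b w : E, a = b → (mfderiv 𝓘(ℝ, E) 𝓘(ℝ, E) e.symm a w : E) =
      mfderiv 𝓘(ℝ, E) 𝓘(ℝ, E) e.symm b w := fun a b w h => by subst h; rfl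
  exact (e' _ _ _ (e.right_inv hy).symm).trans (h3.symm.trans h5)

theorem DiffForm.inChart_interior (Ω : DiffForm E M (k + 1)) {x : M} {y : E}
    (hy : y ∈ (extChartAt 𝓘(ℝ, E) x).target) :
    (DiffForm.interior D Ω).inChart x y =
      ContinuousAlternatingMap.curryLeft (Ω.inChart x y) (vectorFieldInChart D x y) := by
  ext v
  refine congrArg (Ω ((extChartAt 𝓘(ℝ, E) x).symm y)) ?_
  funext i
  refine Fin.cases ?_ (fun i => rfl) i
  exact (mfderiv_extChartAt_symm_vectorFieldInChart hy).symm

variable [FiniteDimensional ℝ E]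

theorem DiffForm.SmoothAt.interior
    (hD : ContMDiff 𝓘(ℝ, E) 𝓘(ℝ, E).tangent ∞ (fun x => (⟨x, D x⟩ : TangentBundle 𝓘(ℝ, E) M)))
    {Ω : DiffForm E M (k + 1)} {x : M} (hΩ : Ω.SmoothAt x) :
    (DiffForm.interior D Ω).SmoothAt x := by
  refine ContDiffAt.congr_of_eventuallyEq
    (ContDiffAt.alternating_curryLeft hΩ (contDiffAt_vectorFieldInChart hD x)) ?_
  filter_upwards [(isOpen_extChartAt_target x).mem_nhds (mem_extChartAt_target x)] with y hy
    using DiffForm.inChart_interior Ω hy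

/-- If `D` scales the closed form `Ω` then `d (i_D Ω) = Ω`. -/
theorem DiffForm.d_interior_eq
    (hD : ContMDiff 𝓘(ℝ, E) 𝓘(ℝ, E).tangent ∞ (fun x => (⟨x, D x⟩ : TangentBundle 𝓘(ℝ, E) M)))
    (hφ : IsGlobalFlow D φ) {Ω : DiffForm E M 2} (hΩ : ∀ x, Ω.SmoothAt x)
    (hclosed : ∀ x, Ω.d x = 0) (hL : IsLieDerivative φ Ω Ω) : (DiffForm.interior D Ω).d = Ω := by
  funext x
  set e := extChartAt 𝓘(ℝ, E) x with he
  have hsurj : Function.Surjective (mfderiv 𝓘(ℝ, E) 𝓘(ℝ, E) e x) :=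
    (isInvertible_mfderiv_extChartAt (I := 𝓘(ℝ, E)) (mem_extChartAt_source x)).bijective.surjective
  -- The form `Ω.d x` is this one precomposed with the chart derivative, which is onto, so vanishing
  -- passes to the coordinate expression.
  have hclosed' : extDeriv (Ω.inChart x) (e x) = 0 := by
    ext v
    choose w hw using fun i => hsurj (v i)
    have := DFunLike.congr_fun (hclosed x) w
    have hv : v = fun i => mfderiv 𝓘(ℝ, E) 𝓘(ℝ, E) e x (w i) := funext fun i => (hw i).symm
    rw [hv]
    exact this
  have hes : e.symm (e x) = x := extChartAt_to_inv x
  have htgt : ∀ᶠ y in 𝓝 (e x), y ∈ e.target :=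
    (isOpen_extChartAt_target x).mem_nhds (mem_extChartAt_target x)
  -- The flow read in the chart, meaningful only near `(0, e x)`; all hypotheses of the flat Cartan
  -- formula are local there.
  let f : ℝ × E → E := fun p => e (φ p.1 (e.symm p.2))
  have hφe : ContMDiffAt 𝓘(ℝ, ℝ × E) 𝓘(ℝ, E) ∞ (fun p : ℝ × E => φ p.1 (e.symm p.2)) (0, e x) := by
    have h1 : ContMDiffAt 𝓘(ℝ, ℝ × E) 𝓘(ℝ, E) ∞ (fun p : ℝ × E => e.symm p.2) (0, e x) :=
      ContMDiffAt.comp (I' := 𝓘(ℝ, E)) ((0 : ℝ), e x) (g := e.symm)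
        ((contMDiffOn_extChartAt_symm x).contMDiffAt htgt) contDiffAt_snd.contMDiffAt
    have h2 : ContMDiffAt 𝓘(ℝ, ℝ × E) 𝓘(ℝ, ℝ) ∞ (fun p : ℝ × E => p.1) (0, e x) :=
      contDiffAt_fst.contMDiffAt
    exact (hφ.smooth _).comp _ (h2.prodMk h1)
  have hf : ContDiffAt ℝ ∞ f (0, e x) := by
    rw [← contMDiffAt_iff_contDiffAt]
    refine ContMDiffAt.comp (I' := 𝓘(ℝ, E)) _ (g := e) ?_ hφe
    have : φ (0 : ℝ) (e.symm (e x)) = x := by rw [hes]; exact φ.map_zero_apply x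
    simp only [this]
    exact contMDiffAt_extChartAt
  have hf0 : ∀ᶠ y in 𝓝 (e x), f (0, y) = y := by
    filter_upwards [htgt] with y hy
    simp only [f, φ.map_zero_apply]
    exact e.right_inv hy
  have hlam : (DiffForm.interior D Ω).inChart x =ᶠ[𝓝 (e x)] fun y =>
      ContinuousAlternatingMap.curryLeft (Ω.inChart x y) (vectorFieldInChart D x y) := by
    filter_upwards [htgt] with y hy using DiffForm.inChart_interior Ω hy
  ext v
  have hD0 : ∀ᶠ y in 𝓝 (e x), HasDerivAt (fun t => f (t, y)) (vectorFieldInChart D x y) 0 := by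
    filter_upwards [htgt] with y hy
    have h1 := hφ.generator (e.symm y) 0
    have h0 : φ (0 : ℝ) (e.symm y) = e.symm y := φ.map_zero_apply _
    have h2 : HasMFDerivAt 𝓘(ℝ, E) 𝓘(ℝ, E) e (φ (0 : ℝ) (e.symm y))
        (mfderiv 𝓘(ℝ, E) 𝓘(ℝ, E) e (φ (0 : ℝ) (e.symm y))) := by
      rw [h0]
      exact (mdifferentiableAt_extChartAt (by simpa [e] using e.map_target hy)).hasMFDerivAt
    let A : E →L[ℝ] E := mfderiv 𝓘(ℝ, E) 𝓘(ℝ, E) e (φ (0 : ℝ) (e.symm y))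
    let d : E := D (φ (0 : ℝ) (e.symm y))
    have h3 : HasFDerivAt (fun t : ℝ => f (t, y)) (A.comp ((1 : ℝ →L[ℝ] ℝ).smulRight d)) 0 :=
      hasMFDerivAt_iff_hasFDerivAt.1 (HasMFDerivAt.comp (0 : ℝ) h2 h1)
    refine h3.hasDerivAt.congr_deriv ?_
    have e' : ∀ a b : M, a = b → (mfderiv 𝓘(ℝ, E) 𝓘(ℝ, E) e a (D a) : E) =
      mfderiv 𝓘(ℝ, E) 𝓘(ℝ, E) e b (D b) := fun a b h => by subst h; rfl
    refine Eq.trans ?_ (e' _ _ h0)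
    have a1 : ((1 : ℝ →L[ℝ] ℝ).smulRight d) (1 : ℝ) = d := by simp
    exact congrArg A a1
  have hf1 : ∀ᶠ y in 𝓝 (e x), fderiv ℝ (fun z => f (0, z)) y = ContinuousLinearMap.id ℝ E := by
    filter_upwards [hf0.eventually_nhds] with y hy
    rw [Filter.EventuallyEq.fderiv_eq (f := id) hy, fderiv_id]
  have hed : MDifferentiableAt 𝓘(ℝ, E) 𝓘(ℝ, E) e x := mdifferentiableAt_extChartAt (by simp)
  let w : Fin 2 → E := fun i => mfderiv 𝓘(ℝ, E) 𝓘(ℝ, E) e x (v i)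
  have hLie : HasDerivAt (fun t : ℝ => Ω.inChart x (f (t, e x))
      (fun i => fderiv ℝ (fun z => f (t, z)) (e x) (w i))) (Ω x v) 0 := by
    refine (hL x v).congr_of_eventuallyEq ?_
    have hc : Filter.Tendsto (fun t : ℝ => φ t x) (𝓝 0) (𝓝 x) := by
      have h1 : Continuous fun t : ℝ => φ t x := φ.continuous continuous_id continuous_const
      have h2 := h1.tendsto 0
      rwa [show φ (0 : ℝ) x = x from φ.map_zero_apply x] at h2
    filter_upwards [hc.eventually ((isOpen_extChartAt_source (I := 𝓘(ℝ, E)) x).mem_nhds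
      (mem_extChartAt_source x))] with t ht
    have h1 : DiffForm.inChart (DiffForm.pullback (E := E) (φ t) Ω) x (e x) = _ :=
      DiffForm.inChart_pullback (x₀ := x) (y₀ := x) (z := e x) Ω (mem_extChartAt_target x)
        (by rw [hes]; exact ht) (hφ.mdifferentiableAt_map t _)
    have h2 := DFunLike.congr_fun h1 w
    have hsymm : ∀ i, (mfderiv 𝓘(ℝ, E) 𝓘(ℝ, E) e.symm (e x) (w i) : E) = v i := fun i => by
      have h4 := mfderiv_comp_apply x (mdifferentiableAt_extChartAt_symm
        (mem_extChartAt_target x)) hed (v i)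
      have hev : e.symm ∘ e =ᶠ[𝓝 x] id := by
        filter_upwards [(isOpen_extChartAt_source (I := 𝓘(ℝ, E)) x).mem_nhds
          (mem_extChartAt_source x)] with p hp using e.left_inv hp
      have h5 : (mfderiv 𝓘(ℝ, E) 𝓘(ℝ, E) (e.symm ∘ e) x : E →L[ℝ] E) =
        mfderiv 𝓘(ℝ, E) 𝓘(ℝ, E) id x := hev.mfderiv_eq
      have h6 := DFunLike.congr_fun h5 (v i)
      rw [mfderiv_id] at h6
      exact h4.symm.trans h6
    refine Eq.trans ?_ (h2.symm.trans ?_)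
    · rfl
    · exact (DiffForm.pullback (E := E) (φ t) Ω).apply_congr hes (funext hsymm)
  have key := extDeriv_curryLeft_of_closed (hΩ x) hclosed' hf hf0.self_of_nhds hf1 hD0
    (contDiffAt_vectorFieldInChart hD x) hLie
  rw [← hlam.extDeriv_eq] at key
  exact key

end CartanManifold

/-! ### Topology of the orbit space. -/

section OrbitTopology

variable {M : Type*} [TopologicalSpace M] (φ : Flow ℝ M)

theorem Flow.continuous_map (t : ℝ) : Continuous (φ t) :=
  φ.cont'.comp (Continuous.prodMk continuous_const continuous_id)

theorem Flow.map_neg_map (t : ℝ) (x : M) : φ (-t) (φ t x) = x := by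
  rw [← φ.map_add, neg_add_cancel, φ.map_zero_apply]

theorem OrbitSpace.proj_eq_iff {x y : M} : proj φ x = proj φ y ↔ ∃ t, φ t x = y := by
  let := φ.toAddAction
  refine Quotient.eq.trans ⟨?_, ?_⟩
  · rintro ⟨t, ht⟩
    refine ⟨-t, ?_⟩
    rw [← show φ t y = x from ht, φ.map_neg_map]
  · rintro ⟨t, rfl⟩
    exact ⟨-t, φ.map_neg_map t x⟩

@[simp]
theorem OrbitSpace.proj_map (t : ℝ) (x : M) : proj φ (φ t x) = proj φ x :=
  ((proj_eq_iff φ).2 ⟨t, rfl⟩).symm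

theorem OrbitSpace.proj_out (c : OrbitSpace φ) : proj φ c.out = c := Quotient.out_eq c

theorem OrbitSpace.isOpenQuotientMap_proj : IsOpenQuotientMap (proj φ) := by
  let := φ.toAddAction
  have : ContinuousConstVAdd ℝ M := ⟨φ.continuous_map⟩
  exact AddAction.isOpenQuotientMap_quotientMk

theorem OrbitSpace.t2Space (h : IsProperMap (fun p : ℝ × M => (φ p.1 p.2, p.2))) :
    T2Space (OrbitSpace φ) := by
  let := φ.toAddAction
  have : ProperVAdd ℝ M := ⟨h⟩
  exact t2Space_quotient_addAction_of_properVAdd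

theorem OrbitSpace.secondCountableTopology [SecondCountableTopology M] :
    SecondCountableTopology (OrbitSpace φ) := by
  let := φ.toAddAction
  have : ContinuousConstVAdd ℝ M := ⟨φ.continuous_map⟩
  exact ContinuousConstVAdd.secondCountableTopology

/-- For a free and proper action of `ℝ`, points close to `x` return close to `x` only in a short
time. -/
theorem Flow.exists_isOpen_forall_abs_lt {φ : Flow ℝ M}
    (hfree : ∀ (t : ℝ) (x : M), φ t x = x → t = 0)
    (h : IsProperMap (fun p : ℝ × M => (φ p.1 p.2, p.2))) (x : M) {δ : ℝ} (hδ : 0 < δ) :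
    ∃ V : Set M, IsOpen V ∧ x ∈ V ∧ ∀ y ∈ V, ∀ t, φ t y ∈ V → |t| < δ := by
  have hZ : IsClosed {p : ℝ × M | δ ≤ |p.1|} :=
    isClosed_le continuous_const (continuous_abs.comp continuous_fst)
  have hc := h.isClosedMap _ hZ
  -- The image of the closed set of times `|t| ≥ δ` is closed by properness and misses `(x, x)` by
  -- freeness, so a product neighbourhood misses it too.
  have hx : (x, x) ∈ ((fun p : ℝ × M => (φ p.1 p.2, p.2)) '' {p : ℝ × M | δ ≤ |p.1|})ᶜ := by
    rintro ⟨⟨t, y⟩, ht, he⟩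
    obtain ⟨h1, rfl⟩ := Prod.mk.inj he
    have := hfree t y h1
    subst this
    simp at ht
    linarith
  obtain ⟨U, V, hU, hV, hxU, hxV, hUV⟩ := isOpen_prod_iff.1 hc.isOpen_compl x x hx
  refine ⟨U ∩ V, hU.inter hV, ⟨hxU, hxV⟩, fun y hy t ht => ?_⟩
  by_contra hlt
  exact hUV (Set.mk_mem_prod ht.1 hy.2) ⟨(t, y), not_lt.1 hlt, rfl⟩

end OrbitTopology

/-! ### Flow boxes. -/

section FlowBox

variable {E : Type*} [NormedAddCommGroup E] [NormedSpace ℝ E]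
  {E₁ : Type*} [NormedAddCommGroup E₁] [NormedSpace ℝ E₁]
  {M : Type*} [TopologicalSpace M] [ChartedSpace E M]
  {D : (x : M) → TangentSpace 𝓘(ℝ, E) x} {φ : Flow ℝ M}

/-- A chart `e` in which the flow is the translation of the second coordinate of `E ≃ E₁ × ℝ`, and
which meets every orbit in at most one segment. -/
structure IsFlowBox (φ : Flow ℝ M) (L : E ≃L[ℝ] E₁ × ℝ) (e : OpenPartialHomeomorph M E) :
    Prop where
  mem_maximalAtlas : e ∈ IsManifold.maximalAtlas 𝓘(ℝ, E) ∞ M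
  base_mem : ∀ y ∈ e.target, L.symm ((L y).1, 0) ∈ e.target
  symm_eq : ∀ y ∈ e.target, e.symm y = φ (L y).2 (e.symm (L.symm ((L y).1, 0)))
  fst_eq : ∀ y ∈ e.target, ∀ y' ∈ e.target, ∀ t,
    φ t (e.symm y) = e.symm y' → (L y).1 = (L y').1

theorem exists_continuousLinearEquiv_prod_apply_eq [FiniteDimensional ℝ E]
    [FiniteDimensional ℝ E₁] (hdim : Module.finrank ℝ E = Module.finrank ℝ E₁ + 1) {v : E}
    (hv : v ≠ 0) : ∃ L : E ≃L[ℝ] E₁ × ℝ, L v = (0, 1) := by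
  have L₀ : E ≃L[ℝ] E₁ × ℝ := ContinuousLinearEquiv.ofFinrankEq (by simp [hdim])
  obtain ⟨A, hA⟩ := SeparatingDual.exists_continuousLinearEquiv_apply_eq (R := ℝ) hv
    (y := L₀.symm (0, 1)) (by simp)
  exact ⟨A.trans L₀, by simp [hA]⟩

variable [FiniteDimensional ℝ E] [IsManifold 𝓘(ℝ, E) ∞ M]

/-- Flowing out of a transversal to `D m` has invertible derivative at the origin, so it is a local
diffeomorphism. Return times of points near `m` are short, and within a short time injectivity on a
larger box forbids a second segment of the same orbit. -/
theorem IsGlobalFlow.exists_isFlowBox [T2Space M] [FiniteDimensional ℝ E₁]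
    (hdim : Module.finrank ℝ E = Module.finrank ℝ E₁ + 1)
    (hD : ContMDiff 𝓘(ℝ, E) 𝓘(ℝ, E).tangent ∞ (fun x => (⟨x, D x⟩ : TangentBundle 𝓘(ℝ, E) M)))
    (hφ : IsGlobalFlow D φ) (hfree : ∀ (t : ℝ) (x : M), φ t x = x → t = 0)
    (hproper : IsProperMap (fun p : ℝ × M => (φ p.1 p.2, p.2))) (m : M) :
    ∃ (L : E ≃L[ℝ] E₁ × ℝ) (e : OpenPartialHomeomorph M E), IsFlowBox φ L e ∧ m ∈ e.source := by
  have : CompleteSpace E := FiniteDimensional.complete ℝ E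
  obtain ⟨D₀, hD₀⟩ : ∃ D₀ : E, D₀ = D m := ⟨_, rfl⟩
  obtain ⟨L, hL⟩ := exists_continuousLinearEquiv_prod_apply_eq (E := E) (E₁ := E₁) (v := D₀) hdim
    (hD₀ ▸ hφ.generator_ne_zero hD hfree m)
  set c := extChartAt 𝓘(ℝ, E) m with hc
  set y₀ : E := c m with hy₀
  set b : E → E := fun y => y₀ + L.symm ((L y).1, 0) with hb
  have hbd : ContDiff ℝ ∞ b := by
    refine contDiff_const.add (L.symm.contDiff.comp ?_)
    exact (contDiff_fst.comp L.contDiff).prodMk contDiff_const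
  -- The component of `L y` in `E₁` chooses a point of the transversal through `m`, and the real
  -- component is the time of flow.
  set Ψ : E → M := fun y => φ (L y).2 (c.symm (b y)) with hΨ
  have hb0 : b 0 = y₀ := by simp [hb]
  set G₀ : Set E := b ⁻¹' c.target with hG₀
  have hG₀o : IsOpen G₀ := (isOpen_extChartAt_target m).preimage hbd.continuous
  have h0G₀ : (0 : E) ∈ G₀ := by
    rw [hG₀, Set.mem_preimage, hb0]; exact mem_extChartAt_target m
  have hΨs : ∀ y ∈ G₀, ContMDiffAt 𝓘(ℝ, E) 𝓘(ℝ, E) ∞ Ψ y := by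
    intro y hy
    have h1 : ContMDiffAt 𝓘(ℝ, E) 𝓘(ℝ, E) ∞ (fun y => c.symm (b y)) y :=
      ContMDiffAt.comp y (I' := 𝓘(ℝ, E)) ((contMDiffOn_extChartAt_symm m).contMDiffAt
        ((isOpen_extChartAt_target m).mem_nhds hy)) hbd.contMDiff.contMDiffAt
    have h2 : ContMDiffAt 𝓘(ℝ, E) 𝓘(ℝ, ℝ) ∞ (fun y => (L y).2) y :=
      (contDiff_snd.comp L.contDiff).contMDiff.contMDiffAt
    exact (hφ.smooth _).comp y (h2.prodMk h1)
  have hΨ0 : Ψ 0 = m := by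
    simp only [hΨ, hb0, map_zero, Prod.snd_zero, φ.map_zero_apply]
    exact extChartAt_to_inv m
  set G₁ : Set E := G₀ ∩ Ψ ⁻¹' c.source with hG₁
  have hG₁o : IsOpen G₁ := by
    refine ContinuousOn.isOpen_inter_preimage
      (fun y hy => (hΨs y hy).continuousAt.continuousWithinAt) hG₀o (isOpen_extChartAt_source m)
  have h0G₁ : (0 : E) ∈ G₁ := ⟨h0G₀, by
    rw [Set.mem_preimage, hΨ0]; exact mem_extChartAt_source m⟩
  set g : E → E := fun y => c (Ψ y) with hg
  have hgs : ∀ y ∈ G₁, ContDiffAt ℝ ∞ g y := by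
    intro y hy
    rw [← contMDiffAt_iff_contDiffAt]
    exact ContMDiffAt.comp y (I' := 𝓘(ℝ, E)) (contMDiffAt_extChartAt'
      ((extChartAt_source 𝓘(ℝ, E) m).subset hy.2)) (hΨs y hy.1)
  have hg0 : g 0 = y₀ := by simp only [hg, hΨ0, hy₀]
  -- the derivative of `g` at the origin
  have hgf : HasFDerivAt g ((ContinuousLinearEquiv.refl ℝ E : E ≃L[ℝ] E) : E →L[ℝ] E) 0 := by
    have h0 := ((hgs 0 h0G₁).differentiableAt (by simp)).hasFDerivAt
    have hline : ∀ v : E, HasDerivAt (fun h : ℝ => g (h • v)) (fderiv ℝ g 0 v) 0 := fun v => by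
      have h1 : HasDerivAt (fun h : ℝ => h • v) v 0 := by
        simpa using (hasDerivAt_id (0 : ℝ)).smul_const v
      have h0' : HasFDerivAt g (fderiv ℝ g 0) ((0 : ℝ) • v) := by simpa using h0
      exact h0'.comp_hasDerivAt (0 : ℝ) h1
    have hbase : ∀ a : E₁, fderiv ℝ g 0 (L.symm (a, 0)) = L.symm (a, 0) := fun a => by
      refine (hline _).unique ?_
      have h1 : HasDerivAt (fun h : ℝ => y₀ + h • L.symm (a, (0 : ℝ))) (L.symm (a, 0)) 0 := by
        simpa using ((hasDerivAt_id (0 : ℝ)).smul_const (L.symm (a, (0 : ℝ)))).const_add y₀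
      refine h1.congr_of_eventuallyEq ?_
      have hcont : ContinuousAt (fun h : ℝ => h • L.symm (a, (0 : ℝ))) 0 := by fun_prop
      have : ∀ᶠ h : ℝ in 𝓝 0, h • L.symm (a, (0 : ℝ)) ∈ G₀ :=
        hcont (by simpa using hG₀o.mem_nhds h0G₀)
      filter_upwards [this] with h hh
      have e1 : b (h • L.symm (a, (0 : ℝ))) = y₀ + h • L.symm (a, (0 : ℝ)) := by
        simp only [hb, map_smul, ContinuousLinearEquiv.apply_symm_apply]
        rw [← map_smul]; simp
      have e2 : (L (h • L.symm (a, (0 : ℝ)))).2 = 0 := by simp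
      have hh' : b (h • L.symm (a, (0 : ℝ))) ∈ c.target := hh
      simp only [hg, hΨ, e2, φ.map_zero_apply]
      rw [e1] at hh' ⊢
      exact c.right_inv hh'
    have hflow : fderiv ℝ g 0 D₀ = D₀ := by
      refine (hline _).unique ?_
      have h1 := hφ.generator m 0
      have h2 : HasMFDerivAt 𝓘(ℝ, E) 𝓘(ℝ, E) c (φ 0 m) (mfderiv 𝓘(ℝ, E) 𝓘(ℝ, E) c (φ 0 m)) :=
        (mdifferentiableAt_extChartAt (by
          rw [φ.map_zero_apply]; exact mem_chart_source E m)).hasMFDerivAt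
      have hcomp : ∀ (A : E →L[ℝ] E) (d : E) (f : ℝ → E),
          HasFDerivAt f (A.comp ((1 : ℝ →L[ℝ] ℝ).smulRight d)) 0 → HasDerivAt f (A d) 0 :=
        fun A d f h => by simpa using h.hasDerivAt
      have h3 : HasDerivAt (fun h : ℝ => c (φ h m)) _ 0 :=
        hcomp (mfderiv 𝓘(ℝ, E) 𝓘(ℝ, E) c (φ 0 m)) (D (φ 0 m)) _
          (HasMFDerivAt.comp (0 : ℝ) h2 h1).hasFDerivAt
      have e4 : ∀ p, p = m → ((mfderiv 𝓘(ℝ, E) 𝓘(ℝ, E) c p : E →L[ℝ] E) (D p) : E) = D₀ := by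
        rintro p rfl
        rw [hD₀, hc, mfderiv_extChartAt_self]; rfl
      have h3' : HasDerivAt (fun h : ℝ => c (φ h m)) D₀ 0 := e4 _ (φ.map_zero_apply m) ▸ h3
      refine h3'.congr_of_eventuallyEq (Filter.Eventually.of_forall fun h => ?_)
      have e5 : L (h • D₀) = (0, h) := by
        rw [map_smul, hL]; simp
      have e6 : b (h • D₀) = y₀ := by simp only [hb, e5]; simp
      simp only [hg, hΨ]
      rw [e6, e5]
      simp only [hy₀, hc, extChartAt_to_inv]
    have : fderiv ℝ g 0 = ((ContinuousLinearEquiv.refl ℝ E : E ≃L[ℝ] E) : E →L[ℝ] E) := by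
      ext v
      have hv : v = L.symm ((L v).1, 0) + (L v).2 • D₀ := by
        apply L.injective
        rw [map_add, map_smul, hL]; simp
      rw [hv, map_add, map_smul, hbase]
      rw [hflow]
      rfl
    rwa [this] at h0
  have hne : (∞ : WithTop ℕ∞) ≠ 0 := by simp
  set p := (hgs 0 h0G₁).toOpenPartialHomeomorph g hgf hne with hp
  have hpc : ∀ y, p y = g y := fun y => rfl
  have h0p : (0 : E) ∈ p.source := ContDiffAt.mem_toOpenPartialHomeomorph_source _ hgf hne
  -- points where the derivative is invertible
  have hinv : ∀ᶠ y in 𝓝 (0 : E), ∃ A : E ≃L[ℝ] E, fderiv ℝ g y = A := by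
    have hcd : ContinuousAt (fderiv ℝ g) 0 :=
      ((hgs 0 h0G₁).fderiv_right (m := ∞) (by simp)).continuousAt
    have : Set.range ((↑) : (E ≃L[ℝ] E) → E →L[ℝ] E) ∈ 𝓝 (fderiv ℝ g 0) := by
      rw [hgf.fderiv]; exact ContinuousLinearEquiv.nhds _
    filter_upwards [hcd this] with y hy
    obtain ⟨A, hA⟩ := hy
    exact ⟨A, hA.symm⟩
  have hgood : ∀ᶠ y in 𝓝 (0 : E), y ∈ G₁ ∧ y ∈ p.source ∧ ∃ A : E ≃L[ℝ] E, fderiv ℝ g y = A :=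
    (hG₁o.eventually_mem h0G₁).and ((p.open_source.eventually_mem h0p).and hinv)
  have hbox : ∀ {P : E → Prop}, (∀ᶠ y in 𝓝 (0 : E), P y) →
      ∃ r > 0, ∀ y : E, ‖L y‖ < r → P y := by
    intro P hP
    have h1 : Filter.Tendsto L.symm (𝓝 0) (𝓝 (0 : E)) := by
      simpa using L.symm.continuous.tendsto 0
    obtain ⟨r, hr, h⟩ := Metric.eventually_nhds_iff.1 (h1.eventually hP)
    exact ⟨r, hr, fun y hy => by simpa using h (y := L y) (by simpa using hy)⟩
  obtain ⟨ρ, hρ, hgoodρ⟩ := hbox hgood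
  -- Injectivity holds for `‖L y‖ < ρ`. Return times below `ρ / 2` and a box of radius at most `ρ /
  -- 2` keep time-translated points inside that range.
  obtain ⟨V, hVo, hmV, hV⟩ := Flow.exists_isOpen_forall_abs_lt hfree hproper m (half_pos hρ)
  have hV0 : ∀ᶠ y in 𝓝 (0 : E), Ψ y ∈ V := by
    refine (hΨs 0 h0G₀).continuousAt (hVo.mem_nhds ?_)
    rwa [hΨ0]
  obtain ⟨r₁, hr₁, hr₁V⟩ := hbox hV0
  set r := min r₁ (ρ / 2) with hr
  have hrpos : 0 < r := lt_min hr₁ (half_pos hρ)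
  have hrρ : r ≤ ρ / 2 := min_le_right _ _
  set B : Set E := {y | ‖L y‖ < r} with hB
  have hBo : IsOpen B := isOpen_lt (continuous_norm.comp L.continuous) continuous_const
  have hBgood : ∀ y ∈ B, y ∈ G₁ ∧ y ∈ p.source ∧ ∃ A : E ≃L[ℝ] E, fderiv ℝ g y = A :=
    fun y hy => hgoodρ y (lt_of_lt_of_le hy (by linarith))
  set q : OpenPartialHomeomorph E M := (p.restrOpen B hBo).trans (chartAt E m).symm with hq
  have hqsrc : q.source = B := by
    ext y
    simp only [hq, OpenPartialHomeomorph.trans_source, OpenPartialHomeomorph.restrOpen_source,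
      OpenPartialHomeomorph.symm_source, Set.mem_inter_iff, Set.mem_preimage]
    refine ⟨fun h => h.1.2, fun h => ⟨⟨(hBgood y h).2.1, h⟩, ?_⟩⟩
    have := c.map_source (hBgood y h).1.2
    simpa [hc, extChartAt, hpc, hg] using this
  have hqapp : ∀ y ∈ B, q y = Ψ y := fun y hy => by
    have := c.left_inv (hBgood y hy).1.2
    simpa [hc, extChartAt, hq, hpc, hg] using this
  have hbaseB : ∀ y ∈ B, L.symm ((L y).1, 0) ∈ B := fun y hy => by
    have hy' : ‖L y‖ < r := hy
    have h1 : ‖(L y).1‖ ≤ ‖L y‖ := norm_fst_le _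
    simp only [hB, Set.mem_ofPred_eq, ContinuousLinearEquiv.apply_symm_apply, Prod.norm_mk, norm_zero]
    exact max_lt (h1.trans_lt hy') hrpos
  refine ⟨L, q.symm, ⟨?_, ?_, ?_, ?_⟩, ?_⟩
  · refine OpenPartialHomeomorph.mem_maximalAtlas_of_contMDiffOn _ ?_ ?_
    · intro x hx
      refine ContMDiffAt.contMDiffWithinAt ?_
      have hxq : x ∈ q.target := hx
      have hx1 : x ∈ (chartAt E m).source := by
        have := hxq
        simp only [hq, OpenPartialHomeomorph.trans_target, OpenPartialHomeomorph.symm_target] at this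
        exact this.1
      have hy : q.symm x ∈ B := hqsrc ▸ q.map_target hxq
      have hx2 : c x ∈ p.target := by
        have := hxq
        simp only [hq, OpenPartialHomeomorph.trans_target, OpenPartialHomeomorph.symm_target] at this
        have h2 := (p.restrOpen B hBo).map_target this.2
        rw [OpenPartialHomeomorph.restrOpen_source] at h2
        have h3 := (p.restrOpen B hBo).right_inv this.2
        have h4 := p.map_source h2.1
        have h5 : p ((p.restrOpen B hBo).symm ((chartAt E m) x)) = (chartAt E m) x := h3
        rw [OpenPartialHomeomorph.symm_symm] at *
        rw [h5] at h4
        simpa [hc] using h4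
      have hsymm : p.symm (c x) = q.symm x := by simp [hq, hc]
      obtain ⟨A, hA⟩ := (hBgood _ hy).2.2
      have hsm : ContDiffAt ℝ ∞ p.symm (c x) := by
        refine p.contDiffAt_symm (f₀' := A) hx2 ?_ ?_
        · rw [hsymm, ← hA]
          exact ((hgs _ (hBgood _ hy).1).differentiableAt (by simp)).hasFDerivAt
        · rw [hsymm]; exact hgs _ (hBgood _ hy).1
      have hcm : ContMDiffAt 𝓘(ℝ, E) 𝓘(ℝ, E) ∞ c x := contMDiffAt_extChartAt' hx1
      refine (ContMDiffAt.comp x (I' := 𝓘(ℝ, E)) hsm.contMDiffAt hcm).congr_of_eventuallyEq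
        (Filter.Eventually.of_forall fun z => ?_)
      simp [hq, hc]
    · intro y hy
      have hy' : y ∈ B := hqsrc ▸ hy
      refine ((hΨs y (hBgood y hy').1.1).congr_of_eventuallyEq ?_).contMDiffWithinAt
      filter_upwards [hBo.mem_nhds hy'] with z hz using hqapp z hz
  · intro y hy
    have hy' : y ∈ B := hqsrc ▸ hy
    exact (hqsrc.symm ▸ hbaseB y hy' : _ ∈ q.source)
  · intro y hy
    have hy' : y ∈ B := hqsrc ▸ hy
    rw [OpenPartialHomeomorph.symm_symm, hqapp y hy', hqapp _ (hbaseB y hy')]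
    simp [hΨ, hb]
  · intro y hy y' hy' t ht
    have hy : y ∈ B := hqsrc ▸ hy
    have hy' : y' ∈ B := hqsrc ▸ hy'
    rw [OpenPartialHomeomorph.symm_symm, hqapp y hy, hqapp y' hy'] at ht
    have hyr : ‖L y‖ < r := hy
    have hyr' : ‖L y'‖ < r := hy'
    have htlt : |t| < ρ / 2 := by
      refine hV (Ψ y) (hr₁V y (hyr.trans_le (min_le_left _ _))) t ?_
      rw [ht]
      exact hr₁V y' (hyr'.trans_le (min_le_left _ _))
    -- The translate of `y` by the return time may leave `B` but stays where `p` is injective;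
    -- having the image of `y'`, it equals `y'`, and its `E₁`-component is that of `y`.
    set z := L.symm ((L y).1, t + (L y).2) with hz
    have hbz : b z = b y := by simp [hb, hz]
    have hΨz : Ψ z = Ψ y' := by
      rw [← ht]
      simp only [hΨ, hbz]
      rw [← φ.map_add, hz, ContinuousLinearEquiv.apply_symm_apply]
    have hzρ : ‖L z‖ < ρ := by
      rw [hz, ContinuousLinearEquiv.apply_symm_apply, Prod.norm_mk]
      have h1 : ‖(L y).1‖ ≤ ‖L y‖ := norm_fst_le _
      have h2 : ‖(L y).2‖ ≤ ‖L y‖ := norm_snd_le _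
      refine max_lt (by linarith) ?_
      have h3 := norm_add_le t (L y).2
      rw [Real.norm_eq_abs t] at h3
      linarith
    have hzy : z = y' := by
      refine p.injOn (hgoodρ z hzρ).2.1 (hBgood y' hy').2.1 ?_
      change c (Ψ z) = c (Ψ y')
      rw [hΨz]
    rw [← hzy, hz]; simp
  · have h0B : (0 : E) ∈ B := by simp [hB, hrpos]
    have := q.map_source (hqsrc.symm ▸ h0B)
    rw [hqapp 0 h0B, hΨ0] at this
    exact this

end FlowBox

/-! ### The smooth structure of the orbit space. -/

section QuotientManifold

variable {E : Type*} [NormedAddCommGroup E] [NormedSpace ℝ E]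
  {E₁ : Type*} [NormedAddCommGroup E₁] [NormedSpace ℝ E₁]
  {M : Type*} [TopologicalSpace M] [ChartedSpace E M]
  {φ : Flow ℝ M} {L : E ≃L[ℝ] E₁ × ℝ} {e : OpenPartialHomeomorph M E}

/-- The inverse of the chart of the orbit space defined by a flow box, as a total function. -/
def orbitParam (φ : Flow ℝ M) (L : E ≃L[ℝ] E₁ × ℝ) (e : OpenPartialHomeomorph M E) (h : E₁) :
    OrbitSpace φ :=
  OrbitSpace.proj φ (e.symm (L.symm (h, 0)))

/-- The domain of the inverse of the chart of the orbit space defined by a flow box. -/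
def orbitParamSource (L : E ≃L[ℝ] E₁ × ℝ) (e : OpenPartialHomeomorph M E) : Set E₁ :=
  {h | L.symm (h, 0) ∈ e.target}

theorem isOpen_orbitParamSource : IsOpen (orbitParamSource L e) :=
  e.open_target.preimage (L.symm.continuous.comp (Continuous.prodMk continuous_id continuous_const))

theorem continuousOn_orbitParam : ContinuousOn (orbitParam φ L e) (orbitParamSource L e) :=
  (OrbitSpace.isOpenQuotientMap_proj φ).continuous.comp_continuousOn
    (e.continuousOn_symm.comp
      (L.symm.continuous.comp (Continuous.prodMk continuous_id continuous_const)).continuousOn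
      fun _ h => h)

theorem IsFlowBox.orbitParam_fst (he : IsFlowBox φ L e) {y : E} (hy : y ∈ e.target) :
    orbitParam φ L e (L y).1 = OrbitSpace.proj φ (e.symm y) := by
  rw [he.symm_eq y hy, OrbitSpace.proj_map]
  rfl

theorem IsFlowBox.fst_mem (he : IsFlowBox φ L e) {y : E} (hy : y ∈ e.target) :
    (L y).1 ∈ orbitParamSource L e :=
  he.base_mem y hy

theorem IsFlowBox.injOn_orbitParam (he : IsFlowBox φ L e) :
    Set.InjOn (orbitParam φ L e) (orbitParamSource L e) := by
  intro h hh h' hh' heq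
  obtain ⟨t, ht⟩ := (OrbitSpace.proj_eq_iff φ).1 heq
  simpa using he.fst_eq _ hh _ hh' t ht

/-- A piece of the transversal has the same image as the part of the box lying above it. That part
is open in `M`, and the projection is an open map. -/
theorem IsFlowBox.isOpen_image_orbitParam (he : IsFlowBox φ L e) {T : Set E₁} (hT : IsOpen T) :
    IsOpen (orbitParam φ L e '' (orbitParamSource L e ∩ T)) := by
  have hU : IsOpen (e.target ∩ {y | (L y).1 ∈ T}) :=
    e.open_target.inter (hT.preimage (continuous_fst.comp L.continuous))
  have : orbitParam φ L e '' (orbitParamSource L e ∩ T) =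
      OrbitSpace.proj φ '' (e.symm '' (e.target ∩ {y | (L y).1 ∈ T})) := by
    ext c
    constructor
    · rintro ⟨h, ⟨hh, hhT⟩, rfl⟩
      exact ⟨_, ⟨L.symm (h, 0), ⟨hh, by simpa using hhT⟩, rfl⟩, rfl⟩
    · rintro ⟨_, ⟨y, ⟨hy, hyT⟩, rfl⟩, rfl⟩
      exact ⟨(L y).1, ⟨he.fst_mem hy, hyT⟩, he.orbitParam_fst hy⟩
  rw [this]
  refine (OrbitSpace.isOpenQuotientMap_proj φ).isOpenMap _ ?_
  exact e.symm.isOpen_image_of_subset_source hU Set.inter_subset_left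

/-- The chart of the orbit space defined by a flow box. -/
def IsFlowBox.orbitChart (he : IsFlowBox φ L e) : OpenPartialHomeomorph (OrbitSpace φ) E₁ :=
  (OpenPartialHomeomorph.ofContinuousOpenRestrict
    (he.injOn_orbitParam.bijOn_image.toPartialEquiv (orbitParam φ L e) (orbitParamSource L e) _)
    continuousOn_orbitParam
    (by
      intro T hT
      obtain ⟨T', hT', rfl⟩ := isOpen_induced_iff.1 hT
      convert he.isOpen_image_orbitParam hT' using 1
      ext c
      constructor
      · rintro ⟨⟨h, hh⟩, hhT, rfl⟩
        exact ⟨h, ⟨hh, hhT⟩, rfl⟩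
      · rintro ⟨h, ⟨hh, hhT⟩, rfl⟩
        exact ⟨⟨h, hh⟩, hhT, rfl⟩) isOpen_orbitParamSource).symm

theorem IsFlowBox.mem_orbitChart_source_iff (he : IsFlowBox φ L e) {c : OrbitSpace φ} :
    c ∈ he.orbitChart.source ↔ ∃ x ∈ e.source, OrbitSpace.proj φ x = c := by
  have : he.orbitChart.source = orbitParam φ L e '' orbitParamSource L e := rfl
  rw [this]
  constructor
  · rintro ⟨h, hh, rfl⟩
    exact ⟨_, e.map_target hh, rfl⟩
  · rintro ⟨x, hx, rfl⟩
    refine ⟨(L (e x)).1, he.fst_mem (e.map_source hx), ?_⟩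
    rw [he.orbitParam_fst (e.map_source hx), e.left_inv hx]

theorem IsFlowBox.orbitChart_proj (he : IsFlowBox φ L e) {x : M} (hx : x ∈ e.source) :
    he.orbitChart (OrbitSpace.proj φ x) = (L (e x)).1 := by
  have h := he.orbitParam_fst (e.map_source hx)
  rw [e.left_inv hx] at h
  rw [← h]
  exact he.orbitChart.right_inv (he.fst_mem (e.map_source hx))

/-- Two boxes over a common orbit need not meet in `M`, but some `φ t` carries a point of the first
transversal into the second box. Nearby, the transition map is the inclusion of the transversal,
then `φ t`, then the `E₁`-component of the second chart. -/
theorem IsFlowBox.contDiffOn_transition [IsManifold 𝓘(ℝ, E) ∞ M]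
    {D : (x : M) → TangentSpace 𝓘(ℝ, E) x} (hφ : IsGlobalFlow D φ)
    {L' : E ≃L[ℝ] E₁ × ℝ} {e' : OpenPartialHomeomorph M E}
    (he : IsFlowBox φ L e) (he' : IsFlowBox φ L' e') :
    ContDiffOn ℝ ∞ (he.orbitChart.symm.trans he'.orbitChart)
      (he.orbitChart.symm.trans he'.orbitChart).source := by
  intro h hh
  rw [OpenPartialHomeomorph.trans_source] at hh
  obtain ⟨hh1, hh2⟩ := hh
  have hh1 : L.symm (h, 0) ∈ e.target := hh1
  obtain ⟨x', hx', hx'e⟩ := he'.mem_orbitChart_source_iff.1 hh2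
  obtain ⟨t, ht⟩ := (OrbitSpace.proj_eq_iff φ).1 hx'e.symm
  have hs : ContMDiffAt 𝓘(ℝ, E₁) 𝓘(ℝ, E) ∞ (fun h => φ t (e.symm (L.symm (h, (0 : ℝ))))) h := by
    refine (hφ.contMDiff_map t _).comp h ?_
    have h1 : ContMDiffAt 𝓘(ℝ, E₁) 𝓘(ℝ, E) ∞ (fun h : E₁ => L.symm (h, (0 : ℝ))) h :=
      (L.symm.contDiff.comp (contDiff_id.prodMk contDiff_const)).contMDiff.contMDiffAt
    exact ContMDiffAt.comp h (((contMDiffOn_symm_of_mem_maximalAtlas he.mem_maximalAtlas).contMDiffAt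
      (e.open_target.mem_nhds hh1))) h1
  have hsx : φ t (e.symm (L.symm (h, (0 : ℝ)))) ∈ e'.source := ht ▸ hx'
  have hs2 : ContDiffAt ℝ ∞ (fun h => (L' (e' (φ t (e.symm (L.symm (h, (0 : ℝ))))))).1) h := by
    rw [← contMDiffAt_iff_contDiffAt]
    have h1 : ContMDiffAt 𝓘(ℝ, E) 𝓘(ℝ, E) ∞ e' (φ t (e.symm (L.symm (h, (0 : ℝ))))) :=
      (contMDiffOn_of_mem_maximalAtlas he'.mem_maximalAtlas).contMDiffAt
        (e'.open_source.mem_nhds hsx)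
    have h2 : ContMDiff 𝓘(ℝ, E) 𝓘(ℝ, E₁) ∞ (fun y : E => (L' y).1) :=
      (contDiff_fst.comp L'.contDiff).contMDiff
    exact (h2 _).comp h (ContMDiffAt.comp h h1 hs)
  refine (hs2.congr_of_eventuallyEq ?_).contDiffWithinAt
  filter_upwards [hs.continuousAt (e'.open_source.mem_nhds hsx)] with h' hh'
  rw [← he'.orbitChart_proj hh', OrbitSpace.proj_map]
  rfl

theorem OrbitSpace.exists_chartedSpace [FiniteDimensional ℝ E] [FiniteDimensional ℝ E₁]
    [IsManifold 𝓘(ℝ, E) ∞ M] [T2Space M]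
    (hdim : Module.finrank ℝ E = Module.finrank ℝ E₁ + 1)
    {D : (x : M) → TangentSpace 𝓘(ℝ, E) x}
    (hD : ContMDiff 𝓘(ℝ, E) 𝓘(ℝ, E).tangent ∞ (fun x => (⟨x, D x⟩ : TangentBundle 𝓘(ℝ, E) M)))
    (hφ : IsGlobalFlow D φ) (hfree : ∀ (t : ℝ) (x : M), φ t x = x → t = 0)
    (hproper : IsProperMap (fun p : ℝ × M => (φ p.1 p.2, p.2))) :
    ∃ _ : ChartedSpace E₁ (OrbitSpace φ), IsManifold 𝓘(ℝ, E₁) ∞ (OrbitSpace φ) ∧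
      Manifold.IsSubmersion 𝓘(ℝ, E) 𝓘(ℝ, E₁) ∞ (OrbitSpace.proj φ) := by
  choose L e he hm using hφ.exists_isFlowBox (E₁ := E₁) hdim hD hfree hproper
  let cs : ChartedSpace E₁ (OrbitSpace φ) :=
    { atlas := Set.range fun m => (he m).orbitChart
      chartAt := fun c => (he c.out).orbitChart
      mem_chart_source := fun c =>
        (he c.out).mem_orbitChart_source_iff.2 ⟨c.out, hm _, OrbitSpace.proj_out φ c⟩
      chart_mem_atlas := fun c => ⟨c.out, rfl⟩ }
  have hmfd : IsManifold 𝓘(ℝ, E₁) ∞ (OrbitSpace φ) := by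
    refine isManifold_of_contDiffOn _ _ _ ?_
    rintro _ _ ⟨m, rfl⟩ ⟨m', rfl⟩
    simpa using (he m).contDiffOn_transition hφ (he m')
  refine ⟨cs, hmfd, ?_⟩
  have hsub : Manifold.IsSubmersionOfComplement ℝ 𝓘(ℝ, E) 𝓘(ℝ, E₁) ∞ (OrbitSpace.proj φ) := by
    intro m
    refine Manifold.IsSubmersionAtOfComplement.mk_of_charts (L m) (e m) (he m).orbitChart (hm m)
      ((he m).mem_orbitChart_source_iff.2 ⟨m, hm m, rfl⟩) (he m).mem_maximalAtlas
      (IsManifold.subset_maximalAtlas ⟨m, rfl⟩)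
      (fun x hx => (he m).mem_orbitChart_source_iff.2 ⟨x, hx, rfl⟩) ?_
    intro y hy
    have hy' : y ∈ (e m).target := by simpa using hy
    have h := (he m).orbitChart_proj ((e m).map_target hy')
    rw [(e m).right_inv hy'] at h
    simpa using h
  exact hsub.isSubmersion

end QuotientManifold

/-! ### Bilinearity rules for forms evaluated on explicit tuples. -/

section PairForms

variable {V : Type*} [AddCommGroup V] [Module ℝ V] [TopologicalSpace V]

theorem ContinuousAlternatingMap.pair_add_left (A : V [⋀^Fin 2]→L[ℝ] ℝ) (u u' v : V) :
    A ![u + u', v] = A ![u, v] + A ![u', v] := by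
  simpa using A.toAlternatingMap.map_vecCons_add ![v] u u'

theorem ContinuousAlternatingMap.pair_smul_left (A : V [⋀^Fin 2]→L[ℝ] ℝ) (a : ℝ) (u v : V) :
    A ![a • u, v] = a * A ![u, v] := by
  simpa using A.toAlternatingMap.map_vecCons_smul ![v] a u

theorem ContinuousAlternatingMap.pair_add_right (A : V [⋀^Fin 2]→L[ℝ] ℝ) (u v v' : V) :
    A ![u, v + v'] = A ![u, v] + A ![u, v'] := by
  rw [A.apply_pair_swap u, A.pair_add_left, A.apply_pair_swap v, A.apply_pair_swap v']
  ring

theorem ContinuousAlternatingMap.pair_smul_right (A : V [⋀^Fin 2]→L[ℝ] ℝ) (a : ℝ) (u v : V) :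
    A ![u, a • v] = a * A ![u, v] := by
  rw [A.apply_pair_swap u, A.pair_smul_left, A.apply_pair_swap v]
  ring

theorem ContinuousAlternatingMap.pair_self (A : V [⋀^Fin 2]→L[ℝ] ℝ) (u : V) : A ![u, u] = 0 := by
  have := A.apply_pair_swap u u
  linarith

theorem mem_formKer {a : V [⋀^Fin 1]→L[ℝ] ℝ} {v : V} : v ∈ formKer a ↔ a ![v] = 0 := by
  have : (fun _ : Fin 1 => v) = ![v] := by ext i; fin_cases i; rfl
  change a (fun _ => v) = 0 ↔ _
  rw [this]

theorem ContinuousAlternatingMap.single_add (A : V [⋀^Fin 1]→L[ℝ] ℝ) (u v : V) :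
    A ![u + v] = A ![u] + A ![v] := by
  simpa using A.toAlternatingMap.map_vecCons_add ![] u v

theorem ContinuousAlternatingMap.single_smul (A : V [⋀^Fin 1]→L[ℝ] ℝ) (a : ℝ) (v : V) :
    A ![a • v] = a * A ![v] := by
  simpa using A.toAlternatingMap.map_vecCons_smul ![] a v

end PairForms

/-! ### Linear symplectic reduction by a line. -/

section LinearReduction

variable {V W : Type*} [NormedAddCommGroup V] [NormedSpace ℝ V] [NormedAddCommGroup W]
  [NormedSpace ℝ W] {Ω : V [⋀^Fin 2]→L[ℝ] ℝ} {d : V} {P : V →L[ℝ] W}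

/-- The functional `Ω(d, ·)` kills `d`, hence the kernel of `P`, so it factors through `P`; a linear
right inverse of `P` writes the factor down. -/
theorem exists_covector_of_surjective [FiniteDimensional ℝ W] (hP : Function.Surjective P)
    (hker : ∀ v, P v = 0 → ∃ s : ℝ, v = s • d) :
    ∃ β : W →L[ℝ] ℝ, ∀ v, β (P v) = Ω ![d, v] := by
  obtain ⟨S, hS⟩ := (P : V →ₗ[ℝ] W).exists_rightInverse_of_surjective (LinearMap.range_eq_top.2 hP)
  have hPS : ∀ w, P (S w) = w := fun w => LinearMap.congr_fun hS w
  let β : W →ₗ[ℝ] ℝ :=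
    { toFun := fun w => Ω ![d, S w]
      map_add' := fun w w' => by rw [map_add, Ω.pair_add_right]
      map_smul' := fun a w => by rw [map_smul, Ω.pair_smul_right]; rfl }
  refine ⟨β.toContinuousLinearMap, fun v => ?_⟩
  obtain ⟨s, hs⟩ := hker (v - S (P v)) (by rw [map_sub, hPS, sub_self])
  have hv : v = S (P v) + s • d := by rw [← hs]; abel
  change Ω ![d, S (P v)] = Ω ![d, v]
  conv_rhs => rw [hv, Ω.pair_add_right, Ω.pair_smul_right, Ω.pair_self, mul_zero, add_zero]

/-- On the kernel of `Ω(d, ·)` the form `Ω` descends to the quotient by `d`. -/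
theorem pair_eq_of_lifts (hker : ∀ v, P v = 0 → ∃ s : ℝ, v = s • d) {v₁ v₂ v₁' v₂' : V}
    (h₁ : Ω ![d, v₁] = 0) (h₂ : Ω ![d, v₂] = 0) (e₁ : P v₁ = P v₁') (e₂ : P v₂ = P v₂') :
    Ω ![v₁, v₂] = Ω ![v₁', v₂'] := by
  obtain ⟨s, hs⟩ := hker (v₁' - v₁) (by rw [map_sub, e₁, sub_self])
  obtain ⟨t, ht⟩ := hker (v₂' - v₂) (by rw [map_sub, e₂, sub_self])
  rw [show v₁' = v₁ + s • d by rw [← hs]; abel, show v₂' = v₂ + t • d by rw [← ht]; abel]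
  simp only [Ω.pair_add_left, Ω.pair_add_right, Ω.pair_smul_left, Ω.pair_smul_right, h₁, h₂,
    Ω.pair_self, Ω.apply_pair_swap v₁ d]
  ring

/-- The linear reduction of a symplectic form is nondegenerate. -/
theorem eq_zero_of_pair_eq_zero (hΩ : ∀ v, (∀ w, Ω ![v, w] = 0) → v = 0) (hd : d ≠ 0)
    (hPd : P d = 0) (hker : ∀ v, P v = 0 → ∃ s : ℝ, v = s • d) {S : W → V}
    (hS : ∀ w, P (S w) = w) {u : W} (hu : Ω ![d, S u] = 0)
    (h : ∀ w, Ω ![d, S w] = 0 → Ω ![S u, S w] = 0) : u = 0 := by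
  have h1 : ∀ v, Ω ![d, v] = 0 → Ω ![S u, v] = 0 := fun v hv => by
    obtain ⟨s, hs⟩ := hker (v - S (P v)) (by rw [map_sub, hS, sub_self])
    have hv' : v = S (P v) + s • d := by rw [← hs]; abel
    have h2 : Ω ![d, S (P v)] = 0 := by
      rw [hv', Ω.pair_add_right, Ω.pair_smul_right, Ω.pair_self, mul_zero, add_zero] at hv
      exact hv
    rw [hv', Ω.pair_add_right, Ω.pair_smul_right, h _ h2, Ω.apply_pair_swap _ d, hu]
    ring
  obtain ⟨x, hx⟩ : ∃ x, Ω ![d, x] ≠ 0 := by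
    by_contra hcon
    push Not at hcon
    exact hd (hΩ d hcon)
  -- By `h1` the functional `Ω(S u, ·)` vanishes on the kernel of `Ω(d, ·)`, so it is a multiple of
  -- it; `a` is the factor, read off at `x`.
  set a := Ω ![S u, x] / Ω ![d, x] with ha
  have h3 : S u + (-a) • d = 0 := by
    refine hΩ _ fun w => ?_
    have h4 := h1 (w + (-(Ω ![d, w] / Ω ![d, x])) • x) (by
      rw [Ω.pair_add_right, Ω.pair_smul_right]; field_simp; ring)
    rw [Ω.pair_add_right, Ω.pair_smul_right] at h4
    rw [Ω.pair_add_left, Ω.pair_smul_left, ha]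
    field_simp at h4 ⊢
    linarith
  have h5 : P (S u + (-a) • d) = 0 := by rw [h3, map_zero]
  rwa [map_add, map_smul, hPd, smul_zero, add_zero, hS] at h5

end LinearReduction

/-! ### Exterior derivatives of proportional one-forms. -/

section ProportionalForms

variable {V : Type*} [NormedAddCommGroup V] [NormedSpace ℝ V]

theorem extDeriv_pair_apply {α : V → V [⋀^Fin 1]→L[ℝ] ℝ} {x : V} (u v : V) :
    extDeriv α x ![u, v] = fderiv ℝ α x u ![v] - fderiv ℝ α x v ![u] := by
  rw [extDeriv, ContinuousAlternatingMap.alternatizeUncurryFin_apply]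
  have e0 : Fin.removeNth (0 : Fin 2) ![u, v] = ![v] := by ext i; fin_cases i; rfl
  have e1 : Fin.removeNth (1 : Fin 2) ![u, v] = ![u] := by ext i; fin_cases i; rfl
  simp [Fin.sum_univ_two, e0, e1, sub_eq_add_neg]

/-- Exterior derivatives of proportional `1`-forms are proportional on the common kernel. -/
theorem extDeriv_eq_of_ker_le {α β : V → V [⋀^Fin 1]→L[ℝ] ℝ} {x w : V}
    (hα : DifferentiableAt ℝ α x) (hβ : DifferentiableAt ℝ β x)
    (h : ∀ᶠ y in 𝓝 x, ∀ v, β y ![v] = 0 → α y ![v] = 0) (hw : β x ![w] ≠ 0) {u v : V}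
    (hu : β x ![u] = 0) (hv : β x ![v] = 0) :
    extDeriv α x ![u, v] = α x ![w] / β x ![w] * extDeriv β x ![u, v] := by
  -- Proportionality in division-free form. Differentiating it at `x`, the terms with factor `α x
  -- ![v]` or `β x ![v]` drop out on the kernel, so the derivative of the ratio never enters.
  have hprop : ∀ v, ∀ᶠ y in 𝓝 x, α y ![v] * β y ![w] = α y ![w] * β y ![v] := fun v => by
    filter_upwards [h] with y hy
    have h1 := hy (β y ![w] • v + (-(β y ![v])) • w) (by
      rw [ContinuousAlternatingMap.single_add, ContinuousAlternatingMap.single_smul,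
        ContinuousAlternatingMap.single_smul]; ring)
    rw [ContinuousAlternatingMap.single_add, ContinuousAlternatingMap.single_smul,
        ContinuousAlternatingMap.single_smul] at h1
    linarith
  have hd : ∀ {γ : V → V [⋀^Fin 1]→L[ℝ] ℝ} (_ : DifferentiableAt ℝ γ x) (v : V),
      HasFDerivAt (fun y => γ y ![v])
        ((ContinuousAlternatingMap.apply ℝ V ℝ ![v]).comp (fderiv ℝ γ x)) x :=
    fun {γ} hγ v =>
      (ContinuousAlternatingMap.apply ℝ V ℝ ![v]).hasFDerivAt.comp x hγ.hasFDerivAt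
  have key : ∀ u v, β x ![v] = 0 →
      fderiv ℝ α x u ![v] = α x ![w] / β x ![w] * fderiv ℝ β x u ![v] := fun u v hv => by
    have h1 := ((hd hα v).mul (hd hβ w)).congr_of_eventuallyEq (f₁ := fun y => α y ![w] * β y ![v])
      ((hprop v).mono fun y hy => hy.symm)
    have h2 := (hd hα w).mul (hd hβ v)
    have h3 := congrArg (fun l : V →L[ℝ] ℝ => l u) (h1.unique h2)
    have hav : α x ![v] = 0 := h.self_of_nhds v hv
    simp only [add_apply, _root_.smul_apply, ContinuousLinearMap.comp_apply,
      ContinuousAlternatingMap.apply_apply, smul_eq_mul, hav, hv] at h3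
    field_simp
    linarith
  rw [extDeriv_pair_apply, extDeriv_pair_apply, key u v hv, key v u hu]
  ring

end ProportionalForms

/-! ### Local sections of a submersion. -/

section LocalSections

variable {E : Type*} [NormedAddCommGroup E] [NormedSpace ℝ E]
  {E₁ : Type*} [NormedAddCommGroup E₁] [NormedSpace ℝ E₁]
  {M : Type*} [TopologicalSpace M] [ChartedSpace E M]
  {C : Type*} [TopologicalSpace C] [ChartedSpace E₁ C]

/-- `σ` is a smooth section of `f` over the open set `U`. -/
structure IsSectionOn (f : M → C) (U : Set C) (σ : C → M) : Prop where
  isOpen : IsOpen U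
  contMDiffAt : ∀ c ∈ U, ContMDiffAt 𝓘(ℝ, E₁) 𝓘(ℝ, E) ∞ σ c
  apply_eq : ∀ c ∈ U, f (σ c) = c

/-- In adapted charts `f` is the first projection of a product; freezing the complementary
coordinate at its value `b` at `m` gives a section through `m`. -/
theorem Manifold.IsSubmersionAt.exists_isSectionOn [IsManifold 𝓘(ℝ, E) ∞ M]
    [IsManifold 𝓘(ℝ, E₁) ∞ C] {f : M → C} {m : M}
    (hf : Manifold.IsSubmersionAt 𝓘(ℝ, E) 𝓘(ℝ, E₁) ∞ f m) :
    ∃ (U : Set C) (σ : C → M), IsSectionOn (E := E) (E₁ := E₁) f U σ ∧ f m ∈ U ∧ σ (f m) = m := by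
  obtain ⟨F, _, _, h⟩ := hf
  set p := h.domChart
  set k := h.codChart
  have hwr : ∀ y ∈ p.target, k (f (p.symm y)) = (h.equiv y).1 := fun y hy => by
    have hy' : y ∈ (h.domChart.extend 𝓘(ℝ, E)).target := by simpa using hy
    simpa using h.writtenInCharts hy'
  have hm := h.mem_domChart_source
  have hkm : k (f m) = (h.equiv (p m)).1 := by
    have := hwr (p m) (p.map_source hm)
    rwa [p.left_inv hm] at this
  set b := (h.equiv (p m)).2
  set j : E₁ → E := fun a => h.equiv.symm (a, b) with hj
  have hjd : ContDiff ℝ ∞ j := h.equiv.symm.contDiff.comp (contDiff_id.prodMk contDiff_const)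
  have hjm : j (k (f m)) = p m := by simp [hj, hkm, b]
  refine ⟨k.source ∩ k ⁻¹' (j ⁻¹' p.target), fun c => p.symm (j (k c)), ⟨?_, ?_, ?_⟩, ?_, ?_⟩
  · exact k.isOpen_inter_preimage (p.open_target.preimage hjd.continuous)
  · rintro c ⟨hc, hc'⟩
    have h1 : ContMDiffAt 𝓘(ℝ, E₁) 𝓘(ℝ, E₁) ∞ k c :=
      (contMDiffOn_of_mem_maximalAtlas h.codChart_mem_maximalAtlas).contMDiffAt
        (k.open_source.mem_nhds hc)
    have h2 : ContMDiffAt 𝓘(ℝ, E) 𝓘(ℝ, E) ∞ p.symm (j (k c)) :=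
      (contMDiffOn_symm_of_mem_maximalAtlas h.domChart_mem_maximalAtlas).contMDiffAt
        (p.open_target.mem_nhds hc')
    exact ContMDiffAt.comp c h2 ((hjd.contMDiff (k c)).comp c h1)
  · rintro c ⟨hc, hc'⟩
    refine k.injOn (h.source_subset_preimage_source (p.map_target hc')) hc ?_
    rw [hwr _ hc']
    simp [hj]
  · refine ⟨h.mem_codChart_source, ?_⟩
    change j (k (f m)) ∈ p.target
    rw [hjm]
    exact p.map_source hm
  · change p.symm (j (k (f m))) = m
    rw [hjm, p.left_inv hm]

theorem IsSectionOn.mfderiv_apply {f : M → C} {U : Set C} {σ : C → M}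
    (h : IsSectionOn (E := E) (E₁ := E₁) f U σ) {c : C} (hc : c ∈ U)
    (hf : MDifferentiableAt 𝓘(ℝ, E) 𝓘(ℝ, E₁) f (σ c)) (u : E₁) :
    (mfderiv 𝓘(ℝ, E) 𝓘(ℝ, E₁) f (σ c) (mfderiv 𝓘(ℝ, E₁) 𝓘(ℝ, E) σ c u) : E₁) = u := by
  have h1 := mfderiv_comp_apply c hf ((h.contMDiffAt c hc).mdifferentiableAt (by simp)) u
  have h2 : f ∘ σ =ᶠ[𝓝 c] id := by
    filter_upwards [h.isOpen.mem_nhds hc] with c' hc' using h.apply_eq c' hc'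
  refine Eq.trans h1.symm ?_
  have h3 : (mfderiv 𝓘(ℝ, E₁) 𝓘(ℝ, E₁) (f ∘ σ) c : E₁ →L[ℝ] E₁) =
    mfderiv 𝓘(ℝ, E₁) 𝓘(ℝ, E₁) id c := h2.mfderiv_eq
  rw [mfderiv_id] at h3
  exact congrArg (fun l : E₁ →L[ℝ] E₁ => l u) h3

end LocalSections

/-! ### The reduced covector and the induced distribution. -/

section Reduction

variable {E : Type*} [NormedAddCommGroup E] [NormedSpace ℝ E]
  {E₁ : Type*} [NormedAddCommGroup E₁] [NormedSpace ℝ E₁]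
  {M : Type*} [TopologicalSpace M] [ChartedSpace E M]
  {Ω : DiffForm E M 2} {D : (x : M) → TangentSpace 𝓘(ℝ, E) x} {φ : Flow ℝ M}
  [ChartedSpace E₁ (OrbitSpace φ)]

/-- The standing assumptions on a conformally symplectic flow whose orbit space is a manifold. -/
structure IsReduction (E₁ : Type*) [NormedAddCommGroup E₁] [NormedSpace ℝ E₁]
    (Ω : DiffForm E M 2) (D : (x : M) → TangentSpace 𝓘(ℝ, E) x) (φ : Flow ℝ M)
    [ChartedSpace E₁ (OrbitSpace φ)] [IsManifold 𝓘(ℝ, E) ∞ M] : Prop where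
  finrank_eq : Module.finrank ℝ E = Module.finrank ℝ E₁ + 1
  symplectic : Ω.IsSymplectic
  smooth : ContMDiff 𝓘(ℝ, E) 𝓘(ℝ, E).tangent ∞ (fun x => (⟨x, D x⟩ : TangentBundle 𝓘(ℝ, E) M))
  flow : IsGlobalFlow D φ
  scale : IsLieDerivative φ Ω Ω
  generator_ne_zero : ∀ x, D x ≠ 0
  submersion : Manifold.IsSubmersion 𝓘(ℝ, E) 𝓘(ℝ, E₁) ∞ (OrbitSpace.proj φ)

/-- The derivative of the projection to the orbit space, as a map of model spaces. -/
def orbitDeriv (E : Type*) [NormedAddCommGroup E] [NormedSpace ℝ E]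
    (E₁ : Type*) [NormedAddCommGroup E₁] [NormedSpace ℝ E₁] {M : Type*} [TopologicalSpace M]
    [ChartedSpace E M] (φ : Flow ℝ M) [ChartedSpace E₁ (OrbitSpace φ)] (m : M) : E →L[ℝ] E₁ :=
  mfderiv 𝓘(ℝ, E) 𝓘(ℝ, E₁) (OrbitSpace.proj φ) m

/-- The derivative of the flow, as a map of the model space. -/
def flowDeriv (E : Type*) [NormedAddCommGroup E] [NormedSpace ℝ E] {M : Type*} [TopologicalSpace M]
    [ChartedSpace E M] (φ : Flow ℝ M) (t : ℝ) (m : M) : E →L[ℝ] E :=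
  mfderiv 𝓘(ℝ, E) 𝓘(ℝ, E) (φ t) m

/-- A form at a point, as a form on the model space. -/
def DiffForm.at {k : ℕ} (α : DiffForm E M k) (m : M) : E [⋀^Fin k]→L[ℝ] ℝ := α m

/-- A vector field at a point, as a vector of the model space. -/
def vectorAt (D : (x : M) → TangentSpace 𝓘(ℝ, E) x) (m : M) : E := D m

open Classical in
/-- The covector at `π m` whose pullback under the projection `π` is `Ω(D, ·)` at `m`. -/
def reducedCovector (E₁ : Type*) [NormedAddCommGroup E₁] [NormedSpace ℝ E₁]
    (Ω : DiffForm E M 2) (D : (x : M) → TangentSpace 𝓘(ℝ, E) x) (φ : Flow ℝ M)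
    [ChartedSpace E₁ (OrbitSpace φ)] (m : M) : E₁ →L[ℝ] ℝ :=
  if h : ∃ β : E₁ →L[ℝ] ℝ, ∀ v, β (orbitDeriv E E₁ φ m v) = Ω.at m ![vectorAt D m, v] then
    h.choose else 0

/-- The distribution on the orbit space induced by the kernel of `Ω(D, ·)`. -/
def reducedDistribution (E₁ : Type*) [NormedAddCommGroup E₁] [NormedSpace ℝ E₁]
    (Ω : DiffForm E M 2) (D : (x : M) → TangentSpace 𝓘(ℝ, E) x) (φ : Flow ℝ M)
    [ChartedSpace E₁ (OrbitSpace φ)] (c : OrbitSpace φ) : Submodule ℝ (TangentSpace 𝓘(ℝ, E₁) c) :=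
  LinearMap.ker (reducedCovector E₁ Ω D φ c.out : E₁ →ₗ[ℝ] ℝ)

namespace IsReduction

variable [IsManifold 𝓘(ℝ, E) ∞ M] [IsManifold 𝓘(ℝ, E₁) ∞ (OrbitSpace φ)]
  [FiniteDimensional ℝ E] [FiniteDimensional ℝ E₁] (H : IsReduction E₁ Ω D φ)

include H

theorem smoothAt (x : M) : Ω.SmoothAt x :=
  (DiffForm.smoothOn_iff isOpen_univ).1 H.symplectic.smooth x trivial

theorem smoothAt_interior (x : M) : (DiffForm.interior D Ω).SmoothAt x :=
  (H.smoothAt x).interior H.smooth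

theorem d_interior : (DiffForm.interior D Ω).d = Ω :=
  DiffForm.d_interior_eq H.smooth H.flow H.smoothAt H.symplectic.closed H.scale

theorem contMDiff_proj : ContMDiff 𝓘(ℝ, E) 𝓘(ℝ, E₁) ∞ (OrbitSpace.proj φ) := fun m => by
  obtain ⟨F, _, _, h⟩ := H.submersion.isSubmersionAt m
  exact h.contMDiffAt

theorem mdifferentiableAt_proj (m : M) :
    MDifferentiableAt 𝓘(ℝ, E) 𝓘(ℝ, E₁) (OrbitSpace.proj φ) m :=
  (H.contMDiff_proj m).mdifferentiableAt (by simp)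

theorem exists_section (m : M) : ∃ (U : Set (OrbitSpace φ)) (σ : OrbitSpace φ → M),
    IsSectionOn (E := E) (E₁ := E₁) (OrbitSpace.proj φ) U σ ∧ OrbitSpace.proj φ m ∈ U ∧
      σ (OrbitSpace.proj φ m) = m :=
  (H.submersion.isSubmersionAt m).exists_isSectionOn

theorem orbitDeriv_surjective (m : M) : Function.Surjective (orbitDeriv E E₁ φ m) := by
  obtain ⟨U, σ, hσ, hm, hσm⟩ := H.exists_section m
  intro u
  have h := hσ.mfderiv_apply hm (H.mdifferentiableAt_proj _) u
  have key : ∀ m', m' = m → ∀ v, orbitDeriv E E₁ φ m' v = u → ∃ v, orbitDeriv E E₁ φ m v = u := by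
    rintro _ rfl v hv
    exact ⟨v, hv⟩
  exact key _ hσm _ h

theorem orbitDeriv_flowDeriv (t : ℝ) (m : M) (v : E) :
    orbitDeriv E E₁ φ (φ t m) (flowDeriv E φ t m v) = orbitDeriv E E₁ φ m v := by
  have h1 := mfderiv_comp_apply m (H.mdifferentiableAt_proj (φ t m))
    (H.flow.mdifferentiableAt_map t m) v
  have h2 : OrbitSpace.proj φ ∘ φ.toFun t = OrbitSpace.proj φ :=
    funext fun x => OrbitSpace.proj_map φ t x
  refine Eq.trans h1.symm ?_
  have h3 : (mfderiv 𝓘(ℝ, E) 𝓘(ℝ, E₁) (OrbitSpace.proj φ ∘ φ.toFun t) m : E →L[ℝ] E₁) =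
      mfderiv 𝓘(ℝ, E) 𝓘(ℝ, E₁) (OrbitSpace.proj φ) m := by rw [h2]
  exact congrArg (fun l : E →L[ℝ] E₁ => l v) h3

theorem orbitDeriv_generator (m : M) : orbitDeriv E E₁ φ m (vectorAt D m) = 0 := by
  have h1 := H.flow.generator m 0
  have h2 := (H.mdifferentiableAt_proj (φ 0 m)).hasMFDerivAt
  have h3 := HasMFDerivAt.comp (0 : ℝ) h2 h1
  have h4 : OrbitSpace.proj φ ∘ (fun t => φ.toFun t m) = fun _ => OrbitSpace.proj φ m :=
    funext fun t => OrbitSpace.proj_map φ t m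
  rw [h4] at h3
  have h5 := hasMFDerivAt_unique h3 (hasMFDerivAt_const _ _)
  have h6 := congrArg (fun l : ℝ →L[ℝ] E₁ => l 1) h5
  have e1 : ∀ (A : E →L[ℝ] E₁) (d : E), (A.comp ((1 : ℝ →L[ℝ] ℝ).smulRight d)) 1 = A d :=
    fun A d => by simp
  have h7 : orbitDeriv E E₁ φ (φ 0 m) (vectorAt D (φ 0 m)) = 0 :=
    (e1 (orbitDeriv E E₁ φ (φ 0 m)) (D (φ 0 m))).symm.trans h6
  rwa [φ.map_zero_apply] at h7

/-- The kernel is a line by rank and nullity, and it contains the nonzero vector `D m`. -/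
theorem exists_smul_of_orbitDeriv_eq_zero (m : M) (v : E) (hv : orbitDeriv E E₁ φ m v = 0) :
    ∃ s : ℝ, v = s • vectorAt D m := by
  set P := orbitDeriv E E₁ φ m
  have h1 := (P : E →ₗ[ℝ] E₁).finrank_range_add_finrank_ker
  rw [LinearMap.range_eq_top.2 (H.orbitDeriv_surjective m), finrank_top, H.finrank_eq] at h1
  have h2 : Module.finrank ℝ (LinearMap.ker (P : E →ₗ[ℝ] E₁)) = 1 := by omega
  have h3 : (⟨vectorAt D m, H.orbitDeriv_generator m⟩ : LinearMap.ker (P : E →ₗ[ℝ] E₁)) ≠ 0 :=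
    fun h => H.generator_ne_zero m (congrArg Subtype.val h)
  obtain ⟨s, hs⟩ := (finrank_eq_one_iff_of_nonzero' _ h3).1 h2 ⟨v, hv⟩
  exact ⟨s, (congrArg Subtype.val hs).symm⟩

theorem reducedCovector_apply (m : M) (v : E) :
    reducedCovector E₁ Ω D φ m (orbitDeriv E E₁ φ m v) = Ω.at m ![vectorAt D m, v] := by
  have h : ∃ β : E₁ →L[ℝ] ℝ, ∀ v, β (orbitDeriv E E₁ φ m v) = Ω.at m ![vectorAt D m, v] :=
    exists_covector_of_surjective (H.orbitDeriv_surjective m)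
      (H.exists_smul_of_orbitDeriv_eq_zero m)
  rw [reducedCovector, dif_pos h]
  exact h.choose_spec v

theorem flowDeriv_generator (t : ℝ) (m : M) :
    flowDeriv E φ t m (vectorAt D m) = vectorAt D (φ t m) :=
  H.flow.mfderiv_map_generator t m

theorem form_flowDeriv (t : ℝ) (m : M) (v w : E) :
    Ω.at (φ t m) ![flowDeriv E φ t m v, flowDeriv E φ t m w] = Real.exp t * Ω.at m ![v, w] := by
  have h := IsLieDerivative.pullback_eq_exp_smul H.flow H.scale t m ![v, w]
  refine Eq.trans ?_ h
  rw [DiffForm.pullback_apply]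
  refine congrArg (Ω.at (φ t m)) ?_
  ext i
  fin_cases i <;> rfl

/-- The flow commutes with the projection, preserves `D` and scales `Ω` by `e^t`. Thus the covector
moves within an open half-line of the cotangent space as `m` runs along its orbit. -/
theorem reducedCovector_map (t : ℝ) (m : M) :
    reducedCovector E₁ Ω D φ (φ t m) = Real.exp t • reducedCovector E₁ Ω D φ m := by
  ext u
  obtain ⟨v, rfl⟩ := H.orbitDeriv_surjective m u
  rw [_root_.smul_apply, H.reducedCovector_apply, ← H.orbitDeriv_flowDeriv t,
    H.reducedCovector_apply, ← H.flowDeriv_generator, H.form_flowDeriv, smul_eq_mul]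

theorem form_nondegenerate (m : M) (v : E) (hv : ∀ w, Ω.at m ![v, w] = 0) : v = 0 :=
  H.symplectic.nondegenerate m v hv

theorem reducedCovector_ne_zero (m : M) : reducedCovector E₁ Ω D φ m ≠ 0 := fun h =>
  H.generator_ne_zero m (H.form_nondegenerate m (vectorAt D m) fun w => by
    rw [← H.reducedCovector_apply, h]; rfl)

/-- The representative `c.out` in the definition is immaterial, since covectors along one orbit
differ by a nonzero factor. -/
theorem reducedDistribution_eq {c : OrbitSpace φ} {m : M} (h : OrbitSpace.proj φ m = c) :
    reducedDistribution E₁ Ω D φ c = LinearMap.ker (reducedCovector E₁ Ω D φ m : E₁ →ₗ[ℝ] ℝ) := by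
  obtain ⟨t, ht⟩ := (OrbitSpace.proj_eq_iff φ).1 (h.trans (OrbitSpace.proj_out φ c).symm)
  ext u
  change reducedCovector E₁ Ω D φ c.out u = 0 ↔ reducedCovector E₁ Ω D φ m u = 0
  rw [← ht, H.reducedCovector_map]
  exact (mul_eq_zero (a := Real.exp t)).trans (or_iff_right (Real.exp_ne_zero t))

theorem mem_reducedDistribution {c : OrbitSpace φ} {m : M} (h : OrbitSpace.proj φ m = c) {u : E₁} :
    (show TangentSpace 𝓘(ℝ, E₁) c from u) ∈ reducedDistribution E₁ Ω D φ c ↔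
      reducedCovector E₁ Ω D φ m u = 0 := by
  rw [H.reducedDistribution_eq h]
  rfl

theorem mem_formKer_interior {m : M} {v : E} :
    (show TangentSpace 𝓘(ℝ, E) m from v) ∈ formKer (DiffForm.interior D Ω m) ↔
      Ω.at m ![vectorAt D m, v] = 0 := mem_formKer

theorem reducedDistribution_proj (m : M) : reducedDistribution E₁ Ω D φ (OrbitSpace.proj φ m) =
    (formKer (DiffForm.interior D Ω m)).map
      (mfderiv 𝓘(ℝ, E) 𝓘(ℝ, E₁) (OrbitSpace.proj φ) m).toLinearMap := by
  ext u
  refine (H.mem_reducedDistribution rfl).trans ?_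
  constructor
  · intro hu
    obtain ⟨v, hv⟩ := H.orbitDeriv_surjective m u
    refine ⟨v, H.mem_formKer_interior.2 ?_, hv⟩
    rw [← H.reducedCovector_apply, hv, hu]
  · rintro ⟨v, hv, rfl⟩
    exact (H.reducedCovector_apply m v).trans (H.mem_formKer_interior.1 hv)

end IsReduction

end Reduction

/-! ### The preferred chart at its own centre. -/

section DiffFormD

variable {E : Type*} [NormedAddCommGroup E] [NormedSpace ℝ E]
  {M : Type*} [TopologicalSpace M] [ChartedSpace E M] [IsManifold 𝓘(ℝ, E) ∞ M] {k : ℕ}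

theorem mfderiv_extChartAt_symm_self (x : M) :
    (mfderiv 𝓘(ℝ, E) 𝓘(ℝ, E) (extChartAt 𝓘(ℝ, E) x).symm (extChartAt 𝓘(ℝ, E) x x) :
      E →L[ℝ] E) = ContinuousLinearMap.id ℝ E := by
  set e := extChartAt 𝓘(ℝ, E) x with he
  have h1 : MDifferentiableAt 𝓘(ℝ, E) 𝓘(ℝ, E) e (e.symm (e x)) := by
    refine mdifferentiableAt_extChartAt ?_
    rw [he, extChartAt_to_inv]
    exact mem_chart_source E x
  have h2 : MDifferentiableAt 𝓘(ℝ, E) 𝓘(ℝ, E) e.symm (e x) :=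
    mdifferentiableAt_extChartAt_symm (mem_extChartAt_target x)
  have h3 : (mfderiv 𝓘(ℝ, E) 𝓘(ℝ, E) (e ∘ e.symm) (e x) : E →L[ℝ] E) =
      ContinuousLinearMap.id ℝ E := by
    have h4 : e ∘ e.symm =ᶠ[𝓝 (e x)] id := by
      filter_upwards [(isOpen_extChartAt_target x).mem_nhds (mem_extChartAt_target x)] with y hy
        using e.right_inv hy
    rw [h4.mfderiv_eq, mfderiv_id]
    rfl
  have h5 : ∀ p, p = x → (mfderiv 𝓘(ℝ, E) 𝓘(ℝ, E) e p : E →L[ℝ] E) = ContinuousLinearMap.id ℝ E := by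
    rintro p rfl
    exact mfderiv_extChartAt_self
  ext v
  have h6 := mfderiv_comp_apply (e x) h1 h2 v
  have h7 := congrArg (fun l : E →L[ℝ] E => l
    ((mfderiv 𝓘(ℝ, E) 𝓘(ℝ, E) e.symm (e x) : E →L[ℝ] E) v)) (h5 (e.symm (e x)) (extChartAt_to_inv x))
  exact h7.symm.trans (h6.symm.trans (congrArg (fun l : E →L[ℝ] E => l v) h3))

theorem DiffForm.inChart_self_apply (α : DiffForm E M k) (x : M) (v : Fin k → E) :
    α.inChart x (extChartAt 𝓘(ℝ, E) x x) v = α.at x v := by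
  refine α.apply_congr (extChartAt_to_inv x) ?_
  funext i
  exact congrArg (fun l : E →L[ℝ] E => l (v i)) (mfderiv_extChartAt_symm_self x)

theorem DiffForm.d_at_apply (α : DiffForm E M k) (x : M) (v : Fin (k + 1) → E) :
    α.d.at x v = extDeriv (α.inChart x) (extChartAt 𝓘(ℝ, E) x x) v := by
  have e : (mfderiv 𝓘(ℝ, E) 𝓘(ℝ, E) (extChartAt 𝓘(ℝ, E) x) x : E →L[ℝ] E) =
    ContinuousLinearMap.id ℝ E := mfderiv_extChartAt_self
  refine congrArg (extDeriv (α.inChart x) (extChartAt 𝓘(ℝ, E) x x)) ?_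
  funext i
  exact congrArg (fun l : E →L[ℝ] E => l (v i)) e

/-- Exterior derivatives of proportional `1`-forms are proportional on the common kernel. -/
theorem DiffForm.d_eq_of_ker_le {α β : DiffForm E M 1} {x : M} (hα : α.SmoothAt x)
    (hβ : β.SmoothAt x) (h : ∀ᶠ y in 𝓝 x, ∀ v, β.at y ![v] = 0 → α.at y ![v] = 0) {w : E}
    (hw : β.at x ![w] ≠ 0) {u v : E} (hu : β.at x ![u] = 0) (hv : β.at x ![v] = 0) :
    α.d.at x ![u, v] = α.at x ![w] / β.at x ![w] * β.d.at x ![u, v] := by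
  rw [DiffForm.d_at_apply, DiffForm.d_at_apply]
  simp only [← DiffForm.inChart_self_apply] at *
  refine extDeriv_eq_of_ker_le (ContDiffAt.differentiableAt hα (by simp))
    (ContDiffAt.differentiableAt hβ (by simp)) ?_ hw hu hv
  have hc := continuousAt_extChartAt_symm (I := 𝓘(ℝ, E)) x
  rw [ContinuousAt, extChartAt_to_inv] at hc
  filter_upwards [hc.eventually h] with z hz v hv
  simp only [DiffForm.inChart_self_apply] at hz
  have e : ∀ γ : DiffForm E M 1, γ.inChart x z ![v] = γ.at ((extChartAt 𝓘(ℝ, E) x).symm z)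
      ![(mfderiv 𝓘(ℝ, E) 𝓘(ℝ, E) (extChartAt 𝓘(ℝ, E) x).symm z : E →L[ℝ] E) v] := fun γ => by
    refine congrArg (γ.at ((extChartAt 𝓘(ℝ, E) x).symm z)) ?_
    ext i
    fin_cases i
    rfl
  rw [e] at hv ⊢
  exact hz _ hv

end DiffFormD

/-! ### Contact forms from local sections, and the conformal class. -/

section ContactReduction

variable {E : Type*} [NormedAddCommGroup E] [NormedSpace ℝ E]
  {E₁ : Type*} [NormedAddCommGroup E₁] [NormedSpace ℝ E₁]
  {M : Type*} [TopologicalSpace M] [ChartedSpace E M]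
  {Ω : DiffForm E M 2} {D : (x : M) → TangentSpace 𝓘(ℝ, E) x} {φ : Flow ℝ M}
  [ChartedSpace E₁ (OrbitSpace φ)]

/-- The derivative of a local section, as a map of model spaces. -/
def sectionDeriv (E : Type*) [NormedAddCommGroup E] [NormedSpace ℝ E]
    (E₁ : Type*) [NormedAddCommGroup E₁] [NormedSpace ℝ E₁] {M C : Type*} [TopologicalSpace M]
    [ChartedSpace E M] [TopologicalSpace C] [ChartedSpace E₁ C] (σ : C → M) (c : C) : E₁ →L[ℝ] E :=
  mfderiv 𝓘(ℝ, E₁) 𝓘(ℝ, E) σ c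

/-- The class of bilinear forms on the reduced distribution which are, up to nonzero multiples,
induced by `Ω`. -/
def reducedConformalClass (E₁ : Type*) [NormedAddCommGroup E₁] [NormedSpace ℝ E₁]
    (Ω : DiffForm E M 2) (D : (x : M) → TangentSpace 𝓘(ℝ, E) x) (φ : Flow ℝ M)
    [ChartedSpace E₁ (OrbitSpace φ)] (c : OrbitSpace φ) :
    Set (LinearMap.BilinForm ℝ (reducedDistribution E₁ Ω D φ c)) :=
  {B | ∃ m, OrbitSpace.proj φ m = c ∧ ∃ a : ℝ, a ≠ 0 ∧ ∀ (u₁ u₂ : reducedDistribution E₁ Ω D φ c)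
    (v₁ v₂ : E), Ω.at m ![vectorAt D m, v₁] = 0 → Ω.at m ![vectorAt D m, v₂] = 0 →
    orbitDeriv E E₁ φ m v₁ = (u₁ : TangentSpace 𝓘(ℝ, E₁) c) →
    orbitDeriv E E₁ φ m v₂ = (u₂ : TangentSpace 𝓘(ℝ, E₁) c) → B u₁ u₂ = a * Ω.at m ![v₁, v₂]}

namespace IsReduction

variable [IsManifold 𝓘(ℝ, E) ∞ M] [IsManifold 𝓘(ℝ, E₁) ∞ (OrbitSpace φ)]
  [FiniteDimensional ℝ E] [FiniteDimensional ℝ E₁] (H : IsReduction E₁ Ω D φ)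
  {U : Set (OrbitSpace φ)} {σ : OrbitSpace φ → M}
  (hσ : IsSectionOn (E := E) (E₁ := E₁) (OrbitSpace.proj φ) U σ) {c : OrbitSpace φ} (hc : c ∈ U)

include H hσ hc

theorem orbitDeriv_sectionDeriv (u : E₁) :
    orbitDeriv E E₁ φ (σ c) (sectionDeriv E E₁ σ c u) = u :=
  hσ.mfderiv_apply hc (H.mdifferentiableAt_proj _) u

theorem interior_sectionDeriv (u : E₁) :
    Ω.at (σ c) ![vectorAt D (σ c), sectionDeriv E E₁ σ c u] =
      reducedCovector E₁ Ω D φ (σ c) u := by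
  rw [← H.reducedCovector_apply, H.orbitDeriv_sectionDeriv hσ hc]

theorem pullback_interior_apply (u : E₁) :
    (DiffForm.pullback (E := E₁) σ (DiffForm.interior D Ω)).at c ![u] =
      reducedCovector E₁ Ω D φ (σ c) u := by
  rw [← H.interior_sectionDeriv hσ hc]
  refine congrArg (Ω.at (σ c)) ?_
  ext i
  fin_cases i <;> rfl

theorem pullback_form_apply (u v : E₁) :
    (DiffForm.pullback (E := E₁) σ Ω).at c ![u, v] =
      Ω.at (σ c) ![sectionDeriv E E₁ σ c u, sectionDeriv E E₁ σ c v] := by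
  refine congrArg (Ω.at (σ c)) ?_
  ext i
  fin_cases i <;> rfl

theorem smoothAt_pullback_interior :
    (DiffForm.pullback (E := E₁) σ (DiffForm.interior D Ω)).SmoothAt c :=
  (H.smoothAt_interior _).pullback (hσ.contMDiffAt c hc)

theorem smoothAt_pullback_form : (DiffForm.pullback (E := E₁) σ Ω).SmoothAt c :=
  (H.smoothAt _).pullback (hσ.contMDiffAt c hc)

theorem d_pullback_interior :
    (DiffForm.pullback (E := E₁) σ (DiffForm.interior D Ω)).d c =
      DiffForm.pullback (E := E₁) σ Ω c := by
  rw [DiffForm.d_pullback (H.smoothAt_interior _) (hσ.contMDiffAt c hc), H.d_interior]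

/-- The derivative of `σ` lifts tangent vectors of the orbit space to `M`, so linear reduction
applies with these lifts. -/
theorem pullback_form_nondegenerate {u : E₁} (hu : reducedCovector E₁ Ω D φ (σ c) u = 0)
    (h : ∀ w, reducedCovector E₁ Ω D φ (σ c) w = 0 →
      (DiffForm.pullback (E := E₁) σ Ω).at c ![u, w] = 0) : u = 0 := by
  refine eq_zero_of_pair_eq_zero (Ω := Ω.at (σ c)) (d := vectorAt D (σ c))
    (P := orbitDeriv E E₁ φ (σ c)) (S := sectionDeriv E E₁ σ c) (H.form_nondegenerate _)
    (H.generator_ne_zero _) (H.orbitDeriv_generator _) (H.exists_smul_of_orbitDeriv_eq_zero _)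
    (H.orbitDeriv_sectionDeriv hσ hc) ?_ fun w hw => ?_
  · rw [H.interior_sectionDeriv hσ hc, hu]
  · rw [← H.pullback_form_apply hσ hc]
    exact h w (by rw [← H.interior_sectionDeriv hσ hc, hw])

omit hc in
theorem isContactFormOn {n : ℕ} (hn : Module.finrank ℝ E₁ = 2 * n + 1) :
    IsContactFormOn n (reducedDistribution E₁ Ω D φ) U
      (DiffForm.pullback (E := E₁) σ (DiffForm.interior D Ω)) where
  smooth := (DiffForm.smoothOn_iff hσ.isOpen).2 fun _ hc => H.smoothAt_pullback_interior hσ hc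
  ker_eq := fun c hc => by
    ext u
    refine Iff.trans ?_ (H.mem_reducedDistribution (hσ.apply_eq c hc)).symm
    exact mem_formKer.trans (Eq.congr (H.pullback_interior_apply hσ hc u) rfl)
  nonintegrable := fun c hc => by
    refine wedge_wedgePow_ne_zero (V := E₁) n hn _ _ fun u hu h => ?_
    refine H.pullback_form_nondegenerate hσ hc
      ((H.pullback_interior_apply hσ hc u).symm.trans hu) fun w hw => ?_
    have h1 := h w ((H.pullback_interior_apply hσ hc w).trans hw)
    rw [H.d_pullback_interior hσ hc] at h1
    exact h1

theorem formRestrict_nondegenerate :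
    (formRestrict (DiffForm.pullback (E := E₁) σ Ω c)
      (reducedDistribution E₁ Ω D φ c)).Nondegenerate := by
  have key : ∀ u : reducedDistribution E₁ Ω D φ c, (∀ w : reducedDistribution E₁ Ω D φ c,
      DiffForm.pullback (E := E₁) σ Ω c ![(u : TangentSpace 𝓘(ℝ, E₁) c), w] = 0) → u = 0 := by
    rintro ⟨u, hu⟩ h
    refine Subtype.ext (H.pullback_form_nondegenerate hσ hc
      ((H.mem_reducedDistribution (hσ.apply_eq c hc)).1 hu) fun w hw => ?_)
    exact h ⟨w, (H.mem_reducedDistribution (hσ.apply_eq c hc)).2 hw⟩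
  refine ⟨key, fun u h => key u fun w => ?_⟩
  rw [ContinuousAlternatingMap.apply_pair_swap]
  exact neg_eq_zero.2 (h w)

/-- On the kernel of `Ω(D, ·)` the value of `Ω` does not depend on the lifts, and passing from `σ c`
to another point `φ t (σ c)` of the orbit multiplies it by `e^t`, which the free factor `a` absorbs.
-/
theorem reducedConformalClass_eq : reducedConformalClass E₁ Ω D φ c =
    {B | ∃ a : ℝ, a ≠ 0 ∧ B = a • formRestrict (DiffForm.pullback (E := E₁) σ Ω c)
      (reducedDistribution E₁ Ω D φ c)} := by
  ext B
  constructor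
  · rintro ⟨m, hm, a, ha, hB⟩
    obtain ⟨t, ht⟩ := (OrbitSpace.proj_eq_iff φ).1 ((hσ.apply_eq c hc).trans hm.symm)
    subst ht
    refine ⟨a * Real.exp t, mul_ne_zero ha (Real.exp_ne_zero t), ?_⟩
    ext ⟨u₁, h₁⟩ ⟨u₂, h₂⟩
    have hk : ∀ u : E₁, (show TangentSpace 𝓘(ℝ, E₁) c from u) ∈ reducedDistribution E₁ Ω D φ c →
        Ω.at (φ t (σ c)) ![vectorAt D (φ t (σ c)),
          flowDeriv E φ t (σ c) (sectionDeriv E E₁ σ c u)] = 0 := fun u hu => by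
      rw [← H.flowDeriv_generator, H.form_flowDeriv, H.interior_sectionDeriv hσ hc,
        (H.mem_reducedDistribution (hσ.apply_eq c hc)).1 hu, mul_zero]
    have hp : ∀ u, orbitDeriv E E₁ φ (φ t (σ c))
        (flowDeriv E φ t (σ c) (sectionDeriv E E₁ σ c u)) = u := fun u => by
      rw [H.orbitDeriv_flowDeriv, H.orbitDeriv_sectionDeriv hσ hc]
    have h3 := hB ⟨u₁, h₁⟩ ⟨u₂, h₂⟩ _ _ (hk u₁ h₁) (hk u₂ h₂) (hp u₁) (hp u₂)
    rw [h3, H.form_flowDeriv, ← mul_assoc]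
    exact congrArg (a * Real.exp t * ·) (H.pullback_form_apply hσ hc u₁ u₂).symm
  · rintro ⟨a, ha, rfl⟩
    refine ⟨σ c, hσ.apply_eq c hc, a, ha, fun u₁ u₂ v₁ v₂ h₁ h₂ e₁ e₂ => ?_⟩
    rw [pair_eq_of_lifts (H.exists_smul_of_orbitDeriv_eq_zero _) h₁ h₂
      (e₁.trans (H.orbitDeriv_sectionDeriv hσ hc _).symm)
      (e₂.trans (H.orbitDeriv_sectionDeriv hσ hc _).symm)]
    exact congrArg (a * ·) (H.pullback_form_apply hσ hc (u₁ : TangentSpace 𝓘(ℝ, E₁) c)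
      (u₂ : TangentSpace 𝓘(ℝ, E₁) c))

/-- Both `η` and `σ^* λ` have the distribution as kernel near `c`, so they are proportional, and
their exterior derivatives have the same ratio on it. The ratio is nonzero because neither form
vanishes at `w`. -/
theorem formRestrict_d_mem {n : ℕ} {V : Set (OrbitSpace φ)} {η : DiffForm E₁ (OrbitSpace φ) 1}
    (hV : IsOpen V) (hη : IsContactFormOn n (reducedDistribution E₁ Ω D φ) V η) (hcV : c ∈ V) :
    formRestrict (η.d c) (reducedDistribution E₁ Ω D φ c) ∈ reducedConformalClass E₁ Ω D φ c := by
  rw [H.reducedConformalClass_eq hσ hc]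
  set η₀ := DiffForm.pullback (E := E₁) σ (DiffForm.interior D Ω) with hη₀
  have hker : ∀ y ∈ U ∩ V, ∀ v, η₀.at y ![v] = 0 ↔ η.at y ![v] = 0 := fun y hy v => by
    rw [hη₀, H.pullback_interior_apply hσ hy.1]
    refine (H.mem_reducedDistribution (hσ.apply_eq y hy.1)).symm.trans ?_
    rw [← hη.ker_eq y hy.2]
    exact mem_formKer
  obtain ⟨w, hw⟩ : ∃ w, reducedCovector E₁ Ω D φ (σ c) w ≠ 0 := by
    by_contra! hcon
    exact H.reducedCovector_ne_zero (σ c) (ContinuousLinearMap.ext hcon)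
  rw [← H.pullback_interior_apply hσ hc] at hw
  refine ⟨η.at c ![w] / η₀.at c ![w],
    div_ne_zero (fun h => hw ((hker c ⟨hc, hcV⟩ w).2 h)) hw, ?_⟩
  ext ⟨u, hu⟩ ⟨v, hv⟩
  have hk : ∀ u : E₁, (show TangentSpace 𝓘(ℝ, E₁) c from u) ∈ reducedDistribution E₁ Ω D φ c →
      η₀.at c ![u] = 0 := fun u hu => by
    rw [hη₀, H.pullback_interior_apply hσ hc]
    exact (H.mem_reducedDistribution (hσ.apply_eq c hc)).1 hu
  have h1 := DiffForm.d_eq_of_ker_le ((DiffForm.smoothOn_iff hV).1 hη.smooth c hcV)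
    (H.smoothAt_pullback_interior hσ hc) (by
      filter_upwards [(hσ.isOpen.inter hV).mem_nhds ⟨hc, hcV⟩] with y hy v using (hker y hy v).1)
    hw (hk u hu) (hk v hv)
  have h2 : η₀.d.at c ![u, v] = DiffForm.pullback (E := E₁) σ Ω c ![u, v] := by
    rw [← H.d_pullback_interior hσ hc]; rfl
  rw [h2] at h1
  exact h1

end IsReduction

end ContactReduction

/-! ### Submanifolds from slice charts. -/

section Slices

variable {E : Type*} [NormedAddCommGroup E] [NormedSpace ℝ E]
  {K : Type*} [NormedAddCommGroup K] [NormedSpace ℝ K]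
  {F : Type*} [NormedAddCommGroup F] [NormedSpace ℝ F]
  {H : Type*} [TopologicalSpace H] {I : ModelWithCorners ℝ F H}
  {N : Type*} [TopologicalSpace N] [ChartedSpace H N] {S : Set N}
  {L : (E × K) ≃L[ℝ] F} {e : OpenPartialHomeomorph N H}

/-- A chart `e` in which the set `S` is the slice `E × {0}` of `E × K`. -/
structure IsSliceChart (I : ModelWithCorners ℝ F H) (S : Set N) (L : (E × K) ≃L[ℝ] F)
    (e : OpenPartialHomeomorph N H) : Prop where
  mem_maximalAtlas : e ∈ IsManifold.maximalAtlas I ∞ N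
  mem_iff : ∀ x ∈ e.source, x ∈ S ↔ (L.symm (e.extend I x)).2 = 0

theorem IsSliceChart.apply_eq (h : IsSliceChart I S L e) {x : N} (hx : x ∈ e.source) (hxS : x ∈ S) :
    L ((L.symm (e.extend I x)).1, 0) = e.extend I x := by
  rw [← (h.mem_iff x hx).1 hxS, Prod.mk.eta, L.apply_symm_apply]

theorem IsSliceChart.symm_mem (h : IsSliceChart I S L e) {v : E}
    (hv : L (v, 0) ∈ (e.extend I).target) : (e.extend I).symm (L (v, 0)) ∈ S := by
  refine (h.mem_iff _ ?_).2 ?_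
  · rw [← e.extend_source (I := I)]
    exact (e.extend I).map_target hv
  · rw [(e.extend I).right_inv hv, L.symm_apply_apply]

variable [I.Boundaryless]

open Classical in
/-- The chart of `S` obtained by restriction of a slice chart. -/
def IsSliceChart.restrict (h : IsSliceChart I S L e) (q : S) : OpenPartialHomeomorph S E where
  toFun x := (L.symm (e.extend I x)).1
  -- Off the target the value is irrelevant; `q` serves as a default.
  invFun v := if hv : L (v, 0) ∈ (e.extend I).target then
    ⟨(e.extend I).symm (L (v, 0)), h.symm_mem hv⟩ else q
  source := {x | x.1 ∈ e.source}
  target := {v | L (v, 0) ∈ (e.extend I).target}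
  map_source' x hx := by
    change L ((L.symm (e.extend I x)).1, 0) ∈ (e.extend I).target
    rw [h.apply_eq hx x.2]
    exact (e.extend I).map_source (by rwa [e.extend_source])
  map_target' v hv := by
    have hv' : L (v, 0) ∈ (e.extend I).target := hv
    rw [dif_pos hv']
    change (e.extend I).symm (L (v, 0)) ∈ e.source
    rw [← e.extend_source (I := I)]
    exact (e.extend I).map_target hv
  left_inv' x hx := by
    have hx' : x.1 ∈ (e.extend I).source := by rwa [e.extend_source]
    have hv : L ((L.symm (e.extend I x)).1, 0) ∈ (e.extend I).target := by
      rw [h.apply_eq hx x.2]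
      exact (e.extend I).map_source hx'
    rw [dif_pos hv]
    refine Subtype.ext ?_
    change (e.extend I).symm (L ((L.symm (e.extend I x)).1, 0)) = x
    rw [h.apply_eq hx x.2, (e.extend I).left_inv hx']
  right_inv' v hv := by
    have hv' : L (v, 0) ∈ (e.extend I).target := hv
    rw [dif_pos hv']
    change (L.symm (e.extend I ((e.extend I).symm (L (v, 0))))).1 = v
    rw [(e.extend I).right_inv hv', L.symm_apply_apply]
  open_source := e.open_source.preimage continuous_subtype_val
  open_target := e.isOpen_extend_target.preimage
    (L.continuous.comp (Continuous.prodMk continuous_id continuous_const))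
  continuousOn_toFun := by
    refine continuous_fst.comp_continuousOn (L.symm.continuous.comp_continuousOn ?_)
    refine e.continuousOn_extend.comp continuous_subtype_val.continuousOn fun x hx => ?_
    rwa [e.extend_source]
  continuousOn_invFun := by
    rw [Topology.IsInducing.subtypeVal.continuousOn_iff]
    have h1 : ContinuousOn (fun v : E => (e.extend I).symm (L (v, 0)))
        {v | L (v, 0) ∈ (e.extend I).target} :=
      e.continuousOn_extend_symm.comp
        (L.continuous.comp (Continuous.prodMk continuous_id continuous_const)).continuousOn
        fun v hv => hv
    refine h1.congr fun v hv => ?_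
    have hv' : L (v, 0) ∈ (e.extend I).target := hv
    simp only [Function.comp_apply, dif_pos hv']

theorem IsSliceChart.restrict_apply (h : IsSliceChart I S L e) (q x : S) :
    h.restrict q x = (L.symm (e.extend I x)).1 := rfl

theorem IsSliceChart.restrict_symm_apply (h : IsSliceChart I S L e) (q : S) {v : E}
    (hv : v ∈ (h.restrict q).target) :
    ((h.restrict q).symm v : N) = (e.extend I).symm (L (v, 0)) := by
  have hv' : L (v, 0) ∈ (e.extend I).target := hv
  exact congrArg Subtype.val (dif_pos hv')

/-- The transition map is the ambient one between the inclusion `v ↦ (v, 0)` and the projection to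
the first factor. -/
theorem IsSliceChart.contDiffOn_transition [IsManifold I ∞ N] {L' : (E × K) ≃L[ℝ] F}
    {e' : OpenPartialHomeomorph N H} (h : IsSliceChart I S L e) (h' : IsSliceChart I S L' e')
    (q q' : S) : ContDiffOn ℝ ∞ ((h.restrict q).symm.trans (h'.restrict q'))
      ((h.restrict q).symm.trans (h'.restrict q')).source := by
  have h1 := I.contDiffOn_extendCoordChange h.mem_maximalAtlas h'.mem_maximalAtlas
  have h2 : ContDiffOn ℝ ∞ (fun v : E => (L'.symm ((e'.extend I ∘ (e.extend I).symm)
      (L (v, 0)))).1) ((h.restrict q).symm.trans (h'.restrict q')).source := by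
    have h3 : ContDiff ℝ ∞ (fun v : E => L (v, 0)) :=
      L.contDiff.comp (contDiff_id.prodMk contDiff_const)
    refine contDiff_fst.comp_contDiffOn (L'.symm.contDiff.comp_contDiffOn (h1.comp
      h3.contDiffOn fun v hv => ?_))
    rw [OpenPartialHomeomorph.trans_source] at hv
    obtain ⟨hv1, hv2⟩ := hv
    refine ⟨hv1, ?_⟩
    have hv3 : ((h.restrict q).symm v : N) ∈ e'.source := hv2
    rw [h.restrict_symm_apply q hv1] at hv3
    simpa using hv3
  refine h2.congr fun v hv => ?_
  rw [OpenPartialHomeomorph.trans_source] at hv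
  change (h'.restrict q') ((h.restrict q).symm v) = _
  rw [h'.restrict_apply, h.restrict_symm_apply q hv.1]
  rfl

/-- A subset which is locally a slice is an embedded submanifold. -/
theorem exists_chartedSpace_of_isSliceChart [IsManifold I ∞ N]
    (h : ∀ q ∈ S, ∃ (L : (E × K) ≃L[ℝ] F) (e : OpenPartialHomeomorph N H),
      IsSliceChart I S L e ∧ q ∈ e.source) :
    ∃ _ : ChartedSpace E S, IsManifold 𝓘(ℝ, E) ∞ S ∧
      Manifold.IsSmoothEmbedding 𝓘(ℝ, E) I ∞ (Subtype.val : S → N) := by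
  choose L e he hq using fun q : S => h q q.2
  let cs : ChartedSpace E S :=
    { atlas := Set.range fun q : S => (he q).restrict q
      chartAt := fun q => (he q).restrict q
      mem_chart_source := fun q => hq q
      chart_mem_atlas := fun q => ⟨q, rfl⟩ }
  have hmfd : IsManifold 𝓘(ℝ, E) ∞ S := by
    refine isManifold_of_contDiffOn _ _ _ ?_
    rintro _ _ ⟨q, rfl⟩ ⟨q', rfl⟩
    simpa using (he q).contDiffOn_transition (he q') q q'
  refine ⟨cs, hmfd, ?_, Topology.IsEmbedding.subtypeVal⟩
  have himm : Manifold.IsImmersionOfComplement K 𝓘(ℝ, E) I ∞ (Subtype.val : S → N) := by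
    intro q
    refine Manifold.IsImmersionAtOfComplement.mk_of_charts (L q) ((he q).restrict q) (e q)
      (hq q) (hq q) (IsManifold.subset_maximalAtlas ⟨q, rfl⟩) (he q).mem_maximalAtlas
      (fun x hx => hx) ?_
    intro v hv
    have hv' : v ∈ ((he q).restrict q).target := by simpa using hv
    have h1 := (he q).restrict_symm_apply q hv'
    have h2 : ((((he q).restrict q).extend 𝓘(ℝ, E)).symm v : N) =
        ((he q).restrict q).symm v := by simp
    rw [Function.comp_apply, Function.comp_apply, h2, h1]
    exact ((e q).extend I).right_inv hv'
  exact himm.isImmersion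

end Slices

/-! ### Charts of the cotangent bundle. -/

section CotangentCharts

variable {E : Type*} [NormedAddCommGroup E] [NormedSpace ℝ E]
  {C : Type*} [TopologicalSpace C] [ChartedSpace E C] [IsManifold 𝓘(ℝ, E) ∞ C]

/-- A covector as a functional on the model space. -/
def CotangentBundle.covector (β : CotangentBundle E C) : E →L[ℝ] ℝ := β.2

/-- The derivative of the inverse of the preferred chart at `c₀`, as a map of the model space. -/
def chartSymmDeriv (E : Type*) [NormedAddCommGroup E] [NormedSpace ℝ E] {C : Type*}
    [TopologicalSpace C] [ChartedSpace E C] (c₀ : C) (y : E) : E →L[ℝ] E :=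
  mfderiv 𝓘(ℝ, E) 𝓘(ℝ, E) (extChartAt 𝓘(ℝ, E) c₀).symm y

/-- Unfolding the trivialization of the bundle of homomorphisms shows that a covector is read as its
pullback under the inverse chart, the same rule that reads one-forms in coordinates. -/
theorem CotangentBundle.chartAt_apply {β₀ β : CotangentBundle E C}
    (h : β.1 ∈ (chartAt E β₀.1).source) :
    chartAt (ModelProd E (E →L[ℝ] ℝ)) β₀ β = (extChartAt 𝓘(ℝ, E) β₀.1 β.1,
      β.covector.comp (chartSymmDeriv E β₀.1 (extChartAt 𝓘(ℝ, E) β₀.1 β.1))) := by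
  rw [hom_chart]
  congr 1
  rw [ContinuousLinearMap.inCoordinates, TangentBundle.symmL_trivializationAt h,
    ModelWithCorners.range_eq_univ, mfderivWithin_univ]
  ext v
  simp
  rfl

theorem CotangentBundle.mem_chartAt_source {β₀ β : CotangentBundle E C} :
    β ∈ (chartAt (ModelProd E (E →L[ℝ] ℝ)) β₀).source ↔ β.1 ∈ (chartAt E β₀.1).source := by
  rw [FiberBundle.chartedSpace_chartAt]
  simp only [mfld_simps]
  refine ⟨fun h => h.1.1, fun h => ⟨⟨h, trivial⟩, ?_⟩⟩
  rw [hom_trivializationAt_apply]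
  exact h

theorem chartSymmDeriv_surjective {c₀ : C} {y : E} (hy : y ∈ (extChartAt 𝓘(ℝ, E) c₀).target) :
    Function.Surjective (chartSymmDeriv E c₀ y) := by
  have h := isInvertible_mfderivWithin_extChartAt_symm (I := 𝓘(ℝ, E)) hy
  rw [ModelWithCorners.range_eq_univ, mfderivWithin_univ] at h
  exact h.bijective.surjective

/-- The coordinate expression of a `1`-form as a family of functionals on the model space. -/
def DiffForm.inChartDual (η : DiffForm E C 1) (c₀ : C) (y : E) : E →L[ℝ] ℝ :=
  (ContinuousAlternatingMap.ofSubsingleton ℝ E ℝ (0 : Fin 1)).symm (η.inChart c₀ y)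

theorem DiffForm.inChartDual_apply (η : DiffForm E C 1) (c₀ : C) (y v : E) :
    η.inChartDual c₀ y v = η.at ((extChartAt 𝓘(ℝ, E) c₀).symm y) ![chartSymmDeriv E c₀ y v] := by
  refine congrArg (η.at ((extChartAt 𝓘(ℝ, E) c₀).symm y)) ?_
  ext i
  fin_cases i
  rfl

theorem ContDiffAt.inChartDual [FiniteDimensional ℝ E] {η : DiffForm E C 1} {c₀ : C} {y : E}
    (h : ContDiffAt ℝ ∞ (η.inChart c₀) y) : ContDiffAt ℝ ∞ (η.inChartDual c₀) y := by
  let e := ContinuousAlternatingMap.ofSubsingletonLIE (𝕜 := ℝ) (E := E) (F := ℝ) (0 : Fin 1)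
  exact e.symm.contDiff.contDiffAt.comp y h

end CotangentCharts

/-! ### Straightening a family of lines of functionals. -/

section Shear

variable {E : Type*} [NormedAddCommGroup E] [NormedSpace ℝ E]

/-- The shear `(y, b) ↦ (y, b - b(w) (ζ(y) - ζ₀))` where `ζ(y)(w) = ζ₀(w) = 1`. It straightens the
family of lines spanned by the functionals `ζ(y)`. -/
def shear (Y : Set E) (hY : IsOpen Y) (w : E) (ζ : E → E →L[ℝ] ℝ) (ζ₀ : E →L[ℝ] ℝ)
    (hζ : ContinuousOn ζ Y) (hw : ∀ y ∈ Y, ζ y w = 1) (hw₀ : ζ₀ w = 1) :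
    OpenPartialHomeomorph (ModelProd E (E →L[ℝ] ℝ)) (ModelProd E (E →L[ℝ] ℝ)) where
  -- For `p.1 ∈ Y` the functional `ζ p.1 - ζ₀` vanishes at `w`, so the shear preserves `p.2 w` and
  -- is undone by changing the sign.
  toFun p := (p.1, p.2 - p.2 w • (ζ p.1 - ζ₀))
  invFun p := (p.1, p.2 + p.2 w • (ζ p.1 - ζ₀))
  source := {p : E × (E →L[ℝ] ℝ) | p.1 ∈ Y ∧ p.2 w ≠ 0}
  target := {p : E × (E →L[ℝ] ℝ) | p.1 ∈ Y ∧ p.2 w ≠ 0}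
  map_source' := by
    rintro ⟨y, b⟩ ⟨hy, hb⟩
    refine ⟨hy, ?_⟩
    simpa [hw y hy, hw₀] using hb
  map_target' := by
    rintro ⟨y, b⟩ ⟨hy, hb⟩
    refine ⟨hy, ?_⟩
    simpa [hw y hy, hw₀] using hb
  left_inv' := by
    rintro ⟨y, b⟩ ⟨hy, hb⟩
    have hy : y ∈ Y := hy
    refine Prod.ext rfl ?_
    simp [hw y hy, hw₀]
  right_inv' := by
    rintro ⟨y, b⟩ ⟨hy, hb⟩
    have hy : y ∈ Y := hy
    refine Prod.ext rfl ?_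
    simp [hw y hy, hw₀]
  open_source := (hY.preimage continuous_fst).inter
    (isOpen_ne.preimage (((ContinuousLinearMap.apply ℝ ℝ w).continuous).comp continuous_snd))
  open_target := (hY.preimage continuous_fst).inter
    (isOpen_ne.preimage (((ContinuousLinearMap.apply ℝ ℝ w).continuous).comp continuous_snd))
  continuousOn_toFun := by
    have h1 : ContinuousOn (fun p : E × (E →L[ℝ] ℝ) => ζ p.1) {p | p.1 ∈ Y ∧ p.2 w ≠ 0} :=
      hζ.comp continuous_fst.continuousOn fun p hp => hp.1
    have h2 : Continuous (fun p : E × (E →L[ℝ] ℝ) => p.2 w) :=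
      (ContinuousLinearMap.apply ℝ ℝ w).continuous.comp continuous_snd
    exact continuous_fst.continuousOn.prodMk (continuous_snd.continuousOn.sub
      (h2.continuousOn.smul (h1.sub continuousOn_const)))
  continuousOn_invFun := by
    have h1 : ContinuousOn (fun p : E × (E →L[ℝ] ℝ) => ζ p.1) {p | p.1 ∈ Y ∧ p.2 w ≠ 0} :=
      hζ.comp continuous_fst.continuousOn fun p hp => hp.1
    have h2 : Continuous (fun p : E × (E →L[ℝ] ℝ) => p.2 w) :=
      (ContinuousLinearMap.apply ℝ ℝ w).continuous.comp continuous_snd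
    exact continuous_fst.continuousOn.prodMk (continuous_snd.continuousOn.add
      (h2.continuousOn.smul (h1.sub continuousOn_const)))

theorem shear_mem_contDiffGroupoid {Y : Set E} {hY : IsOpen Y} {w : E} {ζ : E → E →L[ℝ] ℝ}
    {ζ₀ : E →L[ℝ] ℝ} (hζ : ContDiffOn ℝ ∞ ζ Y) (hw : ∀ y ∈ Y, ζ y w = 1) (hw₀ : ζ₀ w = 1) :
    shear Y hY w ζ ζ₀ hζ.continuousOn hw hw₀ ∈
      contDiffGroupoid ∞ (𝓘(ℝ, E).prod 𝓘(ℝ, E →L[ℝ] ℝ)) := by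
  have h1 : ContDiffOn ℝ ∞ (fun p : E × (E →L[ℝ] ℝ) => ζ p.1) {p | p.1 ∈ Y ∧ p.2 w ≠ 0} :=
    hζ.comp contDiff_fst.contDiffOn fun p hp => hp.1
  have h2 : ContDiff ℝ ∞ (fun p : E × (E →L[ℝ] ℝ) => p.2 w) :=
    (ContinuousLinearMap.apply ℝ ℝ w).contDiff.comp contDiff_snd
  have h3 : ContDiffOn ℝ ∞ (fun p : E × (E →L[ℝ] ℝ) => (p.1, p.2 - p.2 w • (ζ p.1 - ζ₀)))
      {p | p.1 ∈ Y ∧ p.2 w ≠ 0} := contDiff_fst.contDiffOn.prodMk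
    (contDiff_snd.contDiffOn.sub (h2.contDiffOn.smul (h1.sub contDiffOn_const)))
  have h4 : ContDiffOn ℝ ∞ (fun p : E × (E →L[ℝ] ℝ) => (p.1, p.2 + p.2 w • (ζ p.1 - ζ₀)))
      {p | p.1 ∈ Y ∧ p.2 w ≠ 0} := contDiff_fst.contDiffOn.prodMk
    (contDiff_snd.contDiffOn.add (h2.contDiffOn.smul (h1.sub contDiffOn_const)))
  refine mem_groupoid_of_pregroupoid.2 ⟨?_, ?_⟩
  · exact h3.mono fun p hp => hp.1
  · exact h4.mono fun p hp => hp.1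

theorem OpenPartialHomeomorph.trans_mem_maximalAtlas {H N : Type*} [TopologicalSpace H]
    [TopologicalSpace N] [ChartedSpace H N]
    {G : StructureGroupoid H} {e : OpenPartialHomeomorph N H}
    {h : OpenPartialHomeomorph H H} (he : e ∈ G.maximalAtlas N) (hh : h ∈ G) :
    e.trans h ∈ G.maximalAtlas N := fun e' he' => by
  rw [OpenPartialHomeomorph.trans_symm_eq_symm_trans_symm, OpenPartialHomeomorph.trans_assoc,
    ← OpenPartialHomeomorph.trans_assoc e'.symm]
  exact ⟨G.trans (G.symm hh) (he e' he').1, G.trans (he e' he').2 hh⟩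

/-- Two functionals with the same kernel and the same nonzero value at a vector agree. -/
theorem ContinuousLinearMap.ker_eq_ker_iff_eq_smul {b ζ : E →L[ℝ] ℝ} {w : E} (hb : b w ≠ 0)
    (hζ : ζ w ≠ 0) :
    LinearMap.ker (b : E →ₗ[ℝ] ℝ) = LinearMap.ker (ζ : E →ₗ[ℝ] ℝ) ↔ b = (b w / ζ w) • ζ := by
  constructor
  · intro h
    ext v
    have h1 : v - (ζ v / ζ w) • w ∈ LinearMap.ker (ζ : E →ₗ[ℝ] ℝ) := by
      simp [hζ]
    rw [← h] at h1
    have h2 : b (v - (ζ v / ζ w) • w) = 0 := h1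
    rw [map_sub, map_smul, smul_eq_mul] at h2
    rw [_root_.smul_apply, smul_eq_mul]
    field_simp at h2 ⊢
    linarith
  · intro h
    have ha : b w / ζ w ≠ 0 := div_ne_zero hb hζ
    generalize b w / ζ w = a at h ha
    ext v
    simp [h, ha]

end Shear

/-! ### The symplectification as an embedded submanifold. -/

section SymplectificationCharts

variable {E₁ : Type*} [NormedAddCommGroup E₁] [NormedSpace ℝ E₁] [FiniteDimensional ℝ E₁]
  {E : Type*} [NormedAddCommGroup E] [NormedSpace ℝ E] [FiniteDimensional ℝ E]
  {K : Type*} [NormedAddCommGroup K] [NormedSpace ℝ K] [FiniteDimensional ℝ K]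
  {C : Type*} [TopologicalSpace C] [ChartedSpace E₁ C] [IsManifold 𝓘(ℝ, E₁) ∞ C]
  {𝒟 : (c : C) → Submodule ℝ (TangentSpace 𝓘(ℝ, E₁) c)}

/-- The distribution `𝒟` is locally the kernel of a smooth nonvanishing `1`-form. -/
def IsLocallyKernel (𝒟 : (c : C) → Submodule ℝ (TangentSpace 𝓘(ℝ, E₁) c)) : Prop :=
  ∀ c : C, ∃ (U : Set C) (η : DiffForm E₁ C 1), IsOpen U ∧ c ∈ U ∧ (∀ y ∈ U, η.SmoothAt y) ∧
    (∀ y ∈ U, formKer (η y) = 𝒟 y) ∧ ∃ w, η.at c ![w] ≠ 0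

/-- `B` turns the line of `ζ₀` into the axis `{0} × ℝ`. The coordinate on that axis joins `y` in
`E`, and `K` receives the transverse coordinates. -/
theorem exists_sliceEquiv (hE : Module.finrank ℝ E = Module.finrank ℝ E₁ + 1)
    (hK : Module.finrank ℝ E₁ = Module.finrank ℝ K + 1) {ζ₀ : E₁ →L[ℝ] ℝ} {w : E₁}
    (hw : ζ₀ w = 1) : ∃ L : (E × K) ≃L[ℝ] E₁ × (E₁ →L[ℝ] ℝ),
      ∀ y b, (L.symm (y, b)).2 = 0 ↔ b = b w • ζ₀ := by
  have A : E ≃L[ℝ] E₁ × ℝ := ContinuousLinearEquiv.ofFinrankEq (by simp [hE])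
  have hdual : Module.finrank ℝ (E₁ →L[ℝ] ℝ) = Module.finrank ℝ E₁ := by
    rw [← (LinearMap.toContinuousLinearMap (𝕜 := ℝ) (E := E₁) (F' := ℝ)).finrank_eq]
    simp
  have hζ₀ : ζ₀ ≠ 0 := by rintro rfl; simp at hw
  obtain ⟨B, hB⟩ := exists_continuousLinearEquiv_prod_apply_eq (E := E₁ →L[ℝ] ℝ) (E₁ := K)
    (hdual.trans hK) hζ₀
  have hkey : ∀ b, (B b).1 = 0 ↔ b = b w • ζ₀ := fun b => by
    constructor
    · intro h
      have h1 : b = (B b).2 • ζ₀ := by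
        apply B.injective
        rw [map_smul, hB]
        ext <;> simp [h]
      have h2 : b w = (B b).2 := by
        conv_lhs => rw [h1]
        simp [hw]
      rw [h2]
      exact h1
    · intro h
      rw [h, map_smul, hB]
      simp
  let L : (E × K) ≃L[ℝ] E₁ × (E₁ →L[ℝ] ℝ) := ContinuousLinearEquiv.equivOfInverse
    (((ContinuousLinearMap.fst ℝ E₁ ℝ).comp ((A : E →L[ℝ] E₁ × ℝ).comp
      (ContinuousLinearMap.fst ℝ E K))).prod
      ((B.symm : K × ℝ →L[ℝ] (E₁ →L[ℝ] ℝ)).comp ((ContinuousLinearMap.snd ℝ E K).prod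
        ((ContinuousLinearMap.snd ℝ E₁ ℝ).comp ((A : E →L[ℝ] E₁ × ℝ).comp
          (ContinuousLinearMap.fst ℝ E K))))))
    (((A.symm : E₁ × ℝ →L[ℝ] E).comp ((ContinuousLinearMap.fst ℝ E₁ (E₁ →L[ℝ] ℝ)).prod
      ((ContinuousLinearMap.snd ℝ K ℝ).comp ((B : (E₁ →L[ℝ] ℝ) →L[ℝ] K × ℝ).comp
        (ContinuousLinearMap.snd ℝ E₁ (E₁ →L[ℝ] ℝ)))))).prod
      ((ContinuousLinearMap.fst ℝ K ℝ).comp ((B : (E₁ →L[ℝ] ℝ) →L[ℝ] K × ℝ).comp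
        (ContinuousLinearMap.snd ℝ E₁ (E₁ →L[ℝ] ℝ)))))
    (fun x => by simp) (fun x => by simp)
  exact ⟨L, fun y b => hkey b⟩

/-- In the cotangent chart the fibre over `y` is the punctured line spanned by the coordinate
expression `ξ y` of a local defining form. Dividing by `ξ y w` and shearing makes the line constant;
the requirement that `w` have nonzero value excludes the zero covector. -/
theorem IsLocallyKernel.exists_isSliceChart (h𝒟 : IsLocallyKernel 𝒟)
    (hE : Module.finrank ℝ E = Module.finrank ℝ E₁ + 1)
    (hK : Module.finrank ℝ E₁ = Module.finrank ℝ K + 1) (q : CotangentBundle E₁ C)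
    (hq : LinearMap.ker (q.covector : E₁ →ₗ[ℝ] ℝ) = 𝒟 q.1) :
    ∃ (L : (E × K) ≃L[ℝ] E₁ × (E₁ →L[ℝ] ℝ))
      (e : OpenPartialHomeomorph (CotangentBundle E₁ C) (ModelProd E₁ (E₁ →L[ℝ] ℝ))),
      IsSliceChart (𝓘(ℝ, E₁).prod 𝓘(ℝ, E₁ →L[ℝ] ℝ))
        {β : CotangentBundle E₁ C | LinearMap.ker (β.covector : E₁ →ₗ[ℝ] ℝ) = 𝒟 β.1} L e ∧
      q ∈ e.source := by
  set c₀ := q.1 with hc₀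
  obtain ⟨U, η, hU, hcU, hη, hker, w₀, hw₀⟩ := h𝒟 c₀
  set k := extChartAt 𝓘(ℝ, E₁) c₀ with hk
  set ξ : E₁ → E₁ →L[ℝ] ℝ := η.inChartDual c₀ with hξ
  have hξ0 : ∀ v, ξ (k c₀) v = η.at c₀ ![v] := fun v => by
    rw [← DiffForm.inChart_self_apply]
    refine congrArg (η.inChart c₀ (k c₀)) ?_
    ext i
    fin_cases i
    rfl
  -- With this scaling `ξ (k c₀)` itself is normalised and can serve as the model line `ζ₀`.
  set w := (ξ (k c₀) w₀)⁻¹ • w₀ with hw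
  have hwξ : ξ (k c₀) w = 1 := by
    rw [hw, map_smul, smul_eq_mul, inv_mul_cancel₀]
    rwa [hξ0]
  -- the coordinate domain
  set Y₀ : Set E₁ := k.target ∩ k.symm ⁻¹' U with hY₀
  have hY₀o : IsOpen Y₀ := (continuousOn_extChartAt_symm c₀).isOpen_inter_preimage
    (isOpen_extChartAt_target c₀) hU
  have hξs : ∀ y ∈ Y₀, ContDiffAt ℝ ∞ ξ y := fun y hy => by
    have h1 := (hη _ hy.2).contDiffAt_inChart (x₀ := c₀) (k.map_target hy.1)
    rw [← hk, k.right_inv hy.1] at h1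
    exact h1.inChartDual
  have hξw : ContinuousOn (fun y => ξ y w) Y₀ := fun y hy =>
    ((ContinuousLinearMap.apply ℝ ℝ w).continuous.continuousAt.comp
      (hξs y hy).continuousAt).continuousWithinAt
  set Y : Set E₁ := Y₀ ∩ (fun y => ξ y w) ⁻¹' {0}ᶜ with hY
  have hYo : IsOpen Y := hξw.isOpen_inter_preimage hY₀o isOpen_compl_singleton
  have hyY : k c₀ ∈ Y := by
    refine ⟨⟨mem_extChartAt_target c₀, ?_⟩, ?_⟩
    · rw [Set.mem_preimage, hk, extChartAt_to_inv]
      exact hcU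
    · rw [Set.mem_preimage, hwξ]
      simp
  set ζ : E₁ → E₁ →L[ℝ] ℝ := fun y => (ξ y w)⁻¹ • ξ y with hζ
  have hζw : ∀ y ∈ Y, ζ y w = 1 := fun y hy => by
    simp only [hζ, _root_.smul_apply, smul_eq_mul]
    exact inv_mul_cancel₀ hy.2
  have hζs : ContDiffOn ℝ ∞ ζ Y := fun y hy => by
    have h1 : ContDiffAt ℝ ∞ (fun y => ξ y w) y :=
      (ContinuousLinearMap.apply ℝ ℝ w).contDiff.contDiffAt.comp y (hξs y hy.1)
    exact ((h1.inv hy.2).smul (hξs y hy.1)).contDiffWithinAt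
  set ζ₀ := ξ (k c₀) with hζ₀
  obtain ⟨L, hL⟩ := exists_sliceEquiv (E := E) (K := K) hE hK hwξ
  set sh := shear Y hYo w ζ ζ₀ hζs.continuousOn hζw hwξ with hsh
  -- membership in the fibres
  have hfib : ∀ β : CotangentBundle E₁ C, β.1 ∈ (chartAt E₁ c₀).source → k β.1 ∈ Y →
      (LinearMap.ker (β.covector : E₁ →ₗ[ℝ] ℝ) = 𝒟 β.1 ↔
        LinearMap.ker ((β.covector.comp (chartSymmDeriv E₁ c₀ (k β.1)) : E₁ →L[ℝ] ℝ) :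
          E₁ →ₗ[ℝ] ℝ) = LinearMap.ker (ξ (k β.1) : E₁ →ₗ[ℝ] ℝ)) := fun β hβ hβY => by
    have hβs : β.1 ∈ k.source := by rwa [hk, extChartAt_source]
    have hkβ : k.symm (k β.1) = β.1 := k.left_inv hβs
    have hU' : β.1 ∈ U := by rw [← hkβ]; exact hβY.1.2
    -- The chart derivative is onto, so equality of subspaces may be tested after pulling them back
    -- to coordinates.
    have hinj := Submodule.comap_injective_of_surjective
      (f := (chartSymmDeriv E₁ c₀ (k β.1) : E₁ →ₗ[ℝ] E₁))
      (chartSymmDeriv_surjective (k.map_source hβs))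
    have h1 : LinearMap.ker (ξ (k β.1) : E₁ →ₗ[ℝ] ℝ) =
        Submodule.comap (chartSymmDeriv E₁ c₀ (k β.1) : E₁ →ₗ[ℝ] E₁) (𝒟 β.1) := by
      rw [← hker _ hU']
      ext v
      refine Iff.trans ?_ mem_formKer.symm
      change ξ (k β.1) v = 0 ↔ η.at β.1 ![chartSymmDeriv E₁ c₀ (k β.1) v] = 0
      rw [hξ, DiffForm.inChartDual_apply, ← hk, hkβ]
    rw [h1]
    exact hinj.eq_iff.symm
  have hqs : q.1 ∈ (chartAt E₁ c₀).source := mem_chart_source E₁ c₀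
  refine ⟨L, (chartAt _ q).trans sh, ⟨OpenPartialHomeomorph.trans_mem_maximalAtlas
    (IsManifold.chart_mem_maximalAtlas q) (shear_mem_contDiffGroupoid hζs hζw hwξ), ?_⟩, ?_⟩
  · intro β hβ
    rw [OpenPartialHomeomorph.trans_source] at hβ
    obtain ⟨hβ1, hβ2⟩ := hβ
    have hβs : β.1 ∈ (chartAt E₁ c₀).source := CotangentBundle.mem_chartAt_source.1 hβ1
    have happ := CotangentBundle.chartAt_apply (β₀ := q) hβs
    set b := β.covector.comp (chartSymmDeriv E₁ c₀ (k β.1)) with hb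
    have hβ3 : k β.1 ∈ Y ∧ b w ≠ 0 := by
      have : chartAt (ModelProd E₁ (E₁ →L[ℝ] ℝ)) q β ∈ sh.source := hβ2
      rw [happ] at this
      exact this
    have hext : ((chartAt (ModelProd E₁ (E₁ →L[ℝ] ℝ)) q).trans sh).extend
        (𝓘(ℝ, E₁).prod 𝓘(ℝ, E₁ →L[ℝ] ℝ)) β = (k β.1, b - b w • (ζ (k β.1) - ζ₀)) := by
      change sh (chartAt (ModelProd E₁ (E₁ →L[ℝ] ℝ)) q β) = _
      rw [happ]
      rfl
    refine (hfib β hβs hβ3.1).trans ?_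
    rw [hext, hL, ContinuousLinearMap.ker_eq_ker_iff_eq_smul hβ3.2 hβ3.1.2]
    have h1 : (b - b w • (ζ (k β.1) - ζ₀)) w = b w := by
      simp [hζw _ hβ3.1, hwξ]
    rw [h1, smul_sub, sub_sub_eq_add_sub, sub_eq_iff_eq_add, add_comm, add_right_inj]
    simp only [hζ, smul_smul, div_eq_mul_inv]
  · rw [OpenPartialHomeomorph.trans_source]
    refine ⟨mem_chart_source _ q, ?_⟩
    have happ := CotangentBundle.chartAt_apply (β₀ := q) hqs
    change chartAt (ModelProd E₁ (E₁ →L[ℝ] ℝ)) q q ∈ sh.source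
    rw [happ]
    refine ⟨hyY, fun hb => ?_⟩
    have h1 := (hfib q hqs hyY).1 hq
    have h2 : w ∈ LinearMap.ker (ξ (k c₀) : E₁ →ₗ[ℝ] ℝ) := h1 ▸ hb
    have h3 : ξ (k c₀) w = 0 := h2
    rw [hwξ] at h3
    exact one_ne_zero h3

theorem IsLocallyKernel.exists_chartedSpace (h𝒟 : IsLocallyKernel 𝒟)
    (hE : Module.finrank ℝ E = Module.finrank ℝ E₁ + 1)
    (hK : Module.finrank ℝ E₁ = Module.finrank ℝ K + 1) :
    ∃ _ : ChartedSpace E (Symplectification 𝒟), IsManifold 𝓘(ℝ, E) ∞ (Symplectification 𝒟) ∧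
      Manifold.IsSmoothEmbedding 𝓘(ℝ, E) (𝓘(ℝ, E₁).prod 𝓘(ℝ, E₁ →L[ℝ] ℝ)) ∞
        (Subtype.val : Symplectification 𝒟 → CotangentBundle E₁ C) :=
  exists_chartedSpace_of_isSliceChart (E := E) (K := K)
    (I := 𝓘(ℝ, E₁).prod 𝓘(ℝ, E₁ →L[ℝ] ℝ))
    (S := {β : CotangentBundle E₁ C | LinearMap.ker (β.covector : E₁ →ₗ[ℝ] ℝ) = 𝒟 β.1})
    fun q hq => h𝒟.exists_isSliceChart hE hK q hq

end SymplectificationCharts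

/-! ### Transfer of symplectic primitives along local diffeomorphisms. -/

section LocalDiffeomorphisms

variable {E : Type*} [NormedAddCommGroup E] [NormedSpace ℝ E]
  {E' : Type*} [NormedAddCommGroup E'] [NormedSpace ℝ E']
  {M : Type*} [TopologicalSpace M] [ChartedSpace E M] [IsManifold 𝓘(ℝ, E) ∞ M]
  {N : Type*} [TopologicalSpace N] [ChartedSpace E' N] [IsManifold 𝓘(ℝ, E') ∞ N] {k : ℕ}

theorem DiffForm.SmoothAt.const_smul {α : DiffForm E M k} {x : M} (hα : α.SmoothAt x) (c : ℝ) :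
    (c • α).SmoothAt x :=
  ContDiffAt.const_smul (R := ℝ) c hα

theorem DiffForm.d_const_smul (α : DiffForm E M k) (c : ℝ) : (c • α).d = c • α.d := by
  funext x
  ext v
  exact DFunLike.congr_fun (extDeriv_smul (x := extChartAt 𝓘(ℝ, E) x x) c (α.inChart x)) _

theorem DiffForm.IsSymplectic.const_smul [FiniteDimensional ℝ E] {Ω : DiffForm E M 2}
    (hΩ : Ω.IsSymplectic) {c : ℝ}
    (hc : c ≠ 0) : (c • Ω).IsSymplectic where
  smooth := (DiffForm.smoothOn_iff isOpen_univ).2 fun x hx =>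
    ((DiffForm.smoothOn_iff isOpen_univ).1 hΩ.smooth x hx).const_smul c
  closed := fun x => by
    rw [DiffForm.d_const_smul, Pi.smul_apply, hΩ.closed, smul_zero]
  nondegenerate := fun x v h => hΩ.nondegenerate x v fun w =>
    (mul_eq_zero.1 (h w)).resolve_left hc

/-- A form that pulls back to `α` under a local diffeomorphism is, near the image point, the
pullback of `α` under a smooth local inverse. -/
theorem IsLocalDiffeomorphAt.exists_eq_pullback {F : M → N} {m : M}
    (hF : IsLocalDiffeomorphAt 𝓘(ℝ, E) 𝓘(ℝ, E') ∞ F m) {β : DiffForm E' N k} {α : DiffForm E M k}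
    (h : DiffForm.pullback F β = α) :
    ∃ (V : Set N) (G : N → M), IsOpen V ∧ F m ∈ V ∧
      (∀ y ∈ V, ContMDiffAt 𝓘(ℝ, E') 𝓘(ℝ, E) ∞ G y) ∧
      (∀ y ∈ V, ContMDiffAt 𝓘(ℝ, E) 𝓘(ℝ, E') ∞ F (G y)) ∧
      (∀ y ∈ V, F (G y) = y) ∧ (∀ y ∈ V, G ∘ F =ᶠ[𝓝 (G y)] id) ∧
      ∀ y ∈ V, β y = DiffForm.pullback (E := E') G α y := by
  obtain ⟨Φ, hm, hΦ⟩ := hF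
  have hG : ∀ y ∈ Φ.target, ContMDiffAt 𝓘(ℝ, E') 𝓘(ℝ, E) ∞ Φ.invFun y := fun y hy =>
    Φ.contMDiffOn_invFun.contMDiffAt (Φ.open_target.mem_nhds hy)
  have hFΦ : ∀ x ∈ Φ.source, F =ᶠ[𝓝 x] Φ.toFun := fun x hx => by
    filter_upwards [Φ.open_source.mem_nhds hx] with x' hx' using hΦ hx'
  have hFs : ∀ y ∈ Φ.target, ContMDiffAt 𝓘(ℝ, E) 𝓘(ℝ, E') ∞ F (Φ.invFun y) := fun y hy =>
    (Φ.contMDiffOn_toFun.contMDiffAt (Φ.open_source.mem_nhds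
      (Φ.map_target' hy))).congr_of_eventuallyEq (hFΦ _ (Φ.map_target' hy))
  have hFG : ∀ y ∈ Φ.target, F (Φ.invFun y) = y := fun y hy =>
    (hΦ (Φ.map_target' hy)).trans (Φ.right_inv' hy)
  refine ⟨Φ.target, Φ.invFun, Φ.open_target, hΦ hm ▸ Φ.map_source' hm, hG, hFs, hFG,
    fun y hy => ?_, fun y hy => ?_⟩
  · filter_upwards [Φ.open_source.mem_nhds (Φ.map_target' hy)] with x hx
    change Φ.invFun (F x) = x
    rw [hΦ hx]
    exact Φ.left_inv' hx
  · subst h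
    have h1 : F ∘ Φ.invFun =ᶠ[𝓝 y] id := by
      filter_upwards [Φ.open_target.mem_nhds hy] with z hz using hFG z hz
    rw [DiffForm.pullback_pullback β ((hFs y hy).mdifferentiableAt (by simp))
      ((hG y hy).mdifferentiableAt (by simp)), DiffForm.pullback_congr β h1, DiffForm.pullback_id]

variable [FiniteDimensional ℝ E] [FiniteDimensional ℝ E']

/-- A `1`-form is the primitive of a symplectic form if locally it pulls back to such forms under
local diffeomorphisms onto. -/
theorem DiffForm.smoothOn_and_isSymplectic_d_of_pullback {β : DiffForm E' N 1}
    (h : ∀ y : N, ∃ (F : M → N) (m : M), F m = y ∧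
      IsLocalDiffeomorphAt 𝓘(ℝ, E) 𝓘(ℝ, E') ∞ F m ∧
      (∀ x, (DiffForm.pullback (E := E) F β).SmoothAt x) ∧
      (DiffForm.pullback (E := E) F β).d.IsSymplectic) :
    β.SmoothOn Set.univ ∧ β.d.IsSymplectic := by
  have hs : ∀ y, β.SmoothAt y := fun y => by
    obtain ⟨F, m, rfl, hF, hα, -⟩ := h y
    obtain ⟨V, G, hV, hm, hG, -, -, -, hβ⟩ := hF.exists_eq_pullback (β := β) rfl
    refine ((hα (G (F m))).pullback (hG _ hm)).congr ?_
    filter_upwards [hV.mem_nhds hm] with z hz using hβ z hz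
  have hd : ∀ y, ∃ (V : Set N) (G : N → M) (F : M → N), IsOpen V ∧ y ∈ V ∧
      (∀ y ∈ V, ContMDiffAt 𝓘(ℝ, E') 𝓘(ℝ, E) ∞ G y) ∧
      ContMDiffAt 𝓘(ℝ, E) 𝓘(ℝ, E') ∞ F (G y) ∧ F (G y) = y ∧ F ∘ G =ᶠ[𝓝 y] id ∧
      G ∘ F =ᶠ[𝓝 (G y)] id ∧
      ∃ α : DiffForm E M 1, α.d.IsSymplectic ∧
        ∀ y ∈ V, β.d y = DiffForm.pullback (E := E') G α.d y := fun y => by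
    obtain ⟨F, m, rfl, hF, hα, hα'⟩ := h y
    obtain ⟨V, G, hV, hm, hG, hFs, hFG, hGF, hβ⟩ := hF.exists_eq_pullback (β := β) rfl
    refine ⟨V, G, F, hV, hm, hG, hFs _ hm, hFG _ hm, ?_, hGF _ hm, _, hα', fun y hy => ?_⟩
    · filter_upwards [hV.mem_nhds hm] with z hz using hFG z hz
    · rw [← DiffForm.d_pullback (hα (G y)) (hG y hy)]
      refine DiffForm.d_congr ?_
      filter_upwards [hV.mem_nhds hy] with z hz using hβ z hz
  refine ⟨(DiffForm.smoothOn_iff isOpen_univ).2 fun y _ => hs y,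
    (DiffForm.smoothOn_iff isOpen_univ).2 fun y _ => ?_, fun y => ?_, fun y v hv => ?_⟩
  · obtain ⟨V, G, F, hV, hy, hG, -, -, -, -, α, hα, hβ⟩ := hd y
    refine DiffForm.SmoothAt.congr (α := DiffForm.pullback (E := E') G α.d)
      (DiffForm.SmoothAt.pullback ((DiffForm.smoothOn_iff isOpen_univ).1 hα.smooth _ trivial) (hG y hy)) ?_
    filter_upwards [hV.mem_nhds hy] with z hz using hβ z hz
  · obtain ⟨V, G, F, hV, hy, hG, -, -, -, -, α, hα, hβ⟩ := hd y
    have h1 : ∀ᶠ z in 𝓝 y, β.d z = DiffForm.pullback (E := E') G α.d z := by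
      filter_upwards [hV.mem_nhds hy] with z hz using hβ z hz
    rw [DiffForm.d_congr h1, DiffForm.d_pullback
      ((DiffForm.smoothOn_iff isOpen_univ).1 hα.smooth _ trivial) (hG y hy)]
    ext v
    rw [DiffForm.pullback_apply, hα.closed]
    rfl
  · obtain ⟨V, G, F, hV, hy, hG, hFs, hFGy, hFG, hGF, α, hα, hβ⟩ := hd y
    set A : E' →L[ℝ] E := mfderiv 𝓘(ℝ, E') 𝓘(ℝ, E) G y with hA
    set B : E →L[ℝ] E' := mfderiv 𝓘(ℝ, E) 𝓘(ℝ, E') F (G y) with hB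
    have hGd := (hG y hy).mdifferentiableAt (by simp)
    have hFd := hFs.mdifferentiableAt (by simp)
    -- The derivatives of `F` and of its local inverse `G` are mutually inverse, so nondegeneracy
    -- passes from `α.d` to `β.d`.
    have hBA : ∀ u : E', B (A u) = u := fun u => by
      have h1 := mfderiv_comp_apply y hFd hGd u
      have h2 : (mfderiv 𝓘(ℝ, E') 𝓘(ℝ, E') (F ∘ G) y : E' →L[ℝ] E') =
        mfderiv 𝓘(ℝ, E') 𝓘(ℝ, E') id y := hFG.mfderiv_eq
      rw [mfderiv_id] at h2
      exact h1.symm.trans (congrArg (fun l : E' →L[ℝ] E' => l u) h2)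
    have hAB : ∀ u : E, A (B u) = u := fun u => by
      have hGd' : MDifferentiableAt 𝓘(ℝ, E') 𝓘(ℝ, E) G (F (G y)) := by rwa [hFGy]
      have h1 := mfderiv_comp_apply (G y) hGd' hFd u
      have h2 : (mfderiv 𝓘(ℝ, E) 𝓘(ℝ, E) (G ∘ F) (G y) : E →L[ℝ] E) =
        mfderiv 𝓘(ℝ, E) 𝓘(ℝ, E) id (G y) := hGF.mfderiv_eq
      rw [mfderiv_id] at h2
      have h3 : ∀ q, q = y → (mfderiv 𝓘(ℝ, E') 𝓘(ℝ, E) G q : E' →L[ℝ] E) = A := by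
        rintro q rfl
        rfl
      exact (congrArg (fun l : E' →L[ℝ] E => l (B u)) (h3 _ hFGy)).symm.trans
        (h1.symm.trans (congrArg (fun l : E →L[ℝ] E => l u) h2))
    have h1 : A v = 0 := hα.nondegenerate (G y) (A v) fun w => by
      have h2 := hv (B w)
      rw [hβ y hy, DiffForm.pullback_apply] at h2
      refine Eq.trans (α.d.apply_congr rfl ?_) h2
      funext i
      fin_cases i
      · rfl
      · exact (hAB w).symm
    have h2 : B (A v) = v := hBA v
    rw [← h2, h1]
    exact map_zero B

end LocalDiffeomorphisms

/-! ### Smooth maps into and out of the cotangent bundle. -/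

section CotangentMaps

variable {E : Type*} [NormedAddCommGroup E] [NormedSpace ℝ E]
  {C : Type*} [TopologicalSpace C] [ChartedSpace E C] [IsManifold 𝓘(ℝ, E) ∞ C]
  {E' : Type*} [NormedAddCommGroup E'] [NormedSpace ℝ E']
  {H : Type*} [TopologicalSpace H] {J : ModelWithCorners ℝ E' H}
  {N : Type*} [TopologicalSpace N] [ChartedSpace H N]

theorem CotangentBundle.ext {β γ : CotangentBundle E C} (h : β.1 = γ.1)
    (h' : β.covector = γ.covector) : β = γ := by
  obtain ⟨c, b⟩ := β
  obtain ⟨c', b'⟩ := γ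
  obtain rfl : c = c' := h
  exact congrArg (Bundle.TotalSpace.mk c) h'

/-- The centre `c₀` is any point whose chart contains the base point, so one fixed chart can test
smoothness on a whole neighbourhood. -/
theorem CotangentBundle.contMDiffAt_iff {f : N → CotangentBundle E C} {x : N} {c₀ : C}
    (hx : (f x).1 ∈ (chartAt E c₀).source) :
    ContMDiffAt J (𝓘(ℝ, E).prod 𝓘(ℝ, E →L[ℝ] ℝ)) ∞ f x ↔
      ContMDiffAt J 𝓘(ℝ, E) ∞ (fun y => (f y).1) x ∧
      ContMDiffAt J 𝓘(ℝ, E →L[ℝ] ℝ) ∞ (fun y => (f y).covector.comp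
        (chartSymmDeriv E c₀ (extChartAt 𝓘(ℝ, E) c₀ (f y).1))) x := by
  set β₀ : CotangentBundle E C := ⟨c₀, 0⟩
  have hx' := CotangentBundle.mem_chartAt_source (β₀ := β₀).2 hx
  rw [FiberBundle.chartedSpace_chartAt] at hx'
  rw [(trivializationAt (E →L[ℝ] ℝ) (fun c : C => TangentSpace 𝓘(ℝ, E) c →L[ℝ] ℝ)
    c₀).contMDiffAt_iff hx'.1]
  refine and_congr_right fun h => Filter.EventuallyEq.contMDiffAt_iff ?_
  filter_upwards [h.continuousAt.eventually ((chartAt E c₀).open_source.mem_nhds hx)] with y hy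
  have h1 := CotangentBundle.chartAt_apply (β₀ := β₀) (β := f y) hy
  rw [FiberBundle.chartedSpace_chartAt] at h1
  exact congrArg Prod.snd h1

theorem CotangentBundle.contMDiff_proj : ContMDiff (𝓘(ℝ, E).prod 𝓘(ℝ, E →L[ℝ] ℝ)) 𝓘(ℝ, E) ∞
    (fun β : CotangentBundle E C => β.1) :=
  Bundle.contMDiff_proj (fun c : C => TangentSpace 𝓘(ℝ, E) c →L[ℝ] ℝ)

theorem CotangentBundle.contMDiffAt_covector_comp {β : CotangentBundle E C} {c₀ : C}
    (hβ : β.1 ∈ (chartAt E c₀).source) :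
    ContMDiffAt (𝓘(ℝ, E).prod 𝓘(ℝ, E →L[ℝ] ℝ)) 𝓘(ℝ, E →L[ℝ] ℝ) ∞
      (fun γ : CotangentBundle E C => γ.covector.comp
        (chartSymmDeriv E c₀ (extChartAt 𝓘(ℝ, E) c₀ γ.1))) β :=
  ((CotangentBundle.contMDiffAt_iff (f := id) hβ).1 contMDiffAt_id).2

theorem DiffForm.inChartDual_extChartAt (η : DiffForm E C 1) {c₀ c : C}
    (hc : c ∈ (chartAt E c₀).source) (v : E) :
    η.inChartDual c₀ (extChartAt 𝓘(ℝ, E) c₀ c) v =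
      η.at c ![chartSymmDeriv E c₀ (extChartAt 𝓘(ℝ, E) c₀ c) v] := by
  rw [DiffForm.inChartDual_apply, (extChartAt 𝓘(ℝ, E) c₀).left_inv (by simpa using hc)]

theorem DiffForm.SmoothAt.contMDiffAt_inChartDual [FiniteDimensional ℝ E] {η : DiffForm E C 1}
    {c₀ c : C} (hη : η.SmoothAt c) (hc : c ∈ (chartAt E c₀).source) :
    ContMDiffAt 𝓘(ℝ, E) 𝓘(ℝ, E →L[ℝ] ℝ) ∞
      (fun y => η.inChartDual c₀ (extChartAt 𝓘(ℝ, E) c₀ y)) c :=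
  (ContDiffAt.inChartDual (hη.contDiffAt_inChart (by simpa using hc))).contMDiffAt.comp c
    (contMDiffAt_extChartAt' hc)

end CotangentMaps

/-! ### The map to the symplectification. -/

section SymplectificationMap

variable {E : Type*} [NormedAddCommGroup E] [NormedSpace ℝ E]
  {E₁ : Type*} [NormedAddCommGroup E₁] [NormedSpace ℝ E₁]
  {M : Type*} [TopologicalSpace M] [ChartedSpace E M]
  {Ω : DiffForm E M 2} {D : (x : M) → TangentSpace 𝓘(ℝ, E) x} {φ : Flow ℝ M}
  [ChartedSpace E₁ (OrbitSpace φ)]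

namespace IsReduction

variable [IsManifold 𝓘(ℝ, E) ∞ M] [IsManifold 𝓘(ℝ, E₁) ∞ (OrbitSpace φ)]
  [FiniteDimensional ℝ E] [FiniteDimensional ℝ E₁] (H : IsReduction E₁ Ω D φ)

include H

theorem isLocallyKernel_reducedDistribution : IsLocallyKernel (reducedDistribution E₁ Ω D φ) := by
  intro c
  obtain ⟨U, σ, hσ, hc, -⟩ := H.exists_section c.out
  rw [OrbitSpace.proj_out] at hc
  refine ⟨U, DiffForm.pullback (E := E₁) σ (DiffForm.interior D Ω), hσ.isOpen, hc,
    fun y hy => H.smoothAt_pullback_interior hσ hy, fun y hy => ?_, ?_⟩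
  · ext u
    refine Iff.trans ?_ (H.mem_reducedDistribution (hσ.apply_eq y hy)).symm
    exact mem_formKer.trans (Eq.congr (H.pullback_interior_apply hσ hy u) rfl)
  · obtain ⟨w, hw⟩ := DFunLike.ne_iff.1 (H.reducedCovector_ne_zero (σ c))
    exact ⟨w, by rwa [H.pullback_interior_apply hσ hc]⟩

theorem exists_mem_reducedConformalClass (m : M) :
    ∃ B ∈ reducedConformalClass E₁ Ω D φ (OrbitSpace.proj φ m),
      ∀ (u₁ u₂ : reducedDistribution E₁ Ω D φ (OrbitSpace.proj φ m)) (v₁ v₂ : E),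
        Ω.at m ![vectorAt D m, v₁] = 0 → Ω.at m ![vectorAt D m, v₂] = 0 →
        orbitDeriv E E₁ φ m v₁ = (u₁ : TangentSpace 𝓘(ℝ, E₁) (OrbitSpace.proj φ m)) →
        orbitDeriv E E₁ φ m v₂ = (u₂ : TangentSpace 𝓘(ℝ, E₁) (OrbitSpace.proj φ m)) →
        B u₁ u₂ = Ω.at m ![v₁, v₂] := by
  obtain ⟨U, σ, hσ, hc, hσm⟩ := H.exists_section m
  rw [H.reducedConformalClass_eq hσ hc]
  refine ⟨_, ⟨1, one_ne_zero, rfl⟩, ?_⟩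
  have key : ∀ m', σ (OrbitSpace.proj φ m) = m' → ∀ (u₁ u₂ : E₁) (v₁ v₂ : E),
      Ω.at m' ![vectorAt D m', v₁] = 0 → Ω.at m' ![vectorAt D m', v₂] = 0 →
      orbitDeriv E E₁ φ m' v₁ = u₁ → orbitDeriv E E₁ φ m' v₂ = u₂ →
      (DiffForm.pullback (E := E₁) σ Ω).at (OrbitSpace.proj φ m) ![u₁, u₂] =
        Ω.at m' ![v₁, v₂] := by
    rintro _ rfl u₁ u₂ v₁ v₂ h₁ h₂ e₁ e₂
    rw [H.pullback_form_apply hσ hc]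
    exact (pair_eq_of_lifts (H.exists_smul_of_orbitDeriv_eq_zero _) h₁ h₂
      (e₁.trans (H.orbitDeriv_sectionDeriv hσ hc _).symm)
      (e₂.trans (H.orbitDeriv_sectionDeriv hσ hc _).symm)).symm
  intro u₁ u₂ v₁ v₂ h₁ h₂ e₁ e₂
  exact (one_mul _).trans (key m hσm _ _ v₁ v₂ h₁ h₂ e₁ e₂)

theorem exists_flow_section {U : Set (OrbitSpace φ)} {σ : OrbitSpace φ → M}
    (hσ : IsSectionOn (E := E) (E₁ := E₁) (OrbitSpace.proj φ) U σ) {m : M}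
    (hm : OrbitSpace.proj φ m ∈ U) : ∃ t, φ t (σ (OrbitSpace.proj φ m)) = m :=
  (OrbitSpace.proj_eq_iff φ).1 (hσ.apply_eq _ hm)

theorem contMDiffAt_reducedCovector_section {U : Set (OrbitSpace φ)} {σ : OrbitSpace φ → M}
    (hσ : IsSectionOn (E := E) (E₁ := E₁) (OrbitSpace.proj φ) U σ) {c c₀ : OrbitSpace φ}
    (hc : c ∈ U) (hc₀ : c ∈ (chartAt E₁ c₀).source) :
    ContMDiffAt 𝓘(ℝ, E₁) 𝓘(ℝ, E₁ →L[ℝ] ℝ) ∞ (fun y => (reducedCovector E₁ Ω D φ (σ y)).comp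
      (chartSymmDeriv E₁ c₀ (extChartAt 𝓘(ℝ, E₁) c₀ y))) c := by
  refine ((H.smoothAt_pullback_interior hσ hc).contMDiffAt_inChartDual
    hc₀).congr_of_eventuallyEq ?_
  filter_upwards [hσ.isOpen.mem_nhds hc, (chartAt E₁ c₀).open_source.mem_nhds hc₀] with y hy hy₀
  ext v
  exact ((DiffForm.inChartDual_extChartAt _ hy₀ v).trans (H.pullback_interior_apply hσ hy _)).symm

/-- The map `m ↦ (π m, reducedCovector m)` to the cotangent bundle is smooth, as are its
multiples by constants. -/
theorem contMDiff_reducedCovector (ε : ℝ) :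
    ContMDiff 𝓘(ℝ, E) (𝓘(ℝ, E₁).prod 𝓘(ℝ, E₁ →L[ℝ] ℝ)) ∞
      (fun m => (⟨OrbitSpace.proj φ m, ε • reducedCovector E₁ Ω D φ m⟩ :
        CotangentBundle E₁ (OrbitSpace φ))) := by
  intro m₀
  obtain ⟨U, σ, hσ, hc₀, hσm⟩ := H.exists_section m₀
  set c₀ := OrbitSpace.proj φ m₀ with hc
  refine (CotangentBundle.contMDiffAt_iff (mem_chart_source E₁ c₀)).2 ⟨H.contMDiff_proj m₀, ?_⟩
  -- On `M` both `λ` and `mu = π^* σ^* λ` are smooth and `λ = e^t mu`, where `t` is the time from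
  -- the section to `m`. Their ratio at a coordinate vector `X` with `mu(X) ≠ 0` shows that `e^t` is
  -- smooth without differentiating `t`.
  set lam := DiffForm.interior D Ω
  set mu : DiffForm E M 1 := DiffForm.pullback (E := E) (OrbitSpace.proj φ)
    (DiffForm.pullback (E := E₁) σ lam)
  have hmu : ∀ m, OrbitSpace.proj φ m ∈ U → ∀ v : E, mu.at m ![v] =
      reducedCovector E₁ Ω D φ (σ (OrbitSpace.proj φ m)) (orbitDeriv E E₁ φ m v) := fun m hm v => by
    refine Eq.trans ?_ (H.pullback_interior_apply hσ hm _)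
    refine congrArg ((DiffForm.pullback (E := E₁) σ lam).at (OrbitSpace.proj φ m)) ?_
    ext i
    fin_cases i
    rfl
  have hlam : ∀ m, ∀ v : E, lam.at m ![v] =
      reducedCovector E₁ Ω D φ m (orbitDeriv E E₁ φ m v) := fun m v =>
    (H.reducedCovector_apply m v).symm
  have hmus : mu.SmoothAt m₀ :=
    (H.smoothAt_pullback_interior hσ hc₀).pullback (H.contMDiff_proj m₀)
  set k := extChartAt 𝓘(ℝ, E) m₀
  have hX : ∃ X : E, mu.inChartDual m₀ (k m₀) X ≠ 0 := by
    obtain ⟨u, hu⟩ := DFunLike.ne_iff.1 (H.reducedCovector_ne_zero m₀)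
    obtain ⟨v, rfl⟩ := H.orbitDeriv_surjective m₀ u
    obtain ⟨X, rfl⟩ := chartSymmDeriv_surjective (mem_extChartAt_target (I := 𝓘(ℝ, E)) m₀) v
    refine ⟨X, ?_⟩
    rw [DiffForm.inChartDual_extChartAt _ (mem_chart_source E m₀), hmu m₀ hc₀, ← hc, hσm]
    exact hu
  obtain ⟨X, hX⟩ := hX
  have h1 : ContMDiffAt 𝓘(ℝ, E) 𝓘(ℝ, ℝ) ∞ (fun m => mu.inChartDual m₀ (k m) X) m₀ :=
    (hmus.contMDiffAt_inChartDual (mem_chart_source E m₀)).clm_apply contMDiffAt_const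
  have h2 : ContMDiffAt 𝓘(ℝ, E) 𝓘(ℝ, ℝ) ∞ (fun m => lam.inChartDual m₀ (k m) X) m₀ :=
    ((H.smoothAt_interior m₀).contMDiffAt_inChartDual (mem_chart_source E m₀)).clm_apply
      contMDiffAt_const
  have h3 := (H.contMDiffAt_reducedCovector_section hσ hc₀ (mem_chart_source E₁ c₀)).comp m₀
    (H.contMDiff_proj m₀)
  have h4 : ContMDiffAt 𝓘(ℝ, E) 𝓘(ℝ, ℝ) ∞
      (fun m => ε * (lam.inChartDual m₀ (k m) X / mu.inChartDual m₀ (k m) X)) m₀ :=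
    contMDiffAt_const.mul (h2.div₀ h1 hX)
  refine (h4.smul h3).congr_of_eventuallyEq ?_
  filter_upwards [h1.continuousAt.eventually_ne hX, (chartAt E m₀).open_source.mem_nhds
    (mem_chart_source E m₀), (H.contMDiff_proj m₀).continuousAt.eventually
    (hσ.isOpen.mem_nhds hc₀)] with m hm1 hm2 hm3
  obtain ⟨t, ht⟩ := H.exists_flow_section hσ hm3
  have h5 : reducedCovector E₁ Ω D φ m =
      Real.exp t • reducedCovector E₁ Ω D φ (σ (OrbitSpace.proj φ m)) := by
    conv_lhs => rw [← ht]
    exact H.reducedCovector_map t _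
  have h6 : lam.inChartDual m₀ (k m) X / mu.inChartDual m₀ (k m) X = Real.exp t := by
    rw [div_eq_iff hm1, DiffForm.inChartDual_extChartAt _ hm2,
      DiffForm.inChartDual_extChartAt _ hm2, hmu m hm3, hlam, h5]
    rfl
  have h7 : ∀ A : E₁ →L[ℝ] E₁, (ε • reducedCovector E₁ Ω D φ m).comp A =
      (ε * (lam.inChartDual m₀ (k m) X / mu.inChartDual m₀ (k m) X)) •
        (reducedCovector E₁ Ω D φ (σ (OrbitSpace.proj φ m))).comp A := fun A => by
    rw [h6, h5, smul_smul]
    rfl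
  exact h7 _

theorem ker_smul_reducedCovector {ε : ℝ} (hε : ε ≠ 0) (m : M) :
    LinearMap.ker ((ε • reducedCovector E₁ Ω D φ m : E₁ →L[ℝ] ℝ) : E₁ →ₗ[ℝ] ℝ) =
      reducedDistribution E₁ Ω D φ (OrbitSpace.proj φ m) := by
  ext u
  refine Iff.trans ?_ (H.mem_reducedDistribution rfl).symm
  change ε * reducedCovector E₁ Ω D φ m u = 0 ↔ _
  exact mul_eq_zero.trans (or_iff_right hε)

/-- The map from `M` to the symplectification of its reduction given by a multiple of the reduced
covector. -/
def symplectificationMap {ε : ℝ} (hε : ε ≠ 0) (m : M) :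
    Symplectification (reducedDistribution E₁ Ω D φ) :=
  ⟨⟨OrbitSpace.proj φ m, ε • reducedCovector E₁ Ω D φ m⟩, H.ker_smul_reducedCovector hε m⟩

theorem exists_covector_eq_smul (β : Symplectification (reducedDistribution E₁ Ω D φ)) {m : M}
    (hm : OrbitSpace.proj φ m = β.1.1) {w : E₁} (hw : reducedCovector E₁ Ω D φ m w ≠ 0) :
    β.1.covector w ≠ 0 ∧ β.1.covector =
      (β.1.covector w / reducedCovector E₁ Ω D φ m w) • reducedCovector E₁ Ω D φ m := by
  have h1 : LinearMap.ker (β.1.covector : E₁ →ₗ[ℝ] ℝ) =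
      LinearMap.ker (reducedCovector E₁ Ω D φ m : E₁ →ₗ[ℝ] ℝ) :=
    β.2.trans (H.reducedDistribution_eq hm)
  have h2 : β.1.covector w ≠ 0 := fun h => by
    have : w ∈ LinearMap.ker (β.1.covector : E₁ →ₗ[ℝ] ℝ) := h
    rw [h1] at this
    exact hw this
  exact ⟨h2, (ContinuousLinearMap.ker_eq_ker_iff_eq_smul h2 hw).1 h1⟩

/-- With `ε = 1` only positive multiples along an orbit occur, which is half of each fibre; a free
nonzero `ε` reaches the other half. -/
theorem exists_symplectificationMap_eq (β : Symplectification (reducedDistribution E₁ Ω D φ)) :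
    ∃ (ε : ℝ) (hε : ε ≠ 0) (m : M), H.symplectificationMap hε m = β := by
  obtain ⟨w, hw⟩ := DFunLike.ne_iff.1 (H.reducedCovector_ne_zero β.1.1.out)
  obtain ⟨h1, h2⟩ := H.exists_covector_eq_smul β (OrbitSpace.proj_out φ _) hw
  exact ⟨_, div_ne_zero h1 hw, β.1.1.out,
    Subtype.ext (CotangentBundle.ext (OrbitSpace.proj_out φ _) h2.symm)⟩

variable [ChartedSpace E (Symplectification (reducedDistribution E₁ Ω D φ))]
  [IsManifold 𝓘(ℝ, E) ∞ (Symplectification (reducedDistribution E₁ Ω D φ))]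
  (hemb : Manifold.IsSmoothEmbedding 𝓘(ℝ, E) (𝓘(ℝ, E₁).prod 𝓘(ℝ, E₁ →L[ℝ] ℝ)) ∞
    (Subtype.val : Symplectification (reducedDistribution E₁ Ω D φ) →
      CotangentBundle E₁ (OrbitSpace φ)))

include hemb

theorem contMDiff_symplectificationMap {ε : ℝ} (hε : ε ≠ 0) :
    ContMDiff 𝓘(ℝ, E) 𝓘(ℝ, E) ∞ (H.symplectificationMap hε) := fun m =>
  (ContMDiffAt.iff_comp_isImmersionAt (hemb.isImmersion.isImmersionAt _)).2
    ⟨(hemb.isEmbedding.continuous_iff.2 (H.contMDiff_reducedCovector ε).continuous).continuousAt,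
      H.contMDiff_reducedCovector ε m⟩

omit H in
theorem contMDiff_symplectification_val :
    ContMDiff 𝓘(ℝ, E) (𝓘(ℝ, E₁).prod 𝓘(ℝ, E₁ →L[ℝ] ℝ)) ∞
      (Subtype.val : Symplectification (reducedDistribution E₁ Ω D φ) →
        CotangentBundle E₁ (OrbitSpace φ)) :=
  hemb.isImmersion.contMDiff

omit H in
theorem contMDiff_symplectification_proj :
    ContMDiff 𝓘(ℝ, E) 𝓘(ℝ, E₁) ∞ (Symplectification.proj (reducedDistribution E₁ Ω D φ)) :=
  CotangentBundle.contMDiff_proj.comp hemb.isImmersion.contMDiff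

/-- Over the domain of a section `σ`, a covector is `a(β) ε` times the reduced covector at `σ`.
Where `a > 0` it is the image of `φ (log a) (σ c)`, an explicit smooth inverse. -/
theorem isLocalDiffeomorph_symplectificationMap {ε : ℝ} (hε : ε ≠ 0) :
    IsLocalDiffeomorph 𝓘(ℝ, E) 𝓘(ℝ, E) ∞ (H.symplectificationMap hε) := by
  intro m₀
  obtain ⟨U, σ, hσ, hc₀, hσm⟩ := H.exists_section m₀
  set c₀ := OrbitSpace.proj φ m₀ with hc
  set k := extChartAt 𝓘(ℝ, E₁) c₀
  obtain ⟨u, hu⟩ := DFunLike.ne_iff.1 (H.reducedCovector_ne_zero m₀)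
  obtain ⟨w, rfl⟩ := chartSymmDeriv_surjective (mem_extChartAt_target (I := 𝓘(ℝ, E₁)) c₀) u
  -- A vector field with constant coordinates; on `V` the covector at `σ c` does not kill it, so `a`
  -- can be computed as a quotient.
  set W : OrbitSpace φ → E₁ := fun c => chartSymmDeriv E₁ c₀ (k c) w with hW
  set q : OrbitSpace φ → ℝ := fun c => reducedCovector E₁ Ω D φ (σ c) (W c) with hq
  have hqs : ∀ c ∈ U ∩ (chartAt E₁ c₀).source, ContMDiffAt 𝓘(ℝ, E₁) 𝓘(ℝ, ℝ) ∞ q c := fun c hc =>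
    (H.contMDiffAt_reducedCovector_section hσ hc.1 hc.2).clm_apply contMDiffAt_const
  set V : Set (OrbitSpace φ) := (U ∩ (chartAt E₁ c₀).source) ∩ q ⁻¹' {0}ᶜ with hV
  have hVo : IsOpen V := ContinuousOn.isOpen_inter_preimage
    (fun c hc => (hqs c hc).continuousAt.continuousWithinAt)
    (hσ.isOpen.inter (chartAt E₁ c₀).open_source) isOpen_compl_singleton
  set a : Symplectification (reducedDistribution E₁ Ω D φ) → ℝ := fun β =>
    β.1.covector (W β.1.1) / q β.1.1 / ε with ha
  have has : ∀ β : Symplectification (reducedDistribution E₁ Ω D φ), β.1.1 ∈ V →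
      ContMDiffAt 𝓘(ℝ, E) 𝓘(ℝ, ℝ) ∞ a β := fun β hβ => by
    have h1 := contMDiff_symplectification_proj hemb β
    have h2 : ContMDiffAt 𝓘(ℝ, E) 𝓘(ℝ, ℝ) ∞
        (fun β : Symplectification (reducedDistribution E₁ Ω D φ) => q β.1.1) β :=
      ContMDiffAt.comp β (hqs _ hβ.1) h1
    have h3 : ContMDiffAt 𝓘(ℝ, E) 𝓘(ℝ, ℝ) ∞ (fun β : Symplectification
        (reducedDistribution E₁ Ω D φ) => β.1.covector (W β.1.1)) β :=
      (ContMDiffAt.comp β (CotangentBundle.contMDiffAt_covector_comp hβ.1.2)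
        (contMDiff_symplectification_val hemb β)).clm_apply contMDiffAt_const
    exact (h3.div₀ h2 hβ.2).div₀ contMDiffAt_const hε
  have haF : ∀ (m : M) (t : ℝ), OrbitSpace.proj φ m ∈ V →
      φ t (σ (OrbitSpace.proj φ m)) = m → a (H.symplectificationMap hε m) = Real.exp t :=
    fun m t hm ht => by
      have h1 : reducedCovector E₁ Ω D φ m =
          Real.exp t • reducedCovector E₁ Ω D φ (σ (OrbitSpace.proj φ m)) := by
        conv_lhs => rw [← ht]
        exact H.reducedCovector_map t _
      have h2 : ε * reducedCovector E₁ Ω D φ m (W (OrbitSpace.proj φ m)) /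
          q (OrbitSpace.proj φ m) / ε = Real.exp t := by
        have h3 : q (OrbitSpace.proj φ m) ≠ 0 := hm.2
        rw [h1, _root_.smul_apply, smul_eq_mul]
        change ε * (Real.exp t * q (OrbitSpace.proj φ m)) / _ / _ = _
        field_simp
      exact h2
  set G : Symplectification (reducedDistribution E₁ Ω D φ) → M := fun β =>
    φ (Real.log (a β)) (σ β.1.1) with hG
  have hproj : ∀ β : Symplectification (reducedDistribution E₁ Ω D φ), β.1.1 ∈ V →
      OrbitSpace.proj φ (G β) = β.1.1 := fun β hβ =>
    (OrbitSpace.proj_map φ _ _).trans (hσ.apply_eq _ hβ.1.1)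
  set T : Set (Symplectification (reducedDistribution E₁ Ω D φ)) :=
    (Symplectification.proj (reducedDistribution E₁ Ω D φ) ⁻¹' V) ∩ a ⁻¹' Set.Ioi 0 with hT
  have hTo : IsOpen T := ContinuousOn.isOpen_inter_preimage
    (fun β hβ => (has β hβ).continuousAt.continuousWithinAt)
    (hVo.preimage (contMDiff_symplectification_proj hemb).continuous) isOpen_Ioi
  have hF := H.contMDiff_symplectificationMap hemb hε
  refine ⟨⟨⟨H.symplectificationMap hε, G, OrbitSpace.proj φ ⁻¹' V, T, ?_, ?_, ?_, ?_⟩,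
    hVo.preimage H.contMDiff_proj.continuous, hTo, hF.contMDiffOn, ?_⟩, ?_, fun _ _ => rfl⟩
  · intro m hm
    obtain ⟨t, ht⟩ := H.exists_flow_section hσ (m := m) hm.1.1
    refine ⟨hm, ?_⟩
    change 0 < a _
    rw [haF m t hm ht]
    exact Real.exp_pos t
  · intro β hβ
    change OrbitSpace.proj φ (G β) ∈ V
    rw [hproj β hβ.1]
    exact hβ.1
  · intro m hm
    obtain ⟨t, ht⟩ := H.exists_flow_section hσ (m := m) hm.1.1
    change φ (Real.log (a (H.symplectificationMap hε m))) (σ (OrbitSpace.proj φ m)) = m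
    rw [haF m t hm ht, Real.log_exp]
    exact ht
  · intro β hβ
    have hβ1 : β.1.1 ∈ V := hβ.1
    have hβ2 : 0 < a β := hβ.2
    refine Subtype.ext (CotangentBundle.ext (hproj β hβ.1) ?_)
    change ε • reducedCovector E₁ Ω D φ (G β) = β.1.covector
    rw [(H.exists_covector_eq_smul β (hσ.apply_eq _ hβ1.1.1) hβ1.2).2]
    have h1 : reducedCovector E₁ Ω D φ (G β) = a β • reducedCovector E₁ Ω D φ (σ β.1.1) := by
      conv_rhs => rw [← Real.exp_log hβ2]
      exact H.reducedCovector_map _ _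
    rw [h1, smul_smul]
    congr 1
    exact mul_div_cancel₀ _ hε
  · intro β hβ
    have hβ1 : β.1.1 ∈ V := hβ.1
    have hβ2 : 0 < a β := hβ.2
    have h1 : ContMDiffAt 𝓘(ℝ, E) 𝓘(ℝ, ℝ) ∞ (fun β => Real.log (a β)) β :=
      ((Real.contDiffAt_log.2 hβ2.ne').contMDiffAt).comp β (has β hβ1)
    have h2 : ContMDiffAt 𝓘(ℝ, E) 𝓘(ℝ, E) ∞
        (fun β : Symplectification (reducedDistribution E₁ Ω D φ) => σ β.1.1) β :=
      ContMDiffAt.comp β (hσ.contMDiffAt _ hβ1.1.1) (contMDiff_symplectification_proj hemb β)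
    exact (ContMDiffAt.comp β (H.flow.smooth _) (h1.prodMk h2)).contMDiffWithinAt
  · refine ⟨⟨hc₀, mem_chart_source E₁ c₀⟩, ?_⟩
    change reducedCovector E₁ Ω D φ (σ c₀) (chartSymmDeriv E₁ c₀ (k c₀) w) ≠ 0
    rw [hσm]
    exact hu

/-- The map covers `π`, so the canonical form at the image of `m` takes the value of `ε β_m` on `π_*
v`. -/
theorem pullback_symplectificationMap {ε : ℝ} (hε : ε ≠ 0) :
    DiffForm.pullback (E := E) (H.symplectificationMap hε)
      (canonicalForm E (reducedDistribution E₁ Ω D φ)) = ε • DiffForm.interior D Ω := by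
  funext m
  ext v
  have h1 := mfderiv_comp_apply m ((contMDiff_symplectification_proj hemb _).mdifferentiableAt
    (by simp)) ((H.contMDiff_symplectificationMap hemb hε m).mdifferentiableAt (by simp)) (v 0)
  have h2 : ∀ x : E, (ε • reducedCovector E₁ Ω D φ m) (orbitDeriv E E₁ φ m x) =
      ε * Ω.at m ![vectorAt D m, x] := fun x => by
    rw [_root_.smul_apply, H.reducedCovector_apply, smul_eq_mul]
  have h3 : ε * Ω.at m ![vectorAt D m, v 0] = ε * Ω.at m (Matrix.vecCons (vectorAt D m) v) := by
    congr 2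
    ext i
    fin_cases i <;> rfl
  refine Eq.trans ?_ ((h2 (v 0)).trans h3)
  exact congrArg (ε • reducedCovector E₁ Ω D φ m) h1.symm

/-- Every point is in the image of one of the local diffeomorphisms, under which the form becomes `ε
λ` and its derivative `ε ω`. -/
theorem smoothOn_and_isSymplectic_canonicalForm :
    (canonicalForm E (reducedDistribution E₁ Ω D φ)).SmoothOn Set.univ ∧
      (canonicalForm E (reducedDistribution E₁ Ω D φ)).d.IsSymplectic := by
  refine DiffForm.smoothOn_and_isSymplectic_d_of_pullback (E := E) (M := M) fun β => ?_
  obtain ⟨ε, hε, m, hm⟩ := H.exists_symplectificationMap_eq β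
  refine ⟨_, m, hm, H.isLocalDiffeomorph_symplectificationMap hemb hε m, ?_, ?_⟩
  · rw [H.pullback_symplectificationMap hemb hε]
    exact fun x => (H.smoothAt_interior x).const_smul ε
  · rw [H.pullback_symplectificationMap hemb hε, DiffForm.d_const_smul, H.d_interior]
    exact H.symplectic.const_smul hε

end IsReduction

end SymplectificationMap

end

/-! ### Assembly of the theorem. -/

theorem mainTheorem6 (n : ℕ)
    (M : Type*) [TopologicalSpace M] [T2Space M] [SecondCountableTopology M]
    [ChartedSpace (EuclideanSpace ℝ (Fin (2 * n + 2))) M] [IsManifold (𝓡 (2 * n + 2)) ∞ M]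
    (Ω : DiffForm (EuclideanSpace ℝ (Fin (2 * n + 2))) M 2) (hΩ : Ω.IsSymplectic)
    (D : (x : M) → TangentSpace (𝓡 (2 * n + 2)) x)
    (hD : ContMDiff (𝓡 (2 * n + 2)) (𝓡 (2 * n + 2)).tangent ∞
      (fun x => (⟨x, D x⟩ : TangentBundle (𝓡 (2 * n + 2)) M)))
    (φ : Flow ℝ M) (hφ : IsGlobalFlow D φ)
    (hscale : IsLieDerivative φ Ω Ω)
    (hfree : ∀ (t : ℝ) (x : M), φ t x = x → t = 0)
    (hproper : IsProperMap (fun p : ℝ × M => (φ p.1 p.2, p.2))) :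
    -- the quotient is a manifold and the projection is a submersion
    (T2Space (OrbitSpace φ) ∧ SecondCountableTopology (OrbitSpace φ) ∧
      ∃ _ : ChartedSpace (EuclideanSpace ℝ (Fin (2 * n + 1))) (OrbitSpace φ),
        IsManifold (𝓡 (2 * n + 1)) ∞ (OrbitSpace φ) ∧
        Manifold.IsSubmersion (𝓡 (2 * n + 2)) (𝓡 (2 * n + 1)) ∞ (OrbitSpace.proj φ)) ∧
    -- for this smooth structure:
    ∀ [ChartedSpace (EuclideanSpace ℝ (Fin (2 * n + 1))) (OrbitSpace φ)]
      [IsManifold (𝓡 (2 * n + 1)) ∞ (OrbitSpace φ)],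
      Manifold.IsSubmersion (𝓡 (2 * n + 2)) (𝓡 (2 * n + 1)) ∞ (OrbitSpace.proj φ) →
      ∃ 𝒟 : (c : OrbitSpace φ) → Submodule ℝ (TangentSpace (𝓡 (2 * n + 1)) c),
        -- (i) `𝒟 = π_* (ker λ)` is a contact distribution
        (∀ m : M, 𝒟 (OrbitSpace.proj φ m) = (formKer (DiffForm.interior D Ω m)).map
          (mfderiv (𝓡 (2 * n + 2)) (𝓡 (2 * n + 1)) (OrbitSpace.proj φ) m).toLinearMap) ∧
        IsContactDistribution n 𝒟 ∧
        -- (ii) `𝒟` carries a conformal symplectic structure, represented by `dη` for every local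
        -- contact form `η`, and by `Ω` evaluated on lifts to `ker λ`
        (∃ 𝒞 : (c : OrbitSpace φ) → Set (LinearMap.BilinForm ℝ (𝒟 c)),
          IsConformalSymplectic 𝒟 𝒞 ∧
          (∀ (U : Set (OrbitSpace φ))
            (η : DiffForm (EuclideanSpace ℝ (Fin (2 * n + 1))) (OrbitSpace φ) 1),
            IsOpen U → IsContactFormOn n 𝒟 U η →
            ∀ c ∈ U, formRestrict (η.d c) (𝒟 c) ∈ 𝒞 c) ∧
          ∀ m : M, ∃ B ∈ 𝒞 (OrbitSpace.proj φ m),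
            ∀ u₁ u₂ : 𝒟 (OrbitSpace.proj φ m),
            ∀ v₁ ∈ formKer (DiffForm.interior D Ω m), ∀ v₂ ∈ formKer (DiffForm.interior D Ω m),
              mfderiv (𝓡 (2 * n + 2)) (𝓡 (2 * n + 1)) (OrbitSpace.proj φ) m v₁ = u₁ →
              mfderiv (𝓡 (2 * n + 2)) (𝓡 (2 * n + 1)) (OrbitSpace.proj φ) m v₂ = u₂ →
              B u₁ u₂ = Ω m ![v₁, v₂]) ∧
        -- (iii) the symplectification is an embedded submanifold of the cotangent bundle, symplectic
        -- for `dα`, `α` the canonical form, and `m ↦ (π_* v ↦ λ_m v)` is a local diffeomorphism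
        -- into it that pulls `α` back to `λ`, hence `dα` to `dλ`
        ∃ _ : ChartedSpace (EuclideanSpace ℝ (Fin (2 * n + 2))) (Symplectification 𝒟),
          IsManifold (𝓡 (2 * n + 2)) ∞ (Symplectification 𝒟) ∧
          Manifold.IsSmoothEmbedding (𝓡 (2 * n + 2))
            ((𝓡 (2 * n + 1)).prod 𝓘(ℝ, EuclideanSpace ℝ (Fin (2 * n + 1)) →L[ℝ] ℝ)) ∞
            (Subtype.val : Symplectification 𝒟 →
              CotangentBundle (EuclideanSpace ℝ (Fin (2 * n + 1))) (OrbitSpace φ)) ∧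
          (canonicalForm (EuclideanSpace ℝ (Fin (2 * n + 2))) 𝒟).SmoothOn Set.univ ∧
          (canonicalForm (EuclideanSpace ℝ (Fin (2 * n + 2))) 𝒟).d.IsSymplectic ∧
          ∃ F : M → Symplectification 𝒟,
            (∀ m : M, ∃ β : TangentSpace (𝓡 (2 * n + 1)) (OrbitSpace.proj φ m) →L[ℝ] ℝ,
              (F m).1 = ⟨OrbitSpace.proj φ m, β⟩ ∧
              ∀ v : TangentSpace (𝓡 (2 * n + 2)) m,
                β (mfderiv (𝓡 (2 * n + 2)) (𝓡 (2 * n + 1)) (OrbitSpace.proj φ) m v) =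
                  DiffForm.interior D Ω m ![v]) ∧
            IsLocalDiffeomorph (𝓡 (2 * n + 2)) (𝓡 (2 * n + 2)) ∞ F ∧
            DiffForm.pullback F (canonicalForm (EuclideanSpace ℝ (Fin (2 * n + 2))) 𝒟) = DiffForm.interior D Ω ∧
            DiffForm.pullback F (canonicalForm (EuclideanSpace ℝ (Fin (2 * n + 2))) 𝒟).d = (DiffForm.interior D Ω).d := by
  have hne : ∀ x, D x ≠ 0 := IsGlobalFlow.generator_ne_zero hD hφ hfree
  have hdim : Module.finrank ℝ (EuclideanSpace ℝ (Fin (2 * n + 2))) =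
      Module.finrank ℝ (EuclideanSpace ℝ (Fin (2 * n + 1))) + 1 := by simp
  refine ⟨⟨OrbitSpace.t2Space φ hproper, OrbitSpace.secondCountableTopology φ,
    OrbitSpace.exists_chartedSpace (E₁ := EuclideanSpace ℝ (Fin (2 * n + 1))) hdim hD hφ hfree
      hproper⟩, ?_⟩
  intro _ _ hsub
  have H : IsReduction (EuclideanSpace ℝ (Fin (2 * n + 1))) Ω D φ :=
    ⟨hdim, hΩ, hD, hφ, hscale, hne, hsub⟩
  have hsec : ∀ c : OrbitSpace φ, ∃ (U : Set (OrbitSpace φ)) (σ : OrbitSpace φ → M),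
      IsSectionOn (E := EuclideanSpace ℝ (Fin (2 * n + 2)))
        (E₁ := EuclideanSpace ℝ (Fin (2 * n + 1))) (OrbitSpace.proj φ) U σ ∧ c ∈ U := fun c => by
    obtain ⟨U, σ, hσ, hc, -⟩ := H.exists_section c.out
    exact ⟨U, σ, hσ, OrbitSpace.proj_out φ c ▸ hc⟩
  refine ⟨reducedDistribution _ Ω D φ, H.reducedDistribution_proj, fun c => ?_,
    ⟨reducedConformalClass _ Ω D φ, fun c => ?_, ?_, fun m => ?_⟩, ?_⟩
  · obtain ⟨U, σ, hσ, hc⟩ := hsec c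
    exact ⟨U, _, hσ.isOpen, hc, H.isContactFormOn hσ (by simp)⟩
  · obtain ⟨U, σ, hσ, hc⟩ := hsec c
    exact ⟨U, _, hσ.isOpen, hc,
      (DiffForm.smoothOn_iff hσ.isOpen).2 fun y hy => H.smoothAt_pullback_form hσ hy,
      fun y hy => ⟨H.formRestrict_nondegenerate hσ hy, H.reducedConformalClass_eq hσ hy⟩⟩
  · intro V η hV hη c hc
    obtain ⟨U, σ, hσ, hcU⟩ := hsec c
    exact H.formRestrict_d_mem hσ hcU hV hη hc
  · obtain ⟨B, hB, hBΩ⟩ := H.exists_mem_reducedConformalClass m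
    exact ⟨B, hB, fun u₁ u₂ v₁ h₁ v₂ h₂ e₁ e₂ => hBΩ u₁ u₂ v₁ v₂ (H.mem_formKer_interior.1 h₁)
      (H.mem_formKer_interior.1 h₂) e₁ e₂⟩
  -- The complement has dimension `2n = 2(2n + 1) - (2n + 2)`, the codimension of the
  -- symplectification in the cotangent bundle.
  · obtain ⟨i₁, i₂, hemb⟩ := H.isLocallyKernel_reducedDistribution.exists_chartedSpace
      (E := EuclideanSpace ℝ (Fin (2 * n + 2))) (K := EuclideanSpace ℝ (Fin (2 * n))) hdim (by simp)
    obtain ⟨hs, hd⟩ := H.smoothOn_and_isSymplectic_canonicalForm hemb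
    have hF := H.pullback_symplectificationMap hemb one_ne_zero
    rw [one_smul] at hF
    refine ⟨i₁, i₂, hemb, hs, hd, H.symplectificationMap one_ne_zero, fun m => ⟨_, rfl, ?_⟩,
      H.isLocalDiffeomorph_symplectificationMap hemb one_ne_zero, hF, ?_⟩
    · intro v
      have h := H.reducedCovector_apply m v
      rw [← one_smul ℝ (reducedCovector _ Ω D φ m)] at h
      exact h
    · rw [← hF]
      funext m
      exact (DiffForm.d_pullback ((DiffForm.smoothOn_iff isOpen_univ).1 hs _ trivial)
        (H.contMDiff_symplectificationMap hemb one_ne_zero m)).symm
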